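/- Let $C$ be a smooth complex projective curve with field of rational functions $\mathbb C(C)$, let $S=C\times\mathbb P^1$, let $y$ be an affine coordinate on $\mathbb P^1$, and let $X$ be a rational vector field on $S$ tangent to the fibration $S\to C$. Call a rational vector field on a smooth complex projective variety $M$ \emph{birationally integrable} if there are a group morphism $\phi:\mathbb C\to\operatorname{Bir}(M)$ and a Euclidean open set $U\subset\mathbb C\times M$ containing $\{0\}\times W$ for some non-empty Zariski open $W\subset M$, such that the local flow $\varphi_t$ of the vector field is well defined on $U$ and $\varphi_t(p)=\phi(t)(p)$ for all $(t,p)\in U$. Call it \emph{regularizable} if its pull-back by some birational map $M'\dashrightarrow M$, with $M'$ a smooth complex projective variety, is holomorphic on $M'$. Let $\operatorname{Bir}_C(S)$ be the group of birational transformations of $S$ that map each fibre of $S\to C$ to itself. Then $X$ is birationally integrable if and only if $X=(a y^2+2b y+c)\,\partial_y$ with $a,b,c\in\mathbb C(C)$ and $b^2-ac=\kappa^2$ for some constant $\kappa\in\mathbb C$. In that case, for any such $a,b,c,\kappa$: if $\kappa\neq 0$, there is $\phi\in\operatorname{Bir}_C(S)$ with $\phi^*X=2\kappa y\,\partial_y$;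 if $\kappa=0$ and $X\neq 0$, there is $\phi\in\operatorname{Bir}_C(S)$ with $\phi^*X=\partial_y$. In particular, every birationally integrable $X$ tangent to the fibration (including $X=0$) is regularizable. -/

import Mathlib

open scoped LinearAlgebra.Projectivization

noncomputable section

/-- An irreducible complex projective variety `V ⊆ ℙ^ι` with field of rational functions `F = ℂ(V)`,
described by its generic point: `coord` are the homogeneous coordinates of `ℙ^ι` restricted to `V`
(up to a common factor), so that the homogeneous equations of `V` are the homogeneous polynomials
that vanish at `coord`, and `F` is generated over `ℂ` by the ratios of the coordinates. -/
structure ProjVariety (F : Type*) [Field F] [Algebra ℂ F] (ι : Type*) where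
  coord : ι → F
  exists_coord_ne_zero : ∃ i, coord i ≠ 0
  adjoin_eq_top :
    IntermediateField.adjoin ℂ (Set.range fun ij : ι × ι => coord ij.1 / coord ij.2) = ⊤

namespace ProjVariety

variable {F : Type*} [Field F] [Algebra ℂ F] {ι : Type*}

/-- `f` is a homogeneous equation of degree `d` of the variety: it belongs to the homogeneous
ideal of `V`. -/
def IsEquation (V : ProjVariety F ι) (d : ℕ) (f : MvPolynomial ι ℂ) : Prop :=
  f.IsHomogeneous d ∧ MvPolynomial.aeval V.coord f = 0

/-- The (closed) points of the variety: the points of `ℙ^ι(ℂ)` where all its homogeneous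
equations vanish. -/
def Point (V : ProjVariety F ι) : Type _ :=
  {z : ℙ ℂ (ι → ℂ) //
    ∀ (d : ℕ) (f : MvPolynomial ι ℂ), V.IsEquation d f → MvPolynomial.eval z.rep f = 0}

/-- A vector of homogeneous coordinates of a point. -/
def Point.rep {V : ProjVariety F ι} (p : V.Point) : ι → ℂ := p.1.rep

/-- The Euclidean topology of the variety: the topology induced by the quotient topology of
`ℙ^ι(ℂ)`. -/
instance (V : ProjVariety F ι) : TopologicalSpace V.Point :=
  TopologicalSpace.induced (fun p : V.Point => p.1)
    (TopologicalSpace.coinduced (fun v : {v : ι → ℂ // v ≠ 0} => Projectivization.mk' ℂ v)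
      inferInstance)

/-- Zariski open subsets: complements of the common zeros of a family of homogeneous polynomials. -/
def IsZariskiOpen (V : ProjVariety F ι) (W : Set V.Point) : Prop :=
  ∃ T : Set (MvPolynomial ι ℂ), (∀ g ∈ T, ∃ d, g.IsHomogeneous d) ∧
    W = {p | ∃ g ∈ T, MvPolynomial.eval p.rep g ≠ 0}

/-- The rational function `h` is regular at `p`, with value `c` there: `h` is the restriction to
the variety of a quotient `f / g` of homogeneous polynomials of equal degree, `g(p) ≠ 0`,
and `c = f(p) / g(p)`. -/
def HasValue (V : ProjVariety F ι) (p : V.Point) (h : F) (c : ℂ) : Prop :=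
  ∃ (d : ℕ) (f g : MvPolynomial ι ℂ), f.IsHomogeneous d ∧ g.IsHomogeneous d ∧
    MvPolynomial.eval p.rep g ≠ 0 ∧
    h = MvPolynomial.aeval V.coord f / MvPolynomial.aeval V.coord g ∧
    c = MvPolynomial.eval p.rep f / MvPolynomial.eval p.rep g

/-- `h` belongs to the local ring `𝒪_{V,p}`. -/
def IsRegularAt (V : ProjVariety F ι) (p : V.Point) (h : F) : Prop :=
  ∃ c, V.HasValue p h c

open Classical in
/-- The value `h(p)` of a rational function `h` at a point `p` where it is regular. -/
def value (V : ProjVariety F ι) (h : F) (p : V.Point) : ℂ :=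
  if H : V.IsRegularAt p h then H.choose else 0

/-- The dimension of the variety: the transcendence degree of its field of rational functions. -/
def dim (_V : ProjVariety F ι) : ℕ := Cardinal.toNat (Algebra.trdeg ℂ F)

/-- Smoothness, by the Jacobian criterion: at every point the gradients of the homogeneous
equations span a space of dimension `N - dim V`, where `N = |ι| - 1` is the dimension of the
ambient projective space. -/
def IsSmooth [Fintype ι] (V : ProjVariety F ι) : Prop :=
  ∀ p : V.Point,
    Module.finrank ℂ (Submodule.span ℂ
      {w : ι → ℂ | ∃ (d : ℕ) (f : MvPolynomial ι ℂ), V.IsEquation d f ∧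
        w = fun i => MvPolynomial.eval p.rep (MvPolynomial.pderiv i f)}) + V.dim + 1
      = Fintype.card ι

/-- A rational vector field on `V` is a `ℂ`-derivation of its field of rational functions. It is
holomorphic at `p` when it preserves the local ring at `p`. -/
def IsHolomorphicAt (V : ProjVariety F ι) (X : Derivation ℂ F F) (p : V.Point) : Prop :=
  ∀ h : F, V.IsRegularAt p h → V.IsRegularAt p (X h)

/-- The rational vector field `X` is holomorphic on all of `V`. -/
def IsHolomorphic (V : ProjVariety F ι) (X : Derivation ℂ F F) : Prop :=
  ∀ p : V.Point, V.IsHolomorphicAt X p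

end ProjVariety

/-- The group of birational transformations of a variety with field of rational functions `F`.
A birational transformation `φ` is recorded by its action `φ^* h = h ∘ φ` on rational functions;
since `(φ ∘ ψ)^* = ψ^* ∘ φ^*`, the group is the opposite of the group of automorphisms of `F`. -/
abbrev Bir (F : Type*) [Field F] [Algebra ℂ F] : Type _ := (F ≃ₐ[ℂ] F)ᵐᵒᵖ

/-- The pull-back `φ^* : F ≃ F` of rational functions by a birational transformation. -/
def Bir.pullback {F : Type*} [Field F] [Algebra ℂ F] (φ : Bir F) : F ≃ₐ[ℂ] F :=
  MulOpposite.unop φ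

/-- The pull-back `f^* X` of a rational vector field `X` by a birational map `f : V' ⇢ V` whose
action on rational functions is `σ = f^* : ℂ(V) ≃ ℂ(V')`: it is characterised by
`(f^* X)(h ∘ f) = (X h) ∘ f`. -/
def pullbackField {F F' : Type*} [Field F] [Algebra ℂ F] [Field F'] [Algebra ℂ F']
    (σ : F ≃ₐ[ℂ] F') (X : Derivation ℂ F F) : Derivation ℂ F' F' :=
  Derivation.mk' (σ.toLinearMap ∘ₗ (X : F →ₗ[ℂ] F) ∘ₗ σ.symm.toLinearMap) (by
    intro a b
    simp [Derivation.leibniz])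

namespace ProjVariety

variable {F : Type*} [Field F] [Algebra ℂ F] {ι : Type*}

/-- The birational transformation `φ` is defined (regular) at `p` and `φ(p) = q`: for each rational
function `h` regular at `q`, the function `h ∘ φ` is regular at `p` and `(h ∘ φ)(p) = h(q)`. -/
def MapsTo (V : ProjVariety F ι) (φ : Bir F) (p q : V.Point) : Prop :=
  ∀ (h : F) (c : ℂ), V.HasValue q h c → V.HasValue p (φ.pullback h) c

/-- Admissible open subsets of `ℂ × V`: Euclidean open sets containing `{0} × W` for some
non-empty Zariski open subset `W` of `V`. -/
def IsAdmissible (V : ProjVariety F ι) (U : Set (ℂ × V.Point)) : Prop :=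
  IsOpen U ∧ ∃ W : Set V.Point, V.IsZariskiOpen W ∧ W.Nonempty ∧ ∀ p ∈ W, ((0 : ℂ), p) ∈ U

/-- `Φ` is the local flow of the rational vector field `X` on `U ⊆ ℂ × V` and is well-defined there:
for each `p` the set of times `t` with `(t, p) ∈ U` is connected and contains `0` (unless empty),
`Φ` is continuous, `Φ(0, p) = p`, and `t ↦ Φ(t, p)` is an integral curve of `X` that
stays where `X` is holomorphic, that is, `d/dt h(Φ(t, p)) = (X h)(Φ(t, p))` for each rational
function `h` regular at `Φ(t, p)`. -/
structure IsLocalFlow (V : ProjVariety F ι) (X : Derivation ℂ F F) (U : Set (ℂ × V.Point))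
    (Φ : ℂ × V.Point → V.Point) : Prop where
  isPreconnected : ∀ p, IsPreconnected {t : ℂ | (t, p) ∈ U}
  zero_mem : ∀ t p, (t, p) ∈ U → ((0 : ℂ), p) ∈ U
  continuousOn : ContinuousOn Φ U
  map_zero : ∀ p, ((0 : ℂ), p) ∈ U → Φ (0, p) = p
  isHolomorphicAt : ∀ z ∈ U, V.IsHolomorphicAt X (Φ z)
  hasDerivAt : ∀ t p, (t, p) ∈ U → ∀ h : F, V.IsRegularAt (Φ (t, p)) h →
    HasDerivAt (fun s : ℂ => V.value h (Φ (s, p))) (V.value (X h) (Φ (t, p))) t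

/-- Birational integrability of a rational vector field `X` on `V`: there are a group morphism
`φ : ℂ → Bir(V)` and an admissible open set `U` on which the local flow of `X` is well-defined
and coincides with `(t, p) ↦ φ(t)(p)`. -/
def IsBirationallyIntegrable (V : ProjVariety F ι) (X : Derivation ℂ F F) : Prop :=
  ∃ φ : Multiplicative ℂ →* Bir F, ∃ U : Set (ℂ × V.Point), V.IsAdmissible U ∧
    ∃ Φ : ℂ × V.Point → V.Point, V.IsLocalFlow X U Φ ∧
      ∀ t p, (t, p) ∈ U → V.MapsTo (φ (Multiplicative.ofAdd t)) p (Φ (t, p))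

end ProjVariety

/-- A rational vector field `X` on `V` is regularizable if there are a smooth projective variety
`V'` and a birational map `f : V' ⇢ V` such that `f^* X` is holomorphic on `V'`. The definition
involves `V` only through its field of rational functions `F`. -/
def IsRegularizable.{u} {F : Type u} [Field F] [Algebra ℂ F] (X : Derivation ℂ F F) : Prop :=
  ∃ (F' : Type u) (_ : Field F') (_ : Algebra ℂ F') (m : ℕ) (V' : ProjVariety F' (Fin (m + 1)))
    (σ : F ≃ₐ[ℂ] F'), V'.IsSmooth ∧ V'.IsHolomorphic (pullbackField σ X)

section Ruled

variable {K : Type*} [Field K]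

theorem ratFunc_eq_div (h : RatFunc K) : ∃ p q : Polynomial K, q ≠ 0 ∧
    h = algebraMap (Polynomial K) (RatFunc K) p / algebraMap (Polynomial K) (RatFunc K) q :=
  ⟨h.num, h.denom, h.denom_ne_zero, (RatFunc.num_div_denom h).symm⟩

/-- The quotient rule, applied to the reduced fraction of `h`. -/
def ratFuncDeriv (h : RatFunc K) : RatFunc K :=
  (algebraMap (Polynomial K) (RatFunc K) (Polynomial.derivative h.num * h.denom
    - h.num * Polynomial.derivative h.denom))
    / (algebraMap (Polynomial K) (RatFunc K) h.denom) ^ 2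

theorem ratFuncDeriv_div (p q : Polynomial K) (hq : q ≠ 0) :
    ratFuncDeriv (algebraMap (Polynomial K) (RatFunc K) p / algebraMap (Polynomial K) (RatFunc K) q)
      = algebraMap (Polynomial K) (RatFunc K)
          (Polynomial.derivative p * q - p * Polynomial.derivative q)
        / (algebraMap (Polynomial K) (RatFunc K) q) ^ 2 := by
  set h := algebraMap (Polynomial K) (RatFunc K) p / algebraMap (Polynomial K) (RatFunc K) q with hh
  have inj := RatFunc.algebraMap_injective K
  have hq' : algebraMap (Polynomial K) (RatFunc K) q ≠ 0 := RatFunc.algebraMap_ne_zero hq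
  have hd : h.denom ≠ 0 := h.denom_ne_zero
  have hd' : algebraMap (Polynomial K) (RatFunc K) h.denom ≠ 0 := RatFunc.algebraMap_ne_zero hd
  have key : h.num * q = p * h.denom := by
    apply inj
    have h1 := RatFunc.num_div_denom h
    rw [hh] at h1
    rw [← hh, div_eq_div_iff hd' hq'] at h1
    simpa using h1
  have key' : Polynomial.derivative h.num * q + h.num * Polynomial.derivative q
      = Polynomial.derivative p * h.denom + p * Polynomial.derivative h.denom := by
    simpa using congrArg Polynomial.derivative key
  unfold ratFuncDeriv
  rw [div_eq_div_iff (pow_ne_zero 2 hd') (pow_ne_zero 2 hq'), ← map_pow, ← map_pow, ← map_mul,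
    ← map_mul]
  congr 1
  linear_combination (q * h.denom) * key' - (Polynomial.derivative h.denom * q
    + h.denom * Polynomial.derivative q) * key

theorem ratFuncDeriv_add (f g : RatFunc K) :
    ratFuncDeriv (f + g) = ratFuncDeriv f + ratFuncDeriv g := by
  obtain ⟨p, q, hq, rfl⟩ := ratFunc_eq_div f
  obtain ⟨r, s, hs, rfl⟩ := ratFunc_eq_div g
  have hq' := RatFunc.algebraMap_ne_zero (K := K) hq
  have hs' := RatFunc.algebraMap_ne_zero (K := K) hs
  rw [div_add_div _ _ hq' hs', ← map_mul, ← map_mul, ← map_mul, ← map_add,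
    ratFuncDeriv_div _ _ (mul_ne_zero hq hs), ratFuncDeriv_div _ _ hq,
    ratFuncDeriv_div _ _ hs]
  simp only [map_sub, map_add, map_mul, Polynomial.derivative_mul]
  field_simp
  ring

theorem ratFuncDeriv_mul (f g : RatFunc K) :
    ratFuncDeriv (f * g) = f * ratFuncDeriv g + g * ratFuncDeriv f := by
  obtain ⟨p, q, hq, rfl⟩ := ratFunc_eq_div f
  obtain ⟨r, s, hs, rfl⟩ := ratFunc_eq_div g
  have hq' := RatFunc.algebraMap_ne_zero (K := K) hq
  have hs' := RatFunc.algebraMap_ne_zero (K := K) hs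
  rw [div_mul_div_comm, ← map_mul, ← map_mul,
    ratFuncDeriv_div _ _ (mul_ne_zero hq hs), ratFuncDeriv_div _ _ hq,
    ratFuncDeriv_div _ _ hs]
  simp only [map_sub, map_add, map_mul, Polynomial.derivative_mul]
  field_simp
  ring

theorem ratFuncDeriv_C (c : K) : ratFuncDeriv (RatFunc.C c) = 0 := by
  simpa using ratFuncDeriv_div (Polynomial.C c) 1 one_ne_zero

theorem ratFuncDeriv_smul (c : K) (f : RatFunc K) :
    ratFuncDeriv (c • f) = c • ratFuncDeriv f := by
  rw [RatFunc.smul_eq_C_mul, RatFunc.smul_eq_C_mul, ratFuncDeriv_mul, ratFuncDeriv_C, mul_zero,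
    add_zero]

/-- The `K`-derivation `∂_y` of `K(y)`. -/
def ratFuncDerivation : Derivation K (RatFunc K) (RatFunc K) :=
  Derivation.mk'
    { toFun := ratFuncDeriv
      map_add' := ratFuncDeriv_add
      map_smul' := ratFuncDeriv_smul }
    ratFuncDeriv_mul

variable [Algebra ℂ K]

/-- The vertical rational vector field `∂_y` on `C × ℙ¹`, where `K = ℂ(C)`, so that
`ℂ(C × ℙ¹) = K(y)`. -/
def ddy : Derivation ℂ (RatFunc K) (RatFunc K) := ratFuncDerivation.restrictScalars ℂ

/-- The rational vector field `X` on `C × ℙ¹` is tangent to the fibration `C × ℙ¹ → C`: it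
kills the rational functions that come from `C`. -/
def IsTangentToFibration (X : Derivation ℂ (RatFunc K) (RatFunc K)) : Prop :=
  ∀ k : K, X (RatFunc.C k) = 0

/-- The group `Bir_C(C × ℙ¹)`: the birational transformations of `C × ℙ¹` that map each fibre of
`C × ℙ¹ → C` to itself, that is, that preserve the rational functions that come from `C`. -/
def IsOverBase (φ : Bir (RatFunc K)) : Prop :=
  ∀ k : K, φ.pullback (RatFunc.C k) = RatFunc.C k

/-- The ruled surface `C × ℙ¹`, for `C ⊆ ℙ^ι`, with field of rational functions `K(y)`, embedded
by the Segre map: if `x_i` are the homogeneous coordinates on `C` and `[1 : y]` those on `ℙ¹`,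
the homogeneous coordinates are `x_i` and `x_i y`. -/
def ProjVariety.prodP1 {ι : Type*} (C : ProjVariety K ι) :
    ProjVariety (RatFunc K) (ι × Fin 2) where
  coord ij := RatFunc.C (C.coord ij.1) * ![1, RatFunc.X] ij.2
  exists_coord_ne_zero := by
    obtain ⟨i, hi⟩ := C.exists_coord_ne_zero
    exact ⟨(i, 0), by simpa using hi⟩
  adjoin_eq_top := by
    set E := IntermediateField.adjoin ℂ (Set.range fun ij : (ι × Fin 2) × (ι × Fin 2) =>
      (RatFunc.C (C.coord ij.1.1) * ![1, RatFunc.X] ij.1.2 : RatFunc K)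
        / (RatFunc.C (C.coord ij.2.1) * ![1, RatFunc.X] ij.2.2)) with hE
    have hK : ∀ k : K, RatFunc.C k ∈ E := by
      let ψ : K →ₐ[ℂ] RatFunc K := IsScalarTower.toAlgHom ℂ K (RatFunc K)
      have hle : (⊤ : IntermediateField ℂ K) ≤ E.comap ψ := by
        rw [← C.adjoin_eq_top, IntermediateField.adjoin_le_iff]
        rintro _ ⟨⟨i, j⟩, rfl⟩
        change RatFunc.C (C.coord i / C.coord j) ∈ E
        refine IntermediateField.subset_adjoin ℂ _ ⟨((i, 0), (j, 0)), ?_⟩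
        simp
      intro k
      exact hle (IntermediateField.mem_top (x := k))
    have hX : (RatFunc.X : RatFunc K) ∈ E := by
      obtain ⟨i, hi⟩ := C.exists_coord_ne_zero
      refine IntermediateField.subset_adjoin ℂ _ ⟨((i, 1), (i, 0)), ?_⟩
      have : (RatFunc.C (C.coord i) : RatFunc K) ≠ 0 := by simpa using hi
      simp [this]
    have hP : ∀ p : Polynomial K, algebraMap (Polynomial K) (RatFunc K) p ∈ E := by
      intro p
      induction p using Polynomial.induction_on' with
      | add p q hp hq => rw [map_add]; exact add_mem hp hq
      | monomial n a =>
        rw [← Polynomial.C_mul_X_pow_eq_monomial, map_mul, map_pow, RatFunc.algebraMap_C,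
          RatFunc.algebraMap_X]
        exact mul_mem (hK a) (pow_mem hX n)
    rw [eq_top_iff]
    intro h _
    rw [← RatFunc.num_div_denom h]
    exact div_mem (hP _) (hP _)

end Ruled

end

noncomputable section

/-! Since `X` kills `K = ℂ(C)`, it equals `f ∂_y` with `f = X y`, and everything depends on `f`.

From integrability to the quadratic form. By Noether normalisation an affine chart of `C` carries a
family of points indexed by `z ∈ ℂ` such that a nonzero function vanishes at finitely many of them
(`exists_points_of_trdeg_eq_one`). A countability argument makes the time of existence of the flow
uniform over uncountably many `z` and infinitely many `v` in each fibre. Identities between rational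
functions can then be tested at these points (`eq_zero_of_hasValue_zero`). The flow stays in the
fibres, so `φ(t)` fixes `K` for small `t`, hence for all `t` because `φ(t) = φ(t/n)^n`. An
automorphism of `K(y)` over `K` is a homography, and homographies preserve cross-ratios.
Differentiating this at time zero shows that `f` has degree at most two in `y` on almost every fibre
(`exists_quadratic_of_homography_flow`), hence globally.

The discriminant is constant. The quantity `u = tr²/det - 2` depends only on a homography, and
`u(g²) = u(g)² - 2`. Applied to `φ(t/2^j)`, this gives an infinite backward orbit of `x ↦ x² - 2` in
`K`. A nonconstant one would yield a strictly increasing tower of subfields inside a finite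
extension (`mem_range_algebraMap_of_sq_sub_two`), so `tr²/det` of `φ(t)` is a constant `m`. On a
fibre the flow solves a Riccati equation, so it is the exponential of a trace-free matrix
(`riccati_eq_homography`) and `m = 4 cosh²(rt)`, where `r²` is the discriminant there. For fixed `t
≠ 0` this leaves countably many values of `r²`, and a nonconstant function on a curve takes each
value finitely often.

Conversely, if `b² - ac = κ²`, the matrix `A = (b, c; -a, -b)` satisfies `A² = κ²`, and its
exponential is a one-parameter group of homographies over `K` realising the flow. The roots of the
quadratic lie in `ℙ¹(K)` because `κ` is constant. Sending them to `0` and `∞` (or a double root to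
`∞`) gives the normal forms, which are holomorphic on the smooth surface `C × ℙ¹`. -/

/-- A homogeneous polynomial of degree `d` scales by `c ^ d` under dilation by `c`. -/
theorem MvPolynomial.IsHomogeneous.aeval_const_mul {ι R : Type*} [CommRing R] [Algebra ℂ R]
    {f : MvPolynomial ι ℂ} {d : ℕ} (hf : f.IsHomogeneous d) (c : R) (x : ι → R) :
    MvPolynomial.aeval (fun j => c * x j) f = c ^ d * MvPolynomial.aeval x f := by
  rw [MvPolynomial.aeval_def, MvPolynomial.aeval_def, MvPolynomial.eval₂_eq, MvPolynomial.eval₂_eq,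
    Finset.mul_sum]
  refine Finset.sum_congr rfl fun m hm => ?_
  have hd : ∑ i ∈ m.support, m i = d := by
    have := hf (MvPolynomial.mem_support_iff.1 hm)
    rw [← this, show (1 : ι → ℕ) = fun _ => 1 from rfl, ← Finsupp.degree_eq_weight_one]
    rfl
  rw [Finset.prod_congr rfl fun i _ => mul_pow c (x i) (m i), Finset.prod_mul_distrib,
    Finset.prod_pow_eq_pow_sum, hd]
  ring

/-! ### Values of rational functions and reduction to affine charts -/

namespace ProjVariety

variable {F : Type*} [Field F] [Algebra ℂ F] {ι : Type*} (V : ProjVariety F ι)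

theorem Point.rep_ne_zero {V : ProjVariety F ι} (p : V.Point) : ∃ i, p.rep i ≠ 0 :=
  Function.ne_iff.1 p.1.rep_nonzero

variable {V} {p : V.Point}

/-- A form vanishing at the generic point is an equation, so it vanishes at every closed point. This
contrapositive legitimates the denominators in `HasValue`. -/
theorem aeval_coord_ne_zero {d : ℕ} {g : MvPolynomial ι ℂ} (hg : g.IsHomogeneous d)
    (h : MvPolynomial.eval p.rep g ≠ 0) : MvPolynomial.aeval V.coord g ≠ 0 :=
  fun h0 => h (p.2 d g ⟨hg, h0⟩)

theorem coord_ne_zero {i : ι} (h : p.rep i ≠ 0) : V.coord i ≠ 0 := by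
  simpa using aeval_coord_ne_zero (V := V) (p := p) (MvPolynomial.isHomogeneous_X ℂ i)
    (by simpa using h)

/-- Cross-multiplying two presentations of `h` gives a form that vanishes at the generic point,
hence at `p`. So `value` does not depend on the choice in its definition. -/
theorem HasValue.unique {h : F} {c c' : ℂ} (H : V.HasValue p h c) (H' : V.HasValue p h c') :
    c = c' := by
  obtain ⟨d, f, g, hf, hg, hg0, rfl, rfl⟩ := H
  obtain ⟨d', f', g', hf', hg', hg0', e, rfl⟩ := H'
  rw [div_eq_div_iff (aeval_coord_ne_zero hg hg0) (aeval_coord_ne_zero hg' hg0')] at e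
  rw [div_eq_div_iff hg0 hg0', ← sub_eq_zero]
  have := p.2 (d + d') (f * g' - f' * g)
    ⟨(hf.mul hg').sub (by rw [add_comm]; exact hf'.mul hg), by simp [e]⟩
  simpa [Point.rep] using this

theorem HasValue.add {h h' : F} {c c' : ℂ} (H : V.HasValue p h c) (H' : V.HasValue p h' c') :
    V.HasValue p (h + h') (c + c') := by
  obtain ⟨d, f, g, hf, hg, hg0, rfl, rfl⟩ := H
  obtain ⟨d', f', g', hf', hg', hg0', rfl, rfl⟩ := H'
  refine ⟨d + d', f * g' + g * f', g * g', (hf.mul hg').add (hg.mul hf'), hg.mul hg', ?_, ?_, ?_⟩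
  · simpa using ⟨hg0, hg0'⟩
  · rw [div_add_div _ _ (aeval_coord_ne_zero hg hg0) (aeval_coord_ne_zero hg' hg0')]; simp
  · rw [div_add_div _ _ hg0 hg0']; simp

theorem HasValue.mul {h h' : F} {c c' : ℂ} (H : V.HasValue p h c) (H' : V.HasValue p h' c') :
    V.HasValue p (h * h') (c * c') := by
  obtain ⟨d, f, g, hf, hg, hg0, rfl, rfl⟩ := H
  obtain ⟨d', f', g', hf', hg', hg0', rfl, rfl⟩ := H'
  refine ⟨d + d', f * f', g * g', hf.mul hf', hg.mul hg', ?_, ?_, ?_⟩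
  · simpa using ⟨hg0, hg0'⟩
  · rw [div_mul_div_comm]; simp
  · rw [div_mul_div_comm]; simp

theorem HasValue.algebraMap (c : ℂ) : V.HasValue p (algebraMap ℂ F c) c :=
  ⟨0, MvPolynomial.C c, 1, MvPolynomial.isHomogeneous_C _ _, MvPolynomial.isHomogeneous_one _ _,
    by simp, by simp, by simp⟩

theorem HasValue.zero : V.HasValue p 0 0 := by simpa using HasValue.algebraMap (V := V) (p := p) 0

theorem HasValue.one : V.HasValue p 1 1 := by simpa using HasValue.algebraMap (V := V) (p := p) 1

theorem HasValue.neg {h : F} {c : ℂ} (H : V.HasValue p h c) : V.HasValue p (-h) (-c) := by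
  simpa using (HasValue.algebraMap (V := V) (p := p) (-1)).mul H

theorem HasValue.sub {h h' : F} {c c' : ℂ} (H : V.HasValue p h c) (H' : V.HasValue p h' c') :
    V.HasValue p (h - h') (c - c') := by
  simpa [sub_eq_add_neg] using H.add H'.neg

theorem HasValue.inv {h : F} {c : ℂ} (H : V.HasValue p h c) (hc : c ≠ 0) :
    V.HasValue p h⁻¹ c⁻¹ := by
  obtain ⟨d, f, g, hf, hg, hg0, rfl, rfl⟩ := H
  exact ⟨d, g, f, hg, hf, (div_ne_zero_iff.1 hc).1, by rw [inv_div], by rw [inv_div]⟩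

theorem HasValue.div {h h' : F} {c c' : ℂ} (H : V.HasValue p h c) (H' : V.HasValue p h' c')
    (hc : c' ≠ 0) : V.HasValue p (h / h') (c / c') := by
  simpa [div_eq_mul_inv] using H.mul (H'.inv hc)

theorem HasValue.coord_div {i : ι} (hi : p.rep i ≠ 0) (j : ι) :
    V.HasValue p (V.coord j / V.coord i) (p.rep j / p.rep i) :=
  ⟨1, MvPolynomial.X j, MvPolynomial.X i, MvPolynomial.isHomogeneous_X _ _,
    MvPolynomial.isHomogeneous_X _ _, by simpa using hi, by simp, by simp⟩

theorem HasValue.aeval {τ : Type*} {y : τ → F} {b : τ → ℂ} (H : ∀ j, V.HasValue p (y j) (b j))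
    (f : MvPolynomial τ ℂ) : V.HasValue p (MvPolynomial.aeval y f) (MvPolynomial.eval b f) := by
  induction f using MvPolynomial.induction_on with
  | C a => simpa using HasValue.algebraMap a
  | add f g hf hg => simpa using hf.add hg
  | mul_X f j hf => simpa using hf.mul (H j)

theorem HasValue.isRegularAt {h : F} {c : ℂ} (H : V.HasValue p h c) : V.IsRegularAt p h := ⟨c, H⟩

theorem IsRegularAt.hasValue {h : F} (H : V.IsRegularAt p h) : V.HasValue p h (V.value h p) := by
  rw [value, dif_pos H]
  exact H.choose_spec

theorem HasValue.value_eq {h : F} {c : ℂ} (H : V.HasValue p h c) : V.value h p = c :=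
  H.isRegularAt.hasValue.unique H

theorem IsRegularAt.add {h h' : F} (H : V.IsRegularAt p h) (H' : V.IsRegularAt p h') :
    V.IsRegularAt p (h + h') := (H.hasValue.add H'.hasValue).isRegularAt

theorem IsRegularAt.mul {h h' : F} (H : V.IsRegularAt p h) (H' : V.IsRegularAt p h') :
    V.IsRegularAt p (h * h') := (H.hasValue.mul H'.hasValue).isRegularAt

/-- Regular functions are quotients of polynomials in the affine coordinates of a chart. -/
theorem HasValue.exists_chart {h : F} {c : ℂ} (H : V.HasValue p h c) (i : ι) (hi : p.rep i ≠ 0) :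
    ∃ f g : MvPolynomial ι ℂ,
      h = MvPolynomial.aeval (fun j => V.coord j / V.coord i) f
        / MvPolynomial.aeval (fun j => V.coord j / V.coord i) g ∧
      MvPolynomial.eval (fun j => p.rep j / p.rep i) g ≠ 0 ∧
      c = MvPolynomial.eval (fun j => p.rep j / p.rep i) f
        / MvPolynomial.eval (fun j => p.rep j / p.rep i) g := by
  obtain ⟨d, f, g, hf, hg, hg0, rfl, rfl⟩ := H
  have hci := coord_ne_zero hi
  -- Dehomogenisation multiplies numerator and denominator by the same power, since both have degree
  -- `d`.
  have key : ∀ f : MvPolynomial ι ℂ, f.IsHomogeneous d →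
      MvPolynomial.aeval (fun j => V.coord j / V.coord i) f
        = (V.coord i)⁻¹ ^ d * MvPolynomial.aeval V.coord f := fun f hf => by
    rw [← hf.aeval_const_mul]; simp [div_eq_inv_mul]
  have key' : ∀ f : MvPolynomial ι ℂ, f.IsHomogeneous d →
      MvPolynomial.eval (fun j => p.rep j / p.rep i) f
        = (p.rep i)⁻¹ ^ d * MvPolynomial.eval p.rep f := fun f hf => by
    have := hf.aeval_const_mul (p.rep i)⁻¹ p.rep
    simpa [div_eq_inv_mul, MvPolynomial.aeval_eq_eval] using this
  refine ⟨f, g, ?_, ?_, ?_⟩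
  · rw [key f hf, key g hg, mul_div_mul_left _ _ (pow_ne_zero _ (inv_ne_zero hci))]
  · rw [key' g hg]
    exact mul_ne_zero (pow_ne_zero _ (inv_ne_zero hi)) hg0
  · rw [key' f hf, key' g hg, mul_div_mul_left _ _ (pow_ne_zero _ (inv_ne_zero hi))]

/-- It suffices to check `φ(p) = q` on the affine coordinates of a chart around `q`. -/
theorem mapsTo_of_coord {φ : Bir F} {q : V.Point} {i : ι} (hi : q.rep i ≠ 0)
    (H : ∀ j, V.HasValue p (φ.pullback (V.coord j / V.coord i)) (q.rep j / q.rep i)) :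
    V.MapsTo φ p q := by
  intro h c hc
  obtain ⟨f, g, rfl, hg0, rfl⟩ := hc.exists_chart i hi
  have key : ∀ f : MvPolynomial ι ℂ,
      φ.pullback (MvPolynomial.aeval (fun j => V.coord j / V.coord i) f)
        = MvPolynomial.aeval (fun j => φ.pullback (V.coord j / V.coord i)) f := fun f => by
    have := MvPolynomial.comp_aeval_apply (fun j => V.coord j / V.coord i)
      (φ.pullback : F →ₐ[ℂ] F) f
    simpa using this
  rw [map_div₀, key, key]
  exact (HasValue.aeval H f).div (HasValue.aeval H g) hg0

theorem isRegularAt_derivation_aeval {τ : Type*} {X : Derivation ℂ F F} {y : τ → F}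
    (hy : ∀ j, V.IsRegularAt p (y j)) (hX : ∀ j, V.IsRegularAt p (X (y j)))
    (f : MvPolynomial τ ℂ) : V.IsRegularAt p (X (MvPolynomial.aeval y f)) := by
  induction f using MvPolynomial.induction_on with
  | C a => simpa using HasValue.zero.isRegularAt
  | add f g hf hg => simpa using hf.add hg
  | mul_X f j hf =>
    have := (HasValue.aeval (fun j => (hy j).hasValue) f).isRegularAt
    simpa [Derivation.leibniz] using (this.mul (hX j)).add ((hy j).mul hf)

/-- It suffices to check holomorphy at `p` on the affine coordinates of a chart around `p`. -/
theorem isHolomorphicAt_of_coord {X : Derivation ℂ F F} {i : ι} (hi : p.rep i ≠ 0)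
    (H : ∀ j, V.IsRegularAt p (X (V.coord j / V.coord i))) : V.IsHolomorphicAt X p := by
  rintro h ⟨c, hc⟩
  obtain ⟨f, g, rfl, hg0, rfl⟩ := hc.exists_chart i hi
  have hy : ∀ j, V.HasValue p (V.coord j / V.coord i) (p.rep j / p.rep i) := HasValue.coord_div hi
  have hyr := fun j => (hy j).isRegularAt
  have hf := (isRegularAt_derivation_aeval hyr H f).hasValue
  have hg := (isRegularAt_derivation_aeval hyr H g).hasValue
  rw [Derivation.leibniz_div]
  have h1 := (HasValue.aeval hy g).inv hg0
  have := ((h1.mul h1).mul (((HasValue.aeval hy g).mul hf).sub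
    ((HasValue.aeval hy f).mul hg))).isRegularAt
  simpa [pow_two] using this

/-- The derivative along a curve of every regular function is determined by that of the affine
coordinates of a chart. -/
theorem hasDerivAt_value_of_coord {X : Derivation ℂ F F} {r : ℂ → V.Point} {t : ℂ} {i : ι}
    (hi : ∀ᶠ s in nhds t, (r s).rep i ≠ 0)
    (H : ∀ j, ∃ c, V.HasValue (r t) (X (V.coord j / V.coord i)) c ∧
      HasDerivAt (fun s => (r s).rep j / (r s).rep i) c t)
    {h : F} (hh : V.IsRegularAt (r t) h) :
    HasDerivAt (fun s => V.value h (r s)) (V.value (X h) (r t)) t := by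
  obtain ⟨c, hc⟩ := hh
  obtain ⟨f, g, rfl, hg0, rfl⟩ := hc.exists_chart i hi.self_of_nhds
  have hy : ∀ j, V.HasValue (r t) (V.coord j / V.coord i) ((r t).rep j / (r t).rep i) :=
    HasValue.coord_div hi.self_of_nhds
  -- The single number `c` is both the value of `X f` and the derivative of `f` along the curve.
  -- Both operations obey the Leibniz rule, so agreement on coordinates propagates.
  have key : ∀ f : MvPolynomial ι ℂ, ∃ c,
      V.HasValue (r t) (X (MvPolynomial.aeval (fun j => V.coord j / V.coord i) f)) c ∧
      HasDerivAt (fun s => MvPolynomial.eval (fun j => (r s).rep j / (r s).rep i) f) c t := by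
    intro f
    induction f using MvPolynomial.induction_on with
    | C a => exact ⟨0, by simpa using HasValue.zero, by simpa using hasDerivAt_const t a⟩
    | add f g hf hg =>
      obtain ⟨a, ha, ha'⟩ := hf
      obtain ⟨b, hb, hb'⟩ := hg
      exact ⟨a + b, by simpa using ha.add hb, by simp only [map_add]; exact ha'.add hb'⟩
    | mul_X f j hf =>
      obtain ⟨a, ha, ha'⟩ := hf
      obtain ⟨b, hb, hb'⟩ := H j
      refine ⟨_, ?_, by simp only [map_mul, MvPolynomial.eval_X]; exact ha'.mul hb'⟩
      have := ((hy j).mul ha).add ((HasValue.aeval hy f).mul hb)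
      rw [map_mul, MvPolynomial.aeval_X, Derivation.leibniz, smul_eq_mul, smul_eq_mul,
        add_comm]
      convert! this using 1
      ring
  obtain ⟨a, ha, ha'⟩ := key f
  obtain ⟨b, hb, hb'⟩ := key g
  have h1 := (HasValue.aeval hy g).inv hg0
  have hv := (h1.mul h1).mul (((HasValue.aeval hy g).mul ha).sub ((HasValue.aeval hy f).mul hb))
  rw [Derivation.leibniz_div, smul_eq_mul, smul_eq_mul, smul_eq_mul, pow_two, hv.value_eq]
  have hd := ha'.div hb' hg0
  have hne := hb'.continuousAt.eventually_ne hg0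
  -- `value` is defined by choice; near `t` it coincides with the explicit quotient, which can be
  -- differentiated.
  refine HasDerivAt.congr_of_eventuallyEq ?_ (f := fun s =>
    MvPolynomial.eval (fun j => (r s).rep j / (r s).rep i) f
      / MvPolynomial.eval (fun j => (r s).rep j / (r s).rep i) g) ?_
  · convert! hd using 1
    field_simp
  · filter_upwards [hi, hne] with s hs hs'
    exact ((HasValue.aeval (HasValue.coord_div hs) f).div
      (HasValue.aeval (HasValue.coord_div hs) g) hs').value_eq

end ProjVariety

/-! ### Derivations and homographies of `K(y)` -/

section Ruled

variable {K : Type*} [Field K]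

theorem RatFunc.C_mul_X_add_C_ne_zero {c d : K} (h : c ≠ 0 ∨ d ≠ 0) :
    (RatFunc.C c * RatFunc.X + RatFunc.C d : RatFunc K) ≠ 0 := by
  intro h0
  have : algebraMap (Polynomial K) (RatFunc K) (Polynomial.C c * Polynomial.X + Polynomial.C d)
      = 0 := by simpa using h0
  rw [map_eq_zero_iff _ (RatFunc.algebraMap_injective K)] at this
  have h1 := congrArg (fun p => Polynomial.coeff p 1) this
  have h2 := congrArg (fun p => Polynomial.coeff p 0) this
  simp at h1 h2
  tauto

/-- Proportionality of two invertible homographies which agree. -/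
theorem exists_smul_of_homography_eq {a b c d a' b' c' d' : K} (hdet : a * d - b * c ≠ 0)
    (h2 : a * c' = a' * c) (h1 : a * d' + b * c' = a' * d + b' * c) (h0 : b * d' = b' * d) :
    ∃ l : K, a' = l * a ∧ b' = l * b ∧ c' = l * c ∧ d' = l * d := by
  have e1 : ∃ l, a' = l * a ∧ c' = l * c := by
    by_cases ha : a = 0
    · have hc : c ≠ 0 := by rintro rfl; simp [ha] at hdet
      refine ⟨c' / c, ?_, by field_simp⟩
      simp [ha, hc] at h2
      simp [ha, h2]
    · exact ⟨a' / a, by field_simp, by field_simp; linear_combination h2⟩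
  have e2 : ∃ l, b' = l * b ∧ d' = l * d := by
    by_cases hb : b = 0
    · have hd : d ≠ 0 := by rintro rfl; simp [hb] at hdet
      refine ⟨d' / d, ?_, by field_simp⟩
      simp [hb, hd] at h0
      simp [hb, h0]
    · exact ⟨b' / b, by field_simp, by field_simp; linear_combination h0⟩
  obtain ⟨l, rfl, rfl⟩ := e1
  obtain ⟨m, rfl, rfl⟩ := e2
  -- With first column scaled by `l` and second by `m`, the hypothesis `h1` reads `(m - l) * det =
  -- 0`.
  have : m = l := by
    apply mul_right_cancel₀ hdet
    linear_combination h1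
  subst this
  exact ⟨m, rfl, rfl, rfl, rfl⟩

/-- Both `tr²` and `det` are multiplied by `l²` when the matrix is multiplied by `l`, so `tr²/det`
is an invariant of the homography itself. -/
theorem trace_sq_mul_det_eq {a b c d a' b' c' d' : K} (hdet : a * d - b * c ≠ 0)
    (h2 : a * c' = a' * c) (h1 : a * d' + b * c' = a' * d + b' * c) (h0 : b * d' = b' * d) :
    (a + d) ^ 2 * (a' * d' - b' * c') = (a' + d') ^ 2 * (a * d - b * c) := by
  obtain ⟨l, rfl, rfl, rfl, rfl⟩ := exists_smul_of_homography_eq hdet h2 h1 h0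
  ring

theorem coeff_eq_of_homography_eq {a b c d a' b' c' d' : K}
    (h : ((RatFunc.C a * RatFunc.X + RatFunc.C b) * (RatFunc.C c' * RatFunc.X + RatFunc.C d') :
        RatFunc K)
      = (RatFunc.C a' * RatFunc.X + RatFunc.C b') * (RatFunc.C c * RatFunc.X + RatFunc.C d)) :
    a * c' = a' * c ∧ a * d' + b * c' = a' * d + b' * c ∧ b * d' = b' * d := by
  have : (Polynomial.C (a * c') * Polynomial.X ^ 2 + Polynomial.C (a * d' + b * c') * Polynomial.X
        + Polynomial.C (b * d'))
      = (Polynomial.C (a' * c) * Polynomial.X ^ 2 + Polynomial.C (a' * d + b' * c) * Polynomial.X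
        + Polynomial.C (b' * d)) := by
    apply RatFunc.algebraMap_injective K
    simp only [map_add, map_mul, map_pow, RatFunc.algebraMap_C, RatFunc.algebraMap_X]
    linear_combination h
  have h2 := congrArg (fun p => Polynomial.coeff p 2) this
  have h1 := congrArg (fun p => Polynomial.coeff p 1) this
  have h0 := congrArg (fun p => Polynomial.coeff p 0) this
  simp only [Polynomial.coeff_add, Polynomial.coeff_C_mul, Polynomial.coeff_X_pow,
    Polynomial.coeff_X, Polynomial.coeff_C] at h0 h1 h2
  norm_num at h0 h1 h2
  exact ⟨h2, h1, h0⟩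

theorem denom_ne_zero_of_det_ne_zero {M : Matrix (Fin 2) (Fin 2) K} (hM : M.det ≠ 0) :
    (RatFunc.C (M 1 0) * RatFunc.X + RatFunc.C (M 1 1) : RatFunc K) ≠ 0 := by
  apply RatFunc.C_mul_X_add_C_ne_zero
  by_contra! h
  exact hM (by simp [Matrix.det_fin_two, h.1, h.2])

variable [Algebra ℂ K]

theorem ddy_apply (h : RatFunc K) : ddy h = ratFuncDeriv h := rfl

@[simp]
theorem ddy_C (k : K) : ddy (RatFunc.C k) = 0 := ratFuncDeriv_C k

theorem ddy_algebraMap (p : Polynomial K) :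
    ddy (algebraMap (Polynomial K) (RatFunc K) p)
      = algebraMap (Polynomial K) (RatFunc K) (Polynomial.derivative p) := by
  simpa [ddy_apply] using ratFuncDeriv_div p 1 one_ne_zero

@[simp]
theorem ddy_X : ddy (RatFunc.X : RatFunc K) = 1 := by
  simpa using ddy_algebraMap (Polynomial.X : Polynomial K)

theorem IsTangentToFibration.eq_smul {X : Derivation ℂ (RatFunc K) (RatFunc K)}
    (hX : IsTangentToFibration X) : X = X RatFunc.X • ddy := by
  have hp : ∀ p : Polynomial K, X (algebraMap (Polynomial K) (RatFunc K) p)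
      = X RatFunc.X * ddy (algebraMap (Polynomial K) (RatFunc K) p) := by
    intro p
    induction p using Polynomial.induction_on' with
    | add p q hp hq => simp only [map_add, hp, hq, mul_add]
    | monomial n a =>
      rw [← Polynomial.C_mul_X_pow_eq_monomial, map_mul, map_pow, RatFunc.algebraMap_C,
        RatFunc.algebraMap_X]
      simp only [Derivation.leibniz, Derivation.leibniz_pow, hX a, ddy_C, ddy_X, smul_eq_mul,
        nsmul_eq_mul, mul_zero, add_zero]
      ring
  ext h
  obtain ⟨p, q, hq, rfl⟩ := ratFunc_eq_div h
  rw [Derivation.smul_apply, Derivation.leibniz_div, Derivation.leibniz_div, hp, hp]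
  simp only [smul_eq_mul]
  ring

/-- In lowest terms a zero derivative makes the denominator divide `num * denom'`, hence `denom'` by
coprimality. Degrees force `denom' = 0`, then `num' = 0`, and the characteristic is zero. -/
theorem exists_eq_C_of_ddy_eq_zero {h : RatFunc K} (hh : ddy h = 0) : ∃ k, h = RatFunc.C k := by
  have : CharZero K := charZero_of_injective_algebraMap (algebraMap ℂ K).injective
  rw [ddy_apply, ratFuncDeriv, div_eq_zero_iff] at hh
  have h1 : Polynomial.derivative h.num * h.denom - h.num * Polynomial.derivative h.denom = 0 := by
    rcases hh with hh | hh
    · exact (map_eq_zero_iff _ (RatFunc.algebraMap_injective K)).1 hh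
    · exact absurd hh (pow_ne_zero 2 (RatFunc.algebraMap_ne_zero h.denom_ne_zero))
  have hd : h.denom ∣ h.num * Polynomial.derivative h.denom :=
    ⟨Polynomial.derivative h.num, by linear_combination -h1⟩
  have hd0 : Polynomial.derivative h.denom = 0 := by
    by_contra h0
    exact absurd (Polynomial.degree_le_of_dvd (h.isCoprime_num_denom.symm.dvd_of_dvd_mul_left hd)
      h0) (not_le.2 (Polynomial.degree_derivative_lt h.denom_ne_zero))
  have hn0 : Polynomial.derivative h.num = 0 := by
    rw [hd0, mul_zero, sub_zero] at h1
    exact (mul_eq_zero.1 h1).resolve_right h.denom_ne_zero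
  exact (RatFunc.eq_C_iff h).2 ⟨Polynomial.derivative_eq_zero.1 hn0,
    Polynomial.derivative_eq_zero.1 hd0⟩

/-- Integrate three times. The third derivative lets "quadratic in `y`" be tested fibre by fibre,
without following the coefficients from one fibre to another. -/
theorem exists_quadratic_of_ddy_ddy_ddy_eq_zero {f : RatFunc K} (hf : ddy (ddy (ddy f)) = 0) :
    ∃ a b c : K, f = RatFunc.C a * RatFunc.X ^ 2 + 2 * RatFunc.C b * RatFunc.X + RatFunc.C c := by
  have : CharZero K := charZero_of_injective_algebraMap (algebraMap ℂ K).injective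
  have : CharZero (RatFunc K) :=
    charZero_of_injective_algebraMap (algebraMap ℂ (RatFunc K)).injective
  obtain ⟨k, hk⟩ := exists_eq_C_of_ddy_eq_zero hf
  obtain ⟨l, hl⟩ := exists_eq_C_of_ddy_eq_zero (h := ddy f - RatFunc.C k * RatFunc.X)
    (by simp [Derivation.leibniz, hk])
  obtain ⟨c, hc⟩ := exists_eq_C_of_ddy_eq_zero
    (h := f - RatFunc.C (k / 2) * RatFunc.X ^ 2 - RatFunc.C l * RatFunc.X) (by
      have h2 : RatFunc.C (k / 2) * 2 = (RatFunc.C k : RatFunc K) := by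
        rw [← map_ofNat (RatFunc.C : K →+* RatFunc K) 2, ← map_mul]; congr 1; field_simp
      simp only [map_sub, Derivation.leibniz, Derivation.leibniz_pow, ddy_C, ddy_X, smul_eq_mul,
        nsmul_eq_mul]
      push_cast
      linear_combination hl - RatFunc.X * h2)
  refine ⟨k / 2, l / 2, c, ?_⟩
  have h2 : 2 * RatFunc.C (l / 2) = (RatFunc.C l : RatFunc K) := by
    rw [← map_ofNat (RatFunc.C : K →+* RatFunc K) 2, ← map_mul]; congr 1; field_simp
  rw [h2]
  linear_combination hc

theorem RatFunc.algHom_ext_of_C_X {L : Type*} [Field L] [Algebra ℂ L] {σ τ : RatFunc K →ₐ[ℂ] L}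
    (hC : ∀ k, σ (RatFunc.C k) = τ (RatFunc.C k)) (hX : σ RatFunc.X = τ RatFunc.X) : σ = τ := by
  have hp : ∀ p : Polynomial K, σ (algebraMap (Polynomial K) (RatFunc K) p)
      = τ (algebraMap (Polynomial K) (RatFunc K) p) := by
    intro p
    induction p using Polynomial.induction_on' with
    | add p q hp hq => simp only [map_add, hp, hq]
    | monomial n a =>
      rw [← Polynomial.C_mul_X_pow_eq_monomial, map_mul, map_pow, RatFunc.algebraMap_C,
        RatFunc.algebraMap_X, map_mul, map_mul, map_pow, map_pow, hC, hX]
  ext h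
  obtain ⟨p, q, hq, rfl⟩ := ratFunc_eq_div h
  rw [map_div₀, map_div₀, hp, hp]

/-- The automorphism `σ` of `K(y)` is the homography with matrix `M`. -/
structure IsHomography (σ : RatFunc K ≃ₐ[ℂ] RatFunc K) (M : Matrix (Fin 2) (Fin 2) K) : Prop where
  map_C : ∀ k, σ (RatFunc.C k) = RatFunc.C k
  det_ne_zero : M.det ≠ 0
  map_X : σ RatFunc.X * (RatFunc.C (M 1 0) * RatFunc.X + RatFunc.C (M 1 1))
    = RatFunc.C (M 0 0) * RatFunc.X + RatFunc.C (M 0 1)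

theorem IsHomography.map_X_eq {σ : RatFunc K ≃ₐ[ℂ] RatFunc K} {M : Matrix (Fin 2) (Fin 2) K}
    (h : IsHomography σ M) : σ RatFunc.X = (RatFunc.C (M 0 0) * RatFunc.X + RatFunc.C (M 0 1))
      / (RatFunc.C (M 1 0) * RatFunc.X + RatFunc.C (M 1 1)) :=
  eq_div_of_mul_eq (denom_ne_zero_of_det_ne_zero h.det_ne_zero) h.map_X

/-- `σ (τ y)` substitutes `M·y` for `y` in `N·y`, which explains the order of the product. -/
theorem IsHomography.trans {σ τ : RatFunc K ≃ₐ[ℂ] RatFunc K} {M N : Matrix (Fin 2) (Fin 2) K}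
    (hσ : IsHomography σ M) (hτ : IsHomography τ N) : IsHomography (τ.trans σ) (N * M) where
  map_C k := by simp [hσ.map_C, hτ.map_C]
  det_ne_zero := by simpa [Matrix.det_mul] using ⟨hτ.det_ne_zero, hσ.det_ne_zero⟩
  map_X := by
    have h1 := congrArg σ hτ.map_X
    simp only [map_mul, map_add, hσ.map_C] at h1
    have h2 := hσ.map_X
    simp only [AlgEquiv.trans_apply, Matrix.mul_apply, Fin.sum_univ_two, map_add, map_mul]
    linear_combination (RatFunc.C (M 1 0) * RatFunc.X + RatFunc.C (M 1 1)) * h1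
      + (RatFunc.C (N 0 0) - σ (τ RatFunc.X) * RatFunc.C (N 1 0)) * h2

theorem IsHomography.eq {σ τ : RatFunc K ≃ₐ[ℂ] RatFunc K} {M : Matrix (Fin 2) (Fin 2) K}
    (hσ : IsHomography σ M) (hτ : IsHomography τ M) : σ = τ := by
  have := RatFunc.algHom_ext_of_C_X (σ := (σ : RatFunc K →ₐ[ℂ] RatFunc K))
    (τ := (τ : RatFunc K →ₐ[ℂ] RatFunc K)) (fun k => by simp [hσ.map_C, hτ.map_C])
    (by simp [hσ.map_X_eq, hτ.map_X_eq])
  ext h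
  exact DFunLike.congr_fun this h

theorem IsHomography.trace_sq_mul_det {σ : RatFunc K ≃ₐ[ℂ] RatFunc K}
    {M N : Matrix (Fin 2) (Fin 2) K} (hM : IsHomography σ M) (hN : IsHomography σ N) :
    M.trace ^ 2 * N.det = N.trace ^ 2 * M.det := by
  have h := coeff_eq_of_homography_eq (a := M 0 0) (b := M 0 1) (c := M 1 0) (d := M 1 1)
    (a' := N 0 0) (b' := N 0 1) (c' := N 1 0) (d' := N 1 1) (by
      rw [← hM.map_X, ← hN.map_X]; ring)
  have hdet := hM.det_ne_zero
  rw [Matrix.det_fin_two] at hdet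
  simpa [Matrix.det_fin_two, Matrix.trace_fin_two] using
    trace_sq_mul_det_eq hdet h.1 h.2.1 h.2.2

/-- The quotient `f` is transcendental over `K`: if it were a constant, the rows of `M` would be
proportional. So `y ↦ f` extends to `K(y)`. -/
theorem exists_algHom_homography {M : Matrix (Fin 2) (Fin 2) K} (hM : M.det ≠ 0) :
    ∃ σ : RatFunc K →ₐ[ℂ] RatFunc K, (∀ k, σ (RatFunc.C k) = RatFunc.C k) ∧
      σ RatFunc.X * (RatFunc.C (M 1 0) * RatFunc.X + RatFunc.C (M 1 1))
        = RatFunc.C (M 0 0) * RatFunc.X + RatFunc.C (M 0 1) := by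
  set f : RatFunc K := (RatFunc.C (M 0 0) * RatFunc.X + RatFunc.C (M 0 1))
      / (RatFunc.C (M 1 0) * RatFunc.X + RatFunc.C (M 1 1)) with hf
  have hd := denom_ne_zero_of_det_ne_zero hM
  have ht : Transcendental K f := by
    apply RatFunc.transcendental_of_ne_C
    rintro ⟨k, hk⟩
    rw [hf, div_eq_iff hd] at hk
    -- Both denominators are taken to be `1`, so this compares two polynomials of degree at most
    -- one.
    have h := coeff_eq_of_homography_eq (a := M 0 0) (b := M 0 1) (c := 0) (d := 1)
      (a' := k * M 1 0) (b' := k * M 1 1) (c' := 0) (d' := 1) (by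
        simp only [map_mul, map_zero, map_one]; linear_combination hk)
    apply hM
    have h1 := h.2.1
    have h0 := h.2.2
    rw [Matrix.det_fin_two]
    linear_combination M 1 1 * h1 - M 1 0 * h0
  let s : RatFunc K →ₐ[K] RatFunc K :=
    (IntermediateField.val _).comp (RatFunc.algEquivOfTranscendental f ht).toAlgHom
  have hsX : s RatFunc.X = f := by simp [s]
  have hsC : ∀ k, s (RatFunc.C k) = RatFunc.C k := fun k => by
    rw [← RatFunc.algebraMap_eq_C]; exact s.commutes k
  refine ⟨s.restrictScalars ℂ, hsC, ?_⟩
  change s RatFunc.X * _ = _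
  rw [hsX, hf, div_mul_cancel₀ _ hd]

/-- The endomorphisms attached to `M` and `M⁻¹` are mutually inverse, since their compositions fix
`K` and `y`. -/
theorem exists_isHomography {M : Matrix (Fin 2) (Fin 2) K} (hM : M.det ≠ 0) :
    ∃ σ : RatFunc K ≃ₐ[ℂ] RatFunc K, IsHomography σ M := by
  have key : ∀ M N : Matrix (Fin 2) (Fin 2) K, M.det ≠ 0 → N * M = 1 →
      ∀ σ τ : RatFunc K →ₐ[ℂ] RatFunc K, (∀ k, σ (RatFunc.C k) = RatFunc.C k) →
      σ RatFunc.X * (RatFunc.C (M 1 0) * RatFunc.X + RatFunc.C (M 1 1))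
        = RatFunc.C (M 0 0) * RatFunc.X + RatFunc.C (M 0 1) →
      (∀ k, τ (RatFunc.C k) = RatFunc.C k) →
      τ RatFunc.X * (RatFunc.C (N 1 0) * RatFunc.X + RatFunc.C (N 1 1))
        = RatFunc.C (N 0 0) * RatFunc.X + RatFunc.C (N 0 1) →
      σ.comp τ = AlgHom.id ℂ (RatFunc K) := by
    intro M N hM hNM σ τ hσC hσ hτC hτ
    apply RatFunc.algHom_ext_of_C_X
    · intro k; simp [hσC, hτC]
    · have h1 := congrArg σ hτ
      simp only [map_mul, map_add, hσC] at h1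
      have e : ∀ i j, RatFunc.C ((N * M) i j) = (RatFunc.C ((1 : Matrix (Fin 2) (Fin 2) K) i j) :
        RatFunc K) := fun i j => by rw [hNM]
      simp only [Matrix.mul_apply, Fin.sum_univ_two, map_add, map_mul] at e
      have e00 := e 0 0
      have e01 := e 0 1
      have e10 := e 1 0
      have e11 := e 1 1
      simp only [Matrix.one_apply_eq, map_one] at e00 e11
      rw [Matrix.one_apply_ne (by decide), map_zero] at e01 e10
      change σ (τ RatFunc.X) = RatFunc.X
      linear_combination (RatFunc.C (M 1 0) * RatFunc.X + RatFunc.C (M 1 1)) * h1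
        + (RatFunc.C (N 0 0) - σ (τ RatFunc.X) * RatFunc.C (N 1 0)) * hσ
        - σ (τ RatFunc.X) * e11 - σ (τ RatFunc.X) * RatFunc.X * e10 + RatFunc.X * e00 + e01
  have hu : IsUnit M.det := isUnit_iff_ne_zero.2 hM
  have hM' : M⁻¹.det ≠ 0 := by
    rw [Matrix.det_nonsing_inv]; exact (hu.ringInverse).ne_zero
  obtain ⟨σ, hσC, hσ⟩ := exists_algHom_homography hM
  obtain ⟨τ, hτC, hτ⟩ := exists_algHom_homography hM'
  exact ⟨AlgEquiv.ofAlgHom σ τ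
    (key _ _ hM (Matrix.nonsing_inv_mul M hu) _ _ hσC hσ hτC hτ)
    (key _ _ hM' (Matrix.mul_nonsing_inv M hu) _ _ hτC hτ hσC hσ), hσC, hM, hσ⟩

/-- The automorphisms of `K(y)` over `K` are homographies. -/
theorem exists_isHomography_of_map_C {σ : RatFunc K ≃ₐ[ℂ] RatFunc K}
    (hσ : ∀ k, σ (RatFunc.C k) = RatFunc.C k) : ∃ M, IsHomography σ M := by
  set f := σ RatFunc.X with hf
  have hfC : ¬ ∃ c, f = RatFunc.C c := by
    rintro ⟨c, hc⟩
    rw [← hσ c, hf] at hc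
    have h := (RatFunc.eq_C_iff (RatFunc.X : RatFunc K)).1 ⟨c, σ.injective hc⟩
    simp at h
  -- Surjectivity of `σ` means that `f = σ y` generates `K(y)` over `K`.
  have htop : IntermediateField.adjoin K {f} = ⊤ := by
    rw [eq_top_iff]
    intro g _
    rw [← σ.apply_symm_apply g]
    obtain ⟨p, q, hq, h⟩ := ratFunc_eq_div (σ.symm g)
    have hp : ∀ p : Polynomial K, σ (algebraMap (Polynomial K) (RatFunc K) p)
        ∈ IntermediateField.adjoin K {f} := by
      intro p
      induction p using Polynomial.induction_on' with
      | add p q hp hq => rw [map_add, map_add]; exact add_mem hp hq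
      | monomial n a =>
        rw [← Polynomial.C_mul_X_pow_eq_monomial, map_mul, map_pow, RatFunc.algebraMap_C,
          RatFunc.algebraMap_X, map_mul, map_pow, hσ]
        exact mul_mem (IntermediateField.algebraMap_mem _ a)
          (pow_mem (IntermediateField.mem_adjoin_simple_self K f) n)
    rw [h, map_div₀]
    exact div_mem (hp p) (hp q)
  -- The degree `[K(y) : K(f)]` is the larger of the degrees of numerator and denominator. Here it
  -- is one, so both are at most linear.
  have hdeg := RatFunc.finrank_eq_max_natDegree f
  rw [htop, IntermediateField.finrank_top] at hdeg
  have hn : f.num.natDegree ≤ 1 := by rw [hdeg]; exact le_max_left _ _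
  have hd : f.denom.natDegree ≤ 1 := by rw [hdeg]; exact le_max_right _ _
  obtain ⟨c, d, hcd⟩ := Polynomial.exists_eq_X_add_C_of_natDegree_le_one hd
  obtain ⟨a, b, hab⟩ := Polynomial.exists_eq_X_add_C_of_natDegree_le_one hn
  have hmul : f * (RatFunc.C c * RatFunc.X + RatFunc.C d)
      = RatFunc.C a * RatFunc.X + RatFunc.C b := by
    have h := RatFunc.num_div_denom f
    rw [div_eq_iff (RatFunc.algebraMap_ne_zero f.denom_ne_zero), hab, hcd] at h
    simpa using h.symm
  have hcd0 : (RatFunc.C c * RatFunc.X + RatFunc.C d : RatFunc K) ≠ 0 := by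
    have := RatFunc.algebraMap_ne_zero f.denom_ne_zero
    rw [hcd] at this
    simpa using this
  refine ⟨!![a, b; c, d], hσ, ?_, by simpa using hmul⟩
  -- A zero determinant would make `f` one of the constants `b / d`, `a / c`, against `hfC`.
  intro hdet
  rw [Matrix.det_fin_two_of] at hdet
  apply hfC
  have hC : RatFunc.C a * RatFunc.C d = (RatFunc.C b * RatFunc.C c : RatFunc K) := by
    rw [← map_mul, ← map_mul]; congr 1; linear_combination hdet
  by_cases hc : c = 0
  · subst hc
    have hd0 : d ≠ 0 := by rintro rfl; simp at hcd0
    have ha : a = 0 := by simpa [hd0] using hdet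
    have hd0' : (RatFunc.C d : RatFunc K) ≠ 0 := by simpa using hd0
    refine ⟨b / d, ?_⟩
    rw [map_div₀, eq_div_iff hd0']
    simpa [ha] using hmul
  · have hc0' : (RatFunc.C c : RatFunc K) ≠ 0 := by simpa using hc
    refine ⟨a / c, ?_⟩
    rw [map_div₀, eq_div_iff hc0']
    apply mul_right_cancel₀ hcd0
    linear_combination RatFunc.C c * hmul - hC

end Ruled

/-! ### Normal forms of quadratic vertical fields -/

section Ruled

variable {K : Type*} [Field K] [Algebra ℂ K]

theorem pullbackField_apply {F F' : Type*} [Field F] [Algebra ℂ F] [Field F'] [Algebra ℂ F']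
    (σ : F ≃ₐ[ℂ] F') (X : Derivation ℂ F F) (h : F') :
    pullbackField σ X h = σ (X (σ.symm h)) := rfl

theorem isTangentToFibration_smul_ddy (f : RatFunc K) : IsTangentToFibration
    (f • ddy : Derivation ℂ (RatFunc K) (RatFunc K)) :=
  fun k => by simp

theorem algebraMap_ratFunc_eq (z : ℂ) :
    algebraMap ℂ (RatFunc K) z = RatFunc.C (algebraMap ℂ K z) := by
  rw [IsScalarTower.algebraMap_apply ℂ K (RatFunc K), RatFunc.algebraMap_eq_C]

/-- If the homography `u` satisfies `X u = v(u)`, with `v` a function of `u`, then `X` is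
conjugate to `v(y) ∂_y`. -/
theorem exists_pullbackField_eq {X : Derivation ℂ (RatFunc K) (RatFunc K)}
    (hX : IsTangentToFibration X) {M : Matrix (Fin 2) (Fin 2) K} (hM : M.det ≠ 0)
    (v : RatFunc K)
    (hv : ∀ σ : RatFunc K ≃ₐ[ℂ] RatFunc K, IsHomography σ M → X (σ RatFunc.X) = σ v) :
    ∃ φ : Bir (RatFunc K), IsOverBase φ ∧ pullbackField φ.pullback X = v • ddy := by
  obtain ⟨σ, hσ⟩ := exists_isHomography hM
  have hC : ∀ k, σ.symm (RatFunc.C k) = RatFunc.C k := fun k => by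
    rw [AlgEquiv.symm_apply_eq, hσ.map_C]
  refine ⟨MulOpposite.op σ.symm, hC, ?_⟩
  change pullbackField σ.symm X = _
  have ht : IsTangentToFibration (pullbackField σ.symm X) := fun k => by
    rw [pullbackField_apply, AlgEquiv.symm_symm, hσ.map_C, hX, map_zero]
  rw [ht.eq_smul, pullbackField_apply, AlgEquiv.symm_symm, hv σ hσ, AlgEquiv.symm_apply_apply]

/-- The quadratic has a double root, which is moved to infinity. If `a ≠ 0`, then `a f = (a y +
b)²`, so `u = -1/(a y + b)` satisfies `X u = 1`. If `a = 0`, then `b = 0` and `u = y/c` works. -/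
theorem exists_pullbackField_eq_ddy {a b c : K} (hD : b ^ 2 - a * c = 0)
    (h0 : a ≠ 0 ∨ b ≠ 0 ∨ c ≠ 0) :
    ∃ φ : Bir (RatFunc K), IsOverBase φ ∧ pullbackField φ.pullback
      ((RatFunc.C a * RatFunc.X ^ 2 + 2 * RatFunc.C b * RatFunc.X + RatFunc.C c) • ddy) = ddy := by
  set X : Derivation ℂ (RatFunc K) (RatFunc K) :=
    (RatFunc.C a * RatFunc.X ^ 2 + 2 * RatFunc.C b * RatFunc.X + RatFunc.C c) • ddy with hXdef
  have hX : IsTangentToFibration X := isTangentToFibration_smul_ddy _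
  have hXX : X RatFunc.X = RatFunc.C a * RatFunc.X ^ 2 + 2 * RatFunc.C b * RatFunc.X
      + RatFunc.C c := by simp [hXdef]
  suffices ∃ M : Matrix (Fin 2) (Fin 2) K, M.det ≠ 0 ∧
      ∀ σ : RatFunc K ≃ₐ[ℂ] RatFunc K, IsHomography σ M → X (σ RatFunc.X) = 1 by
    obtain ⟨M, hM, h⟩ := this
    simpa using exists_pullbackField_eq hX hM 1 (fun σ hσ => by simpa using h σ hσ)
  by_cases ha : a = 0
  · subst ha
    have hb : b = 0 := by simpa using hD
    subst hb
    have hc : c ≠ 0 := by simpa using h0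
    have hc' : (RatFunc.C c : RatFunc K) ≠ 0 := by simpa using hc
    refine ⟨!![1, 0; 0, c], by simpa using hc, fun σ hσ => ?_⟩
    have h := hσ.map_X_eq
    simp at h
    rw [h, Derivation.leibniz_div, hX, hXX]
    simp [pow_two]
    field_simp
  · refine ⟨!![0, -1; a, b], by simpa using ha, fun σ hσ => ?_⟩
    have h := hσ.map_X_eq
    have hne := denom_ne_zero_of_det_ne_zero hσ.det_ne_zero
    have hDC : (RatFunc.C b ^ 2 - RatFunc.C a * RatFunc.C c : RatFunc K) = 0 := by
      rw [← map_pow, ← map_mul, ← map_sub, hD, map_zero]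
    simp at h hne
    rw [h, Derivation.leibniz_div, map_neg, Derivation.map_one_eq_zero, map_add,
      Derivation.leibniz, hX, hX, hXX]
    simp only [smul_eq_mul, neg_zero, mul_zero, add_zero]
    field_simp
    linear_combination -hDC

/-- The two roots are moved to `0` and `∞`. If `a ≠ 0`, then `a f = (a y + b - κ)(a y + b + κ)`, and
the quotient `u` of the two factors satisfies `X u = 2κ u`. If `a = 0`, then `b = ±κ` and one root
is already at infinity: take `u = 2κ y + c`, respectively `u = 1/(c - 2κ y)`. -/
theorem exists_pullbackField_eq_smul_ddy {a b c : K} {κ : ℂ} (hκ : κ ≠ 0)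
    (hD : b ^ 2 - a * c = algebraMap ℂ K (κ ^ 2)) :
    ∃ φ : Bir (RatFunc K), IsOverBase φ ∧ pullbackField φ.pullback
      ((RatFunc.C a * RatFunc.X ^ 2 + 2 * RatFunc.C b * RatFunc.X + RatFunc.C c) • ddy)
        = (algebraMap ℂ (RatFunc K) (2 * κ) * RatFunc.X) • ddy := by
  set X : Derivation ℂ (RatFunc K) (RatFunc K) :=
    (RatFunc.C a * RatFunc.X ^ 2 + 2 * RatFunc.C b * RatFunc.X + RatFunc.C c) • ddy with hXdef
  have hX : IsTangentToFibration X := isTangentToFibration_smul_ddy _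
  have hXX : X RatFunc.X = RatFunc.C a * RatFunc.X ^ 2 + 2 * RatFunc.C b * RatFunc.X
      + RatFunc.C c := by simp [hXdef]
  set k : K := algebraMap ℂ K κ with hk
  have hk0 : k ≠ 0 := by simpa [hk] using hκ
  have h2k : algebraMap ℂ (RatFunc K) (2 * κ) = 2 * RatFunc.C k := by
    rw [algebraMap_ratFunc_eq, map_mul, map_mul, map_ofNat, map_ofNat]
  have hchar : CharZero K := charZero_of_injective_algebraMap (algebraMap ℂ K).injective
  have h2 : (2 : K) ≠ 0 := two_ne_zero
  have h2C : (RatFunc.C 2 : RatFunc K) = 2 := map_ofNat _ 2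
  rw [map_pow] at hD
  suffices ∃ M : Matrix (Fin 2) (Fin 2) K, M.det ≠ 0 ∧
      ∀ σ : RatFunc K ≃ₐ[ℂ] RatFunc K, IsHomography σ M →
        X (σ RatFunc.X) = 2 * RatFunc.C k * σ RatFunc.X by
    obtain ⟨M, hM, h⟩ := this
    refine exists_pullbackField_eq hX hM _ (fun σ hσ => ?_)
    rw [h σ hσ, map_mul, h2k, map_mul, hσ.map_C, map_ofNat]
  by_cases ha : a = 0
  · subst ha
    have hb : (b - k) * (b + k) = 0 := by linear_combination hD
    rcases mul_eq_zero.1 hb with hb | hb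
    · obtain rfl : b = k := sub_eq_zero.1 hb
      refine ⟨!![2 * k, c; 0, 1], by simpa using hk0, fun σ hσ => ?_⟩
      have h := hσ.map_X_eq
      simp at h
      rw [h, map_add, ← map_ofNat (RatFunc.C : K →+* RatFunc K) 2, ← map_mul, Derivation.leibniz,
        hX, hX, hXX]
      simp [h2C]
    · obtain rfl : b = -k := eq_neg_of_add_eq_zero_left hb
      refine ⟨!![0, 1; -2 * k, c], by simpa using hk0, fun σ hσ => ?_⟩
      have h := hσ.map_X_eq
      have hne := denom_ne_zero_of_det_ne_zero hσ.det_ne_zero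
      simp [h2C] at h hne
      rw [h, Derivation.leibniz_inv, map_add, map_neg, ← h2C,
        ← map_mul, Derivation.leibniz, hX, hX, hXX]
      simp [h2C]
      field_simp
  · refine ⟨!![a, b - k; a, b + k], ?_, fun σ hσ => ?_⟩
    · rw [Matrix.det_fin_two_of]
      have : a * (b + k) - (b - k) * a = 2 * (a * k) := by ring
      rw [this]
      exact mul_ne_zero h2 (mul_ne_zero ha hk0)
    have h := hσ.map_X_eq
    have hne := denom_ne_zero_of_det_ne_zero hσ.det_ne_zero
    have hDC : (RatFunc.C b ^ 2 - RatFunc.C a * RatFunc.C c : RatFunc K) = RatFunc.C k ^ 2 := by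
      rw [← map_pow, ← map_mul, ← map_sub, hD, map_pow]
    simp at h hne
    rw [h, Derivation.leibniz_div]
    simp only [map_add, map_sub, Derivation.leibniz, hX a, hX b, hX k, hXX, smul_eq_mul]
    field_simp
    linear_combination (-2 * RatFunc.C k) * hDC

end Ruled

/-! ### Function fields and points of curves -/

/-- The function field of a curve contains no sequence of transcendental elements such that each
is a polynomial of degree two of the next one. -/
theorem mem_range_algebraMap_of_sq_sub_two {K : Type*} [Field K] [Algebra ℂ K] {S : Set K}
    (hS : S.Finite) (hgen : IntermediateField.adjoin ℂ S = ⊤) (htr : Algebra.trdeg ℂ K ≤ 1)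
    (u : ℕ → K) (hu : ∀ j, u j = u (j + 1) ^ 2 - 2) : u 0 ∈ Set.range (algebraMap ℂ K) := by
  by_contra h0
  have hconst : ∀ x : K, IsAlgebraic ℂ x → x ∈ Set.range (algebraMap ℂ K) := fun x hx => by
    have := (IntermediateField.isAlgebraic_adjoin_simple (K := ℂ) hx.isIntegral)
    obtain ⟨y, hy⟩ := (IsAlgClosed.algebraMap_bijective_of_isIntegral
      (k := ℂ) (K := IntermediateField.adjoin ℂ {x})).2
      ⟨x, IntermediateField.mem_adjoin_simple_self ℂ x⟩
    exact ⟨y, congrArg Subtype.val hy⟩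
  have hu0 : ∀ j, Transcendental ℂ (u j) := by
    intro j
    induction j with
    | zero => exact fun h => h0 (hconst _ h)
    | succ j ih =>
      intro h
      apply ih
      rw [hu j]
      exact (h.pow 2).sub (by rw [← map_ofNat (algebraMap ℂ K) 2]; exact isAlgebraic_algebraMap _)
  let L : ℕ → IntermediateField ℂ K := fun j => IntermediateField.adjoin ℂ {u j}
  have hmem : ∀ j, u j ∈ L j := fun j => IntermediateField.mem_adjoin_simple_self ℂ (u j)
  have hle : ∀ j, L j ≤ L (j + 1) := fun j => by
    rw [IntermediateField.adjoin_simple_le_iff, hu j]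
    exact sub_mem (pow_mem (hmem _) 2) (ofNat_mem _ 2)
  have hmono : Monotone L := monotone_nat_of_le_succ hle
  -- If `u (j + 1) = r(u j) / s(u j)`, substituting `u j = q(u (j + 1))` gives `X * s(q) = r(q)`
  -- with `q` of degree two: an odd degree equals an even one.
  have hnot : ∀ j, u (j + 1) ∉ L j := by
    intro j hj
    obtain ⟨r, s, hrs⟩ := (IntermediateField.mem_adjoin_simple_iff ℂ _).1 hj
    have hne : u (j + 1) ≠ 0 := fun h => hu0 (j + 1) (by rw [h]; exact isAlgebraic_zero)
    have hs : Polynomial.aeval (u j) s ≠ 0 := fun h => hne (by rw [hrs, h, div_zero])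
    rw [eq_div_iff hs] at hrs
    set q : Polynomial ℂ := Polynomial.X ^ 2 - Polynomial.C 2 with hq
    have hqu : Polynomial.aeval (u (j + 1)) q = u j := by
      simp [hq, hu j, map_ofNat (algebraMap ℂ K) 2]
    have hqd : q.natDegree = 2 := Polynomial.natDegree_X_pow_sub_C
    have hpoly : Polynomial.X * s.comp q = r.comp q := by
      apply transcendental_iff_injective.1 (hu0 (j + 1))
      rw [map_mul, Polynomial.aeval_X, Polynomial.aeval_comp, Polynomial.aeval_comp, hqu, hrs]
    have hs0 : s.comp q ≠ 0 := by
      intro h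
      have := congrArg (Polynomial.aeval (u (j + 1))) h
      rw [Polynomial.aeval_comp, hqu, map_zero] at this
      exact hs this
    have hdeg := congrArg Polynomial.natDegree hpoly
    rw [Polynomial.natDegree_mul Polynomial.X_ne_zero hs0, Polynomial.natDegree_X,
      Polynomial.natDegree_comp, Polynomial.natDegree_comp, hqd] at hdeg
    omega
  -- As the transcendence degree is at most one, `u 0` alone is a transcendence basis.
  have halg : Algebra.IsAlgebraic (L 0) K := by
    have hind : AlgebraicIndependent ℂ ![u 0] := algebraicIndependent_iff_transcendental.2 (hu0 0)
    have hb := hind.isTranscendenceBasis_of_lift_trdeg_le_of_finite (by simpa using htr)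
    have := hb.isAlgebraic_field
    rwa [show Set.range ![u 0] = {u 0} by simp] at this
  have hfin : FiniteDimensional (L 0) K := by
    have : Finite S := hS
    have h1 := IntermediateField.finiteDimensional_adjoin (K := L 0) (S := S)
      (fun x _ => (Algebra.IsAlgebraic.isAlgebraic x).isIntegral)
    have h2 : IntermediateField.adjoin (L 0) S = ⊤ := by
      rw [← IntermediateField.restrictScalars_eq_top_iff (K := ℂ), eq_top_iff, ← hgen,
        IntermediateField.adjoin_le_iff]
      exact fun x hx => IntermediateField.subset_adjoin (L 0) S hx
    rw [h2] at h1
    exact Module.Finite.equiv (IntermediateField.topEquiv (F := L 0) (E := K)).toLinearEquiv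
  -- The fields `L j`, seen as subspaces of the finite-dimensional `L 0`-space `K`, must stabilise.
  let N : ℕ →o Submodule (L 0) K :=
    { toFun := fun j => (IntermediateField.extendScalars (hmono (Nat.zero_le j))).toSubmodule
      monotone' := fun i j hij x hx => hmono hij hx }
  obtain ⟨n, hn⟩ := monotone_stabilizes_iff_noetherian.2 (inferInstance : IsNoetherian (L 0) K) N
  have : u (n + 1) ∈ N n := by
    rw [hn (n + 1) (Nat.le_succ n)]
    exact hmem (n + 1)
  exact hnot n this

/-- A curve has a one-parameter family of points such that each nonzero regular function vanishes
at finitely many members of the family. -/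
theorem exists_points_of_trdeg_eq_one {A : Type*} [CommRing A] [IsDomain A] [Algebra ℂ A]
    [Algebra.FiniteType ℂ A] (htr : Algebra.trdeg ℂ A ≤ 1) (hA : ¬ Algebra.IsAlgebraic ℂ A) :
    ∃ e : ℂ → (A →ₐ[ℂ] ℂ), ∀ a : A, a ≠ 0 → {z | e z a = 0}.Finite := by
  -- Noether normalisation. The number of variables is at most one by the transcendence degree, and
  -- it is not zero because `A` is not algebraic.
  obtain ⟨s, g, hginj, hgint⟩ := exists_integral_inj_algHom_of_fg ℂ A
  have hs : s = 1 := by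
    have h1 : s ≤ 1 := by
      have := lift_trdeg_le_of_injective g hginj
      rw [MvPolynomial.trdeg_of_isDomain] at this
      have h2 := this.trans (Cardinal.lift_le.2 htr)
      simpa using h2
    by_contra hne
    obtain rfl : s = 0 := by omega
    apply hA
    refine ⟨fun a => ?_⟩
    apply IsIntegral.isAlgebraic
    have h1 := hgint a
    have h2 : (algebraMap ℂ A) = (g : MvPolynomial (Fin 0) ℂ →+* A).comp
      (algebraMap ℂ (MvPolynomial (Fin 0) ℂ)) := g.comp_algebraMap.symm
    have h3 : (algebraMap ℂ A).IsIntegral := by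
      rw [h2]
      exact RingHom.IsIntegral.trans _ _ (RingHom.isIntegral_of_surjective _
        (MvPolynomial.C_surjective (Fin 0))) hgint
    exact h3 a
  subst hs
  let G : Polynomial ℂ →ₐ[ℂ] A :=
    g.comp (MvPolynomial.uniqueAlgEquiv ℂ (Fin 1)).symm.toAlgHom
  have hGinj : Function.Injective G := hginj.comp (MvPolynomial.uniqueAlgEquiv ℂ (Fin 1)).symm.injective
  have hGint : G.toRingHom.IsIntegral :=
    RingHom.IsIntegral.trans _ _ (RingHom.isIntegral_of_surjective
      (MvPolynomial.uniqueAlgEquiv ℂ (Fin 1)).symm.toAlgHom.toRingHom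
      (MvPolynomial.uniqueAlgEquiv ℂ (Fin 1)).symm.surjective) hgint
  let := G.toRingHom.toAlgebra
  have hmap : ∀ p, algebraMap (Polynomial ℂ) A p = G p := fun p => rfl
  have : Algebra.IsIntegral (Polynomial ℂ) A := ⟨hGint⟩
  -- A point over `z` of the affine line: lying over gives a maximal ideal, and its residue field is
  -- `ℂ` by the Nullstellensatz.
  have key : ∀ z : ℂ, ∃ e : A →ₐ[ℂ] ℂ, ∀ p, e (G p) = p.eval z := by
    intro z
    have hmax : (RingHom.ker (Polynomial.evalRingHom z)).IsMaximal :=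
      RingHom.ker_isMaximal_of_surjective _ (fun c => ⟨Polynomial.C c, by simp⟩)
    obtain ⟨Q, hQ, hQz⟩ := Ideal.exists_ideal_over_maximal_of_isIntegral (S := A)
      (RingHom.ker (Polynomial.evalRingHom z)) (by
        intro p hp
        rw [RingHom.mem_ker, hmap, map_eq_zero_iff _ hGinj] at hp
        simp [hp])
    let : Field (A ⧸ Q) := Ideal.Quotient.field Q
    have : Module.Finite ℂ (A ⧸ Q) := finite_of_finite_type_of_isJacobsonRing ℂ (A ⧸ Q)
    let E : ℂ ≃ₐ[ℂ] (A ⧸ Q) := AlgEquiv.ofBijective (Algebra.ofId ℂ (A ⧸ Q))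
      IsAlgClosed.algebraMap_bijective_of_isIntegral
    refine ⟨E.symm.toAlgHom.comp (Ideal.Quotient.mkₐ ℂ Q), fun p => ?_⟩
    have hmem : p - Polynomial.C (p.eval z) ∈ RingHom.ker (Polynomial.evalRingHom z) := by
      simp [RingHom.mem_ker]
    rw [← hQz, Ideal.mem_comap, hmap, map_sub, ← Ideal.Quotient.mk_eq_mk_iff_sub_mem] at hmem
    change E.symm (Ideal.Quotient.mk Q (G p)) = _
    rw [hmem, AlgEquiv.symm_apply_eq, ← Polynomial.algebraMap_eq, G.commutes]
    rfl
  choose e he using key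
  refine ⟨e, fun a ha => ?_⟩
  -- A nonzero `a` divides a nonzero polynomial `r` in the coordinate `z`, so its zeros in the
  -- family are among the roots of `r`.
  obtain ⟨r, hr, b, hb⟩ := (Algebra.IsAlgebraic.isAlgebraic (R := Polynomial ℂ) a).exists_nonzero_dvd
    (mem_nonZeroDivisors_of_ne_zero ha)
  refine (Polynomial.finite_setOfPred_isRoot hr).subset fun z hz => ?_
  have := congrArg (e z) hb
  rw [hmap, he, map_mul, show e z a = 0 from hz, zero_mul] at this
  exact this

/-! ### Riccati equations, cross-ratios and the countability of discriminants -/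

/-- `sinh (κ t) / κ`, extended by its limit `t` when `κ = 0`. -/
def sinhDiv (κ t : ℂ) : ℂ := if κ = 0 then t else Complex.sinh (κ * t) / κ

theorem mul_sinhDiv (κ t : ℂ) : κ * sinhDiv κ t = Complex.sinh (κ * t) := by
  unfold sinhDiv
  split_ifs with h
  · simp [h]
  · field_simp

@[simp]
theorem sinhDiv_zero (κ : ℂ) : sinhDiv κ 0 = 0 := by simp [sinhDiv]

theorem hasDerivAt_sinhDiv (κ t : ℂ) : HasDerivAt (sinhDiv κ) (Complex.cosh (κ * t)) t := by
  by_cases h : κ = 0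
  · have : sinhDiv κ = id := by ext t; simp [sinhDiv, h]
    rw [this, h, zero_mul, Complex.cosh_zero]
    exact hasDerivAt_id t
  · have : sinhDiv κ = fun t => Complex.sinh (κ * t) / κ := by ext t; simp [sinhDiv, h]
    rw [this]
    have h1 := (((hasDerivAt_id t).const_mul κ).csinh).div_const κ
    convert! h1 using 1
    simp only [id]
    field_simp

theorem hasDerivAt_cosh_mul (κ t : ℂ) :
    HasDerivAt (fun t => Complex.cosh (κ * t)) (κ ^ 2 * sinhDiv κ t) t := by
  have h1 := ((hasDerivAt_id t).const_mul κ).ccosh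
  convert! h1 using 1
  rw [pow_two, mul_assoc, mul_sinhDiv]
  simp only [id]
  ring

theorem cosh_sq_sub_sinhDiv_sq (κ t : ℂ) :
    Complex.cosh (κ * t) ^ 2 - κ ^ 2 * sinhDiv κ t ^ 2 = 1 := by
  rw [← mul_pow, mul_sinhDiv, Complex.cosh_sq_sub_sinh_sq]

theorem cosh_mul_add (κ s t : ℂ) : Complex.cosh (κ * (s + t))
    = Complex.cosh (κ * s) * Complex.cosh (κ * t) + κ ^ 2 * sinhDiv κ s * sinhDiv κ t := by
  rw [mul_add, Complex.cosh_add, ← mul_sinhDiv, ← mul_sinhDiv]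
  ring

theorem sinhDiv_add (κ s t : ℂ) : sinhDiv κ (s + t)
    = sinhDiv κ s * Complex.cosh (κ * t) + Complex.cosh (κ * s) * sinhDiv κ t := by
  by_cases h : κ = 0
  · simp [sinhDiv, h]
  · apply mul_left_cancel₀ h
    rw [mul_sinhDiv, mul_add, Complex.sinh_add, ← mul_sinhDiv, ← mul_sinhDiv]
    ring

/-- A function satisfying a homogeneous linear differential equation on a disc, and vanishing at
its centre, vanishes. -/
theorem eq_zero_of_hasDerivAt_mul {g h : ℂ → ℂ} {ε : ℝ}
    (hh : ContinuousOn h (Metric.ball 0 ε))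
    (hg : ∀ t ∈ Metric.ball (0 : ℂ) ε, HasDerivAt g (h t * g t) t) (h0 : g 0 = 0) {t : ℂ}
    (ht : t ∈ Metric.ball (0 : ℂ) ε) : g t = 0 := by
  have hmem : ∀ s ∈ Set.Icc (0 : ℝ) 1, (s : ℂ) * t ∈ Metric.ball (0 : ℂ) ε := by
    intro s hs
    rw [mem_ball_zero_iff] at ht ⊢
    rw [norm_mul, Complex.norm_real, Real.norm_eq_abs, abs_of_nonneg hs.1]
    exact lt_of_le_of_lt (mul_le_of_le_one_left (norm_nonneg _) hs.2) ht
  have hder : ∀ s ∈ Set.Icc (0 : ℝ) 1, HasDerivAt (fun s : ℝ => g (s * t))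
      (h (s * t) * g (s * t) * t) s := by
    intro s hs
    have h1 : HasDerivAt (fun s : ℝ => (s : ℂ) * t) t s := by
      simpa using (Complex.ofRealCLM.hasDerivAt (x := s)).mul_const t
    exact (hg _ (hmem s hs)).comp s h1
  have hc : ContinuousOn (fun s : ℝ => h (s * t)) (Set.Icc 0 1) :=
    hh.comp (by fun_prop) hmem
  -- Grönwall's inequality on the real segment from `0` to `t`, where `h` is bounded by compactness.
  obtain ⟨B, hB⟩ := isCompact_Icc.exists_bound_of_continuousOn hc
  have := norm_le_gronwallBound_of_norm_deriv_right_le (f := fun s : ℝ => g (s * t)) (δ := 0)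
    (K := B * ‖t‖) (ε := 0) (a := 0) (b := 1)
    (fun s hs => (hder s hs).continuousAt.continuousWithinAt)
    (fun s hs => (hder s ⟨hs.1, hs.2.le⟩).hasDerivWithinAt) (by simp [h0])
    (fun s hs => by
      rw [norm_mul, norm_mul, add_zero]
      have := hB s ⟨hs.1, hs.2.le⟩
      nlinarith [mul_le_mul_of_nonneg_right this
        (mul_nonneg (norm_nonneg (g (s * t))) (norm_nonneg t))]) 1 ⟨zero_le_one, le_rfl⟩
  simpa [gronwallBound_ε0_δ0] using this

/-- The solutions of the Riccati equation `w' = a w² + 2 b w + c` are the orbits of the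
one-parameter group of homographies generated by the matrix `(b, c; -a, -b)`. -/
theorem riccati_eq_homography {a b c κ v : ℂ} (hκ : κ ^ 2 = b ^ 2 - a * c) {w : ℂ → ℂ} {ε : ℝ}
    (hw : ∀ t ∈ Metric.ball (0 : ℂ) ε, HasDerivAt w (a * w t ^ 2 + 2 * b * w t + c) t)
    (h0 : w 0 = v) {t : ℂ} (ht : t ∈ Metric.ball (0 : ℂ) ε) :
    w t * (-(a * sinhDiv κ t) * v + (Complex.cosh (κ * t) - b * sinhDiv κ t))
      = (Complex.cosh (κ * t) + b * sinhDiv κ t) * v + c * sinhDiv κ t := by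
  rw [← sub_eq_zero]
  -- Let `N` be the right side and `D` the factor of `w` on the left. From `N' = b N + c D`, `D' =
  -- -a N - b D` and the Riccati equation, `g = w D - N` satisfies `g' = (a w + b) g`, even where
  -- `D` vanishes.
  refine eq_zero_of_hasDerivAt_mul (h := fun t => a * w t + b) (g := fun t =>
    w t * (-(a * sinhDiv κ t) * v + (Complex.cosh (κ * t) - b * sinhDiv κ t))
      - ((Complex.cosh (κ * t) + b * sinhDiv κ t) * v + c * sinhDiv κ t)) ?_ ?_ ?_ ht
  · exact fun t ht => (((hw t ht).continuousAt.const_mul a).add_const b).continuousWithinAt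
  · intro t ht
    have hS := hasDerivAt_sinhDiv κ t
    have hC := hasDerivAt_cosh_mul κ t
    have h1 := ((hw t ht).mul ((((hS.const_mul a).neg).mul_const v).add (hC.sub (hS.const_mul b)))).sub
      (((hC.add (hS.const_mul b)).mul_const v).add (hS.const_mul c))
    convert! h1 using 1
    rw [hκ]
    ring_nf
    simp
    ring
  · simp [h0]

/-- With `y = exp (2 r t)` the condition becomes `y² + (2 - m) y + 1 = 0`. It has finitely many
roots, and each has countably many logarithms. -/
theorem countable_setOf_cosh_sq_eq {t : ℂ} (ht : t ≠ 0) (m : ℂ) :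
    {d : ℂ | ∃ r, r ^ 2 = d ∧ 4 * Complex.cosh (r * t) ^ 2 = m}.Countable := by
  have hexp : ∀ y : ℂ, {r : ℂ | Complex.exp (2 * t * r) = y}.Countable := by
    intro y
    by_cases hy : ∃ r₀ : ℂ, Complex.exp (2 * t * r₀) = y
    · obtain ⟨r₀, rfl⟩ := hy
      refine (Set.countable_range fun n : ℤ => r₀ + n * (Real.pi * Complex.I) / t).mono ?_
      intro r hr
      obtain ⟨n, hn⟩ := Complex.exp_eq_exp_iff_exists_int.1 (show Complex.exp _ = _ from hr)
      refine ⟨n, ?_⟩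
      field_simp
      linear_combination (-1 / 2 : ℂ) * hn
    · convert Set.countable_empty
      ext r
      simpa using fun h => hy ⟨r, h⟩
  have hroots : {y : ℂ | y ^ 2 + (2 - m) * y + 1 = 0}.Finite := by
    have hne : (Polynomial.X ^ 2 + Polynomial.C (2 - m) * Polynomial.X + 1 : Polynomial ℂ) ≠ 0 := by
      intro h
      have := congrArg (Polynomial.eval 0) h
      simp at this
    refine (Polynomial.finite_setOfPred_isRoot hne).subset fun y hy => ?_
    simpa [Polynomial.IsRoot] using hy
  refine ((hroots.countable.biUnion fun y _ => hexp y).image (fun r => r ^ 2)).mono ?_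
  rintro d ⟨r, rfl, hr⟩
  refine ⟨r, ?_, rfl⟩
  simp only [Set.mem_iUnion]
  refine ⟨Complex.exp (2 * t * r), ?_, rfl⟩
  have h1 : Complex.exp (2 * t * r) = Complex.exp (r * t) ^ 2 := by
    rw [← Complex.exp_nat_mul]; congr 1; push_cast; ring
  have h2 : Complex.exp (r * t) * Complex.exp (-(r * t)) = 1 := by
    rw [← Complex.exp_add]; simp
  rw [Complex.cosh] at hr
  change _ ^ 2 + (2 - m) * _ + 1 = 0
  rw [h1, ← hr]
  linear_combination (-1 * (Complex.exp (r * t) * Complex.exp (-(r * t)) + 1)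
    - 2 * Complex.exp (r * t) ^ 2) * h2

/-- A difference `w - w'` is `det * (v - v')` over the product of two denominators, and these
factors cancel in the cross-ratio. The form without division allows coincident points. -/
theorem cross_ratio_homography {F : Type*} [Field F] {a b c d v₁ v₂ v₃ v₄ w₁ w₂ w₃ w₄ : F}
    (hdet : a * d - b * c ≠ 0) (h₁ : w₁ * (c * v₁ + d) = a * v₁ + b)
    (h₂ : w₂ * (c * v₂ + d) = a * v₂ + b) (h₃ : w₃ * (c * v₃ + d) = a * v₃ + b)
    (h₄ : w₄ * (c * v₄ + d) = a * v₄ + b) :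
    (w₁ - w₂) * (w₃ - w₄) * ((v₁ - v₃) * (v₂ - v₄))
      = (w₁ - w₃) * (w₂ - w₄) * ((v₁ - v₂) * (v₃ - v₄)) := by
  have hne : ∀ {v w : F}, w * (c * v + d) = a * v + b → c * v + d ≠ 0 := by
    intro v w h h0
    rw [h0, mul_zero] at h
    have : (a * d - b * c) = 0 := by linear_combination a * h0 + c * h
    exact hdet this
  have e₁ := eq_div_of_mul_eq (hne h₁) h₁
  have e₂ := eq_div_of_mul_eq (hne h₂) h₂
  have e₃ := eq_div_of_mul_eq (hne h₃) h₃
  have e₄ := eq_div_of_mul_eq (hne h₄) h₄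
  have key : ∀ {v w v' w' : F}, w * (c * v + d) = a * v + b → w' * (c * v' + d) = a * v' + b →
      (w - w') * ((c * v + d) * (c * v' + d)) = (a * d - b * c) * (v - v') := by
    intro v w v' w' h h'
    linear_combination (c * v' + d) * h - (c * v + d) * h'
  apply mul_right_cancel₀ (mul_ne_zero (mul_ne_zero (hne h₁) (hne h₂))
    (mul_ne_zero (hne h₃) (hne h₄)))
  have k12 := key h₁ h₂
  have k34 := key h₃ h₄
  have k13 := key h₁ h₃
  have k24 := key h₂ h₄
  calc _ = ((w₁ - w₂) * ((c * v₁ + d) * (c * v₂ + d))) * ((w₃ - w₄) * ((c * v₃ + d) * (c * v₄ + d)))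
        * ((v₁ - v₃) * (v₂ - v₄)) := by ring
    _ = ((w₁ - w₃) * ((c * v₁ + d) * (c * v₃ + d))) * ((w₂ - w₄) * ((c * v₂ + d) * (c * v₄ + d)))
        * ((v₁ - v₂) * (v₃ - v₄)) := by rw [k12, k34, k13, k24]; ring
    _ = _ := by ring

/-- The derivative is the limit of slopes along any sequence of times. Using a sequence keeps the
number of homographies, and so of exceptional fibres, countable. -/
theorem HasDerivAt.eq_zero_of_seq {g : ℂ → ℂ} {g' : ℂ} (hg : HasDerivAt g g' 0) (h0 : g 0 = 0)
    {s : ℕ → ℂ} (hs : Filter.Tendsto s Filter.atTop (nhds 0)) (hs0 : ∀ j, s j ≠ 0)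
    (hgs : ∀ j, g (s j) = 0) : g' = 0 := by
  have h1 := hasDerivAt_iff_tendsto_slope.1 hg
  have h2 : Filter.Tendsto s Filter.atTop (nhdsWithin 0 {0}ᶜ) :=
    tendsto_nhdsWithin_iff.2 ⟨hs, Filter.Eventually.of_forall hs0⟩
  have h3 := h1.comp h2
  refine tendsto_nhds_unique h3 ?_
  refine tendsto_const_nhds.congr fun j => ?_
  simp [slope, hgs, h0]

/-- A vector field whose flow is by homographies (at least for a sequence of times that tends
to zero) is quadratic. -/
theorem exists_quadratic_of_homography_flow {s : ℕ → ℂ}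
    (hs : Filter.Tendsto s Filter.atTop (nhds 0)) (hs0 : ∀ j, s j ≠ 0) {a b c d : ℕ → ℂ}
    (hdet : ∀ j, a j * d j - b j * c j ≠ 0) {V : Set ℂ} (hV : V.Infinite) {w : ℂ → ℂ → ℂ}
    {f : ℂ → ℂ} (hw0 : ∀ v ∈ V, w v 0 = v) (hw : ∀ v ∈ V, HasDerivAt (w v) (f v) 0)
    (hflow : ∀ v ∈ V, ∀ j, w v (s j) * (c j * v + d j) = a j * v + b j) :
    ∃ p : Polynomial ℂ, p.natDegree ≤ 2 ∧ ∀ v ∈ V, f v = p.eval v := by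
  obtain ⟨T, hTV, hT⟩ := hV.exists_subset_card_eq 3
  obtain ⟨v₁, v₂, v₃, h12, h13, h23, rfl⟩ := Finset.card_eq_three.1 hT
  have hm₁ : v₁ ∈ V := hTV (by simp)
  have hm₂ : v₂ ∈ V := hTV (by simp)
  have hm₃ : v₃ ∈ V := hTV (by simp)
  have hne : (v₁ - v₂) * (v₁ - v₃) * (v₂ - v₃) ≠ 0 :=
    mul_ne_zero (mul_ne_zero (sub_ne_zero.2 h12) (sub_ne_zero.2 h13)) (sub_ne_zero.2 h23)
  let L : ℂ → Polynomial ℂ := fun v => Polynomial.C v - Polynomial.X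
  -- Differentiate the cross-ratio identity for `v₁, v₂, v₃, v` at time zero and solve for `f v`.
  -- Its coefficient is, up to sign, the Vandermonde product of the three fixed points, and the
  -- remaining terms are quadratic in `v`.
  refine ⟨Polynomial.C (((v₁ - v₂) * (v₁ - v₃) * (v₂ - v₃))⁻¹) *
    (Polynomial.C ((f v₁ - f v₂) * (v₁ - v₃)) * (L v₃ * L v₂)
      + Polynomial.C ((v₁ - v₂) * f v₃ * (v₁ - v₃)) * L v₂
      - Polynomial.C ((f v₁ - f v₃) * (v₁ - v₂)) * (L v₂ * L v₃)
      - Polynomial.C ((v₁ - v₃) * f v₂ * (v₁ - v₂)) * L v₃), ?_, ?_⟩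
  · simp only [L]
    compute_degree
  · intro v hv
    have hd := ((((hw v₁ hm₁).sub (hw v₂ hm₂)).mul ((hw v₃ hm₃).sub (hw v hv))).mul_const
      ((v₁ - v₃) * (v₂ - v))).sub
      ((((hw v₁ hm₁).sub (hw v₃ hm₃)).mul ((hw v₂ hm₂).sub (hw v hv))).mul_const
      ((v₁ - v₂) * (v₃ - v)))
    have h := hd.eq_zero_of_seq (by simp [hw0 _ hm₁, hw0 _ hm₂, hw0 _ hm₃, hw0 _ hv]; ring) hs hs0
      (fun j => by
        have := cross_ratio_homography (hdet j) (hflow _ hm₁ j) (hflow _ hm₂ j) (hflow _ hm₃ j)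
          (hflow _ hv j)
        simpa [sub_eq_zero] using this)
    simp only [Pi.sub_apply, hw0 _ hm₁, hw0 _ hm₂, hw0 _ hm₃, hw0 _ hv] at h
    simp only [L, Polynomial.eval_mul, Polynomial.eval_sub, Polynomial.eval_add,
      Polynomial.eval_C, Polynomial.eval_X]
    rw [eq_comm, inv_mul_eq_iff_eq_mul₀ hne]
    linear_combination h

/-! ### The Euclidean topology and the affine chart `C_o × 𝔸¹` -/

namespace ProjVariety

section Topology

variable {F : Type*} [Field F] [Algebra ℂ F] {ι : Type*} {V : ProjVariety F ι}

theorem rep_mk_smul {v : ι → ℂ} (hv : v ≠ 0) :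
    ∃ l : ℂ, l ≠ 0 ∧ (Projectivization.mk ℂ v hv).rep = l • v := by
  obtain ⟨l, hl⟩ := Projectivization.exists_smul_eq_mk_rep ℂ v hv
  exact ⟨l, l.ne_zero, hl.symm⟩

theorem isOpen_preimage_of_isOpen_mk {S : Set (ℙ ℂ (ι → ℂ))}
    (hS : IsOpen {v : {v : ι → ℂ // v ≠ 0} | Projectivization.mk' ℂ v ∈ S}) :
    IsOpen {p : V.Point | p.1 ∈ S} := by
  let _ : TopologicalSpace (ℙ ℂ (ι → ℂ)) := TopologicalSpace.coinduced
    (fun v : {v : ι → ℂ // v ≠ 0} => Projectivization.mk' ℂ v) inferInstance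
  exact isOpen_induced_iff.2 ⟨S, isOpen_coinduced.2 hS, rfl⟩

theorem isOpen_and_mem_ratio (i j : ι) {O : Set ℂ} (hO : IsOpen O) :
    IsOpen {p : V.Point | p.rep i ≠ 0 ∧ p.rep j / p.rep i ∈ O} := by
  refine isOpen_preimage_of_isOpen_mk (S := {x | x.rep i ≠ 0 ∧ x.rep j / x.rep i ∈ O}) ?_
  have : {v : {v : ι → ℂ // v ≠ 0} | Projectivization.mk' ℂ v ∈
      {x : ℙ ℂ (ι → ℂ) | x.rep i ≠ 0 ∧ x.rep j / x.rep i ∈ O}}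
      = {v | v.1 i ≠ 0 ∧ v.1 j / v.1 i ∈ O} := by
    ext v
    obtain ⟨l, hl, h⟩ := rep_mk_smul v.2
    simp only [Set.mem_ofPred_eq, Projectivization.mk'_eq_mk, h, Pi.smul_apply, smul_eq_mul]
    rw [mul_div_mul_left _ _ hl]
    simp [hl]
  rw [this]
  have hc : ∀ j, Continuous fun v : {v : ι → ℂ // v ≠ 0} => v.1 j :=
    fun j => (continuous_apply j).comp continuous_subtype_val
  have hopen : IsOpen {v : {v : ι → ℂ // v ≠ 0} | v.1 i ≠ 0} :=
    isOpen_ne_fun (hc i) continuous_const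
  have hcont : ContinuousOn (fun v : {v : ι → ℂ // v ≠ 0} => v.1 j / v.1 i) {v | v.1 i ≠ 0} :=
    (hc j).continuousOn.div (hc i).continuousOn fun v hv => hv
  exact hcont.isOpen_inter_preimage hopen hO

theorem isOpen_chart (i : ι) : IsOpen {p : V.Point | p.rep i ≠ 0} := by
  simpa using isOpen_and_mem_ratio (V := V) i i isOpen_univ

theorem continuousOn_ratio (i j : ι) :
    ContinuousOn (fun p : V.Point => p.rep j / p.rep i) {p | p.rep i ≠ 0} := by
  rw [continuousOn_open_iff (isOpen_chart i)]
  exact fun O hO => isOpen_and_mem_ratio i j hO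

/-- A continuous lift to homogeneous coordinates suffices, since the projection from nonzero vectors
is continuous and the topology of the variety is induced. -/
theorem continuousOn_point {T : Type*} [TopologicalSpace T] {s : Set T} {g : T → V.Point}
    {f : T → ι → ℂ} (hf : ContinuousOn f s) (hf0 : ∀ x ∈ s, f x ≠ 0)
    (hg : ∀ x (hx : x ∈ s), (g x).1 = Projectivization.mk ℂ (f x) (hf0 x hx)) :
    ContinuousOn g s := by
  let _ : TopologicalSpace (ℙ ℂ (ι → ℂ)) := TopologicalSpace.coinduced
    (fun v : {v : ι → ℂ // v ≠ 0} => Projectivization.mk' ℂ v) inferInstance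
  rw [continuousOn_iff_continuous_domRestrict]
  have h1 : Continuous fun x : s => (⟨f x, hf0 x x.2⟩ : {v : ι → ℂ // v ≠ 0}) :=
    (continuousOn_iff_continuous_domRestrict.1 hf).subtype_mk _
  have h2 : Continuous fun v : {v : ι → ℂ // v ≠ 0} => Projectivization.mk' ℂ v :=
    continuous_coinduced_rng
  refine continuous_induced_rng.2 ((h2.comp h1).congr fun x => ?_)
  exact (hg x x.2).symm

end Topology

variable {K : Type*} [Field K] [Algebra ℂ K] {ι : Type*} (C : ProjVariety K ι) (o : ι)

/-- The ring of regular functions of the affine chart `x_o ≠ 0`. -/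
def affineRing : Subalgebra ℂ K := Algebra.adjoin ℂ (Set.range fun i => C.coord i / C.coord o)

theorem coord_div_mem (i : ι) : C.coord i / C.coord o ∈ C.affineRing o :=
  Algebra.subset_adjoin ⟨i, rfl⟩

/-- The affine coordinates of the chart `x_o ≠ 0`. -/
def affineCoord (i : ι) : C.affineRing o := ⟨C.coord i / C.coord o, C.coord_div_mem o i⟩

variable {o}

theorem adjoin_affineCoord_eq_top (ho : C.coord o ≠ 0) :
    IntermediateField.adjoin ℂ (Set.range fun i => C.coord i / C.coord o) = ⊤ := by
  rw [eq_top_iff, ← C.adjoin_eq_top, IntermediateField.adjoin_le_iff]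
  rintro _ ⟨⟨i, j⟩, rfl⟩
  have h : ∀ i, C.coord i / C.coord o
      ∈ IntermediateField.adjoin ℂ (Set.range fun i => C.coord i / C.coord o) :=
    fun i => IntermediateField.subset_adjoin ℂ _ ⟨i, rfl⟩
  have := div_mem (h i) (h j)
  rwa [div_div_div_cancel_right₀ ho] at this

theorem exists_eq_div_affineRing (ho : C.coord o ≠ 0) (k : K) :
    ∃ a s : C.affineRing o, s ≠ 0 ∧ k = a / s := by
  have hk : k ∈ IntermediateField.adjoin ℂ (Set.range fun i => C.coord i / C.coord o) := by
    rw [C.adjoin_affineCoord_eq_top ho]; exact IntermediateField.mem_top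
  obtain ⟨a, ha, s, hs, rfl⟩ := IntermediateField.mem_adjoin_iff_div.1 hk
  by_cases h : s = 0
  · exact ⟨0, 1, one_ne_zero, by simp [h]⟩
  · exact ⟨⟨a, ha⟩, ⟨s, hs⟩, fun h' => h (congrArg Subtype.val h'), rfl⟩

instance [Finite ι] : Algebra.FiniteType ℂ (C.affineRing o) :=
  (Subalgebra.fg_iff_finiteType _).1 ⟨(Set.finite_range fun i => C.coord i / C.coord o).toFinset, by
    rw [Set.Finite.coe_toFinset]; rfl⟩

/-- The chart ring inherits transcendence degree at most one, and it is not algebraic because `K`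
consists of quotients of its elements. -/
theorem exists_points [Finite ι] (ho : C.coord o ≠ 0) (hdim : C.dim = 1) :
    ∃ e : ℂ → (C.affineRing o →ₐ[ℂ] ℂ), ∀ a, a ≠ 0 → {z | e z a = 0}.Finite := by
  have htr : Algebra.trdeg ℂ K = 1 := Cardinal.toNat_eq_one.1 hdim
  apply exists_points_of_trdeg_eq_one
  · rw [← htr]
    exact trdeg_le_of_injective (C.affineRing o).val Subtype.val_injective
  · intro halg
    have : Algebra.IsAlgebraic ℂ K := ⟨fun k => by
      obtain ⟨a, s, -, rfl⟩ := C.exists_eq_div_affineRing ho k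
      have h : ∀ a : C.affineRing o, IsAlgebraic ℂ (a : K) := fun a =>
        (halg.isAlgebraic a).algHom (C.affineRing o).val
      rw [div_eq_mul_inv]
      exact (h a).mul (h s).inv⟩
    rw [trdeg_eq_zero] at htr
    exact zero_ne_one htr

variable (o) in
/-- The regular functions of the affine chart `C_o × 𝔸¹` of `C × ℙ¹`, as rational functions. -/
def toRatFunc : Polynomial (C.affineRing o) →ₐ[ℂ] RatFunc K :=
  (IsScalarTower.toAlgHom ℂ (Polynomial K) (RatFunc K)).comp
    (Polynomial.mapAlgHom (C.affineRing o).val)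

theorem toRatFunc_apply (P : Polynomial (C.affineRing o)) : C.toRatFunc o P
    = algebraMap (Polynomial K) (RatFunc K) (P.map (algebraMap (C.affineRing o) K)) := rfl

@[simp]
theorem toRatFunc_C (a : C.affineRing o) :
    C.toRatFunc o (Polynomial.C a) = RatFunc.C (a : K) := by
  rw [toRatFunc_apply, Polynomial.map_C, RatFunc.algebraMap_C]; rfl

@[simp]
theorem toRatFunc_X : C.toRatFunc o Polynomial.X = RatFunc.X := by
  rw [toRatFunc_apply, Polynomial.map_X, RatFunc.algebraMap_X]

theorem toRatFunc_injective : Function.Injective (C.toRatFunc o) :=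
  (RatFunc.algebraMap_injective K).comp (Polynomial.map_injective _ Subtype.val_injective)

/-- The value at the point `(e, v)` of the affine chart `C_o × 𝔸¹`. -/
def evalAt {A : Type*} [CommRing A] [Algebra ℂ A] (e : A →ₐ[ℂ] ℂ) (v : ℂ) :
    Polynomial A →ₐ[ℂ] ℂ :=
  (Polynomial.aeval v).comp (Polynomial.mapAlgHom e)

@[simp]
theorem evalAt_C {A : Type*} [CommRing A] [Algebra ℂ A] (e : A →ₐ[ℂ] ℂ) (v : ℂ) (a : A) :
    evalAt e v (Polynomial.C a) = e a := by simp [evalAt]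

@[simp]
theorem evalAt_X {A : Type*} [CommRing A] [Algebra ℂ A] (e : A →ₐ[ℂ] ℂ) (v : ℂ) :
    evalAt e v Polynomial.X = v := by simp [evalAt]

theorem evalAt_eq_eval_map {A : Type*} [CommRing A] [Algebra ℂ A] (e : A →ₐ[ℂ] ℂ) (v : ℂ)
    (P : Polynomial A) : evalAt e v P = (P.map (e : A →+* ℂ)).eval v := by
  simp [evalAt]

variable (o) in
/-- The homogeneous coordinates of `C × ℙ¹`, divided by `x_o`. -/
def prodCoord (ij : ι × Fin 2) : Polynomial (C.affineRing o) :=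
  Polynomial.C (C.affineCoord o ij.1) * ![1, Polynomial.X] ij.2

theorem mul_toRatFunc_prodCoord (ho : C.coord o ≠ 0) (ij : ι × Fin 2) :
    RatFunc.C (C.coord o) * C.toRatFunc o (C.prodCoord o ij) = C.prodP1.coord ij := by
  have ho' : (RatFunc.C (C.coord o) : RatFunc K) ≠ 0 := by simpa using ho
  obtain ⟨i, j⟩ := ij
  fin_cases j <;> simp [prodCoord, prodP1, affineCoord] <;> field_simp

/-- Dehomogenisation: forms on `C × ℙ¹` become polynomials in `y` over the chart ring, which can be
evaluated at a pair `(e, v)`. -/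
theorem aeval_prodP1_coord (ho : C.coord o ≠ 0) {d : ℕ} {f : MvPolynomial (ι × Fin 2) ℂ}
    (hf : f.IsHomogeneous d) : MvPolynomial.aeval C.prodP1.coord f
      = RatFunc.C (C.coord o) ^ d * C.toRatFunc o (MvPolynomial.aeval (C.prodCoord o) f) := by
  rw [MvPolynomial.comp_aeval_apply, ← hf.aeval_const_mul]
  rw [show C.prodP1.coord = fun ij => RatFunc.C (C.coord o) * C.toRatFunc o (C.prodCoord o ij) from
    funext fun ij => (C.mul_toRatFunc_prodCoord ho ij).symm]

/-- The homogeneous coordinates of the point `(e, v)`. -/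
def pointVec (e : C.affineRing o →ₐ[ℂ] ℂ) (v : ℂ) (ij : ι × Fin 2) : ℂ :=
  e (C.affineCoord o ij.1) * ![1, v] ij.2

theorem evalAt_prodCoord (e : C.affineRing o →ₐ[ℂ] ℂ) (v : ℂ) (ij : ι × Fin 2) :
    evalAt e v (C.prodCoord o ij) = C.pointVec e v ij := by
  obtain ⟨i, j⟩ := ij
  fin_cases j <;> simp [prodCoord, pointVec]

theorem affineCoord_self (ho : C.coord o ≠ 0) : C.affineCoord o o = 1 :=
  Subtype.ext (div_self ho)

theorem pointVec_zero (ho : C.coord o ≠ 0) (e : C.affineRing o →ₐ[ℂ] ℂ) (v : ℂ) :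
    C.pointVec e v (o, 0) = 1 := by simp [pointVec, C.affineCoord_self ho]

theorem pointVec_one (ho : C.coord o ≠ 0) (e : C.affineRing o →ₐ[ℂ] ℂ) (v : ℂ) :
    C.pointVec e v (o, 1) = v := by simp [pointVec, C.affineCoord_self ho]

theorem pointVec_ne_zero (ho : C.coord o ≠ 0) (e : C.affineRing o →ₐ[ℂ] ℂ) (v : ℂ) :
    C.pointVec e v ≠ 0 := fun h => by
  have := congrFun h (o, 0)
  rw [C.pointVec_zero ho] at this
  exact one_ne_zero this

theorem eval_pointVec (e : C.affineRing o →ₐ[ℂ] ℂ) (v : ℂ) (f : MvPolynomial (ι × Fin 2) ℂ) :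
    MvPolynomial.eval (C.pointVec e v) f = evalAt e v (MvPolynomial.aeval (C.prodCoord o) f) := by
  rw [MvPolynomial.comp_aeval_apply]
  simp only [evalAt_prodCoord]
  rfl

/-- The point `(e, v)` of the affine chart `C_o × 𝔸¹` of `C × ℙ¹`. -/
def point (ho : C.coord o ≠ 0) (e : C.affineRing o →ₐ[ℂ] ℂ) (v : ℂ) : C.prodP1.Point :=
  ⟨Projectivization.mk ℂ (C.pointVec e v) (C.pointVec_ne_zero ho e v), fun d f hf => by
    obtain ⟨l, hl, h⟩ := rep_mk_smul (C.pointVec_ne_zero ho e v)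
    have h1 := hf.1.aeval_const_mul l (C.pointVec e v)
    have h2 := hf.2
    have ho' : (RatFunc.C (C.coord o) : RatFunc K) ≠ 0 := by simpa using ho
    -- An equation dehomogenises to the zero polynomial, as `toRatFunc` is injective, and so it
    -- holds at `(e, v)`.
    rw [C.aeval_prodP1_coord ho hf.1, mul_eq_zero, or_iff_right (pow_ne_zero _ ho'),
      map_eq_zero_iff _ C.toRatFunc_injective] at h2
    rw [MvPolynomial.aeval_eq_eval, MvPolynomial.aeval_eq_eval, C.eval_pointVec e v f, h2,
      map_zero, mul_zero] at h1
    rw [h]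
    exact h1⟩


variable {C}

theorem point_rep (ho : C.coord o ≠ 0) (e : C.affineRing o →ₐ[ℂ] ℂ) (v : ℂ) :
    ∃ l : ℂ, l ≠ 0 ∧ (C.point ho e v).rep = l • C.pointVec e v :=
  rep_mk_smul (C.pointVec_ne_zero ho e v)

theorem point_rep_ne_zero (ho : C.coord o ≠ 0) (e : C.affineRing o →ₐ[ℂ] ℂ) (v : ℂ) :
    (C.point ho e v).rep (o, 0) ≠ 0 := by
  obtain ⟨l, hl, h⟩ := point_rep ho e v
  simpa [h, C.pointVec_zero ho] using hl

theorem point_ratio (ho : C.coord o ≠ 0) (e : C.affineRing o →ₐ[ℂ] ℂ) (v : ℂ) (ij : ι × Fin 2) :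
    (C.point ho e v).rep ij / (C.point ho e v).rep (o, 0) = C.pointVec e v ij := by
  obtain ⟨l, hl, h⟩ := point_rep ho e v
  rw [h, Pi.smul_apply, Pi.smul_apply, C.pointVec_zero ho]
  simp [hl]

section Values

variable {q : C.prodP1.Point}

theorem hasValue_C_affineCoord (hq : q.rep (o, 0) ≠ 0) (i : ι) :
    C.prodP1.HasValue q (RatFunc.C (C.affineCoord o i : K)) (q.rep (i, 0) / q.rep (o, 0)) := by
  have h := HasValue.coord_div hq (i, 0)
  simpa [prodP1, affineCoord] using h

theorem hasValue_X (ho : C.coord o ≠ 0) (hq : q.rep (o, 0) ≠ 0) :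
    C.prodP1.HasValue q RatFunc.X (q.rep (o, 1) / q.rep (o, 0)) := by
  have ho' : (RatFunc.C (C.coord o) : RatFunc K) ≠ 0 := by simpa using ho
  have h := HasValue.coord_div hq (o, 1)
  simpa [prodP1, ho'] using h

theorem isRegularAt_C (hq : q.rep (o, 0) ≠ 0) (a : C.affineRing o) :
    C.prodP1.IsRegularAt q (RatFunc.C (a : K)) := by
  obtain ⟨a, ha⟩ := a
  change C.prodP1.IsRegularAt q (RatFunc.C a)
  induction ha using Algebra.adjoin_induction with
  | mem x hx =>
    obtain ⟨i, rfl⟩ := hx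
    exact (hasValue_C_affineCoord hq i).isRegularAt
  | algebraMap z => rw [← algebraMap_ratFunc_eq]; exact (HasValue.algebraMap z).isRegularAt
  | add x y _ _ hx hy => rw [map_add]; exact hx.add hy
  | mul x y _ _ hx hy => rw [map_mul]; exact hx.mul hy

theorem hasValue_C_of_affineCoord {e : C.affineRing o →ₐ[ℂ] ℂ}
    (he : ∀ i, C.prodP1.HasValue q (RatFunc.C (C.affineCoord o i : K)) (e (C.affineCoord o i)))
    (a : C.affineRing o) : C.prodP1.HasValue q (RatFunc.C (a : K)) (e a) := by
  obtain ⟨a, ha⟩ := a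
  change C.prodP1.HasValue q (RatFunc.C a) _
  induction ha using Algebra.adjoin_induction with
  | mem x hx =>
    obtain ⟨i, rfl⟩ := hx
    exact he i
  | algebraMap z =>
    rw [← algebraMap_ratFunc_eq]
    convert! HasValue.algebraMap (V := C.prodP1) (p := q) z
    exact e.commutes z
  | add x y hx hy hx' hy' =>
    rw [map_add]
    convert! hx'.add hy'
    exact map_add e ⟨x, hx⟩ ⟨y, hy⟩
  | mul x y hx hy hx' hy' =>
    rw [map_mul]
    convert! hx'.mul hy'
    exact map_mul e ⟨x, hx⟩ ⟨y, hy⟩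

theorem hasValue_toRatFunc {e : C.affineRing o →ₐ[ℂ] ℂ} {w : ℂ}
    (he : ∀ a : C.affineRing o, C.prodP1.HasValue q (RatFunc.C (a : K)) (e a))
    (hw : C.prodP1.HasValue q RatFunc.X w) (P : Polynomial (C.affineRing o)) :
    C.prodP1.HasValue q (C.toRatFunc o P) (evalAt e w P) := by
  induction P using Polynomial.induction_on with
  | C a => simpa using he a
  | add p q hp hq => rw [map_add, map_add]; exact hp.add hq
  | monomial n a h =>
    rw [pow_succ, ← mul_assoc, map_mul, map_mul]
    simpa using h.mul hw

theorem hasValue_point_C (ho : C.coord o ≠ 0) (e : C.affineRing o →ₐ[ℂ] ℂ) (v : ℂ)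
    (a : C.affineRing o) : C.prodP1.HasValue (C.point ho e v) (RatFunc.C (a : K)) (e a) := by
  refine hasValue_C_of_affineCoord (fun i => ?_) a
  have := hasValue_C_affineCoord (point_rep_ne_zero ho e v) i
  rw [point_ratio ho] at this
  simpa [pointVec] using this

theorem hasValue_point_X (ho : C.coord o ≠ 0) (e : C.affineRing o →ₐ[ℂ] ℂ) (v : ℂ) :
    C.prodP1.HasValue (C.point ho e v) RatFunc.X v := by
  have := hasValue_X ho (point_rep_ne_zero ho e v)
  rwa [point_ratio ho, C.pointVec_one ho] at this

theorem hasValue_point (ho : C.coord o ≠ 0) (e : C.affineRing o →ₐ[ℂ] ℂ) (v : ℂ)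
    (P : Polynomial (C.affineRing o)) :
    C.prodP1.HasValue (C.point ho e v) (C.toRatFunc o P) (evalAt e v P) :=
  hasValue_toRatFunc (hasValue_point_C ho e v) (hasValue_point_X ho e v) P

end Values

theorem exists_eq_div_toRatFunc (ho : C.coord o ≠ 0) (h : RatFunc K) :
    ∃ P Q : Polynomial (C.affineRing o), Q ≠ 0 ∧ h = C.toRatFunc o P / C.toRatFunc o Q := by
  have key : ∀ p : Polynomial K, ∃ (P : Polynomial (C.affineRing o)) (s : C.affineRing o), s ≠ 0 ∧
      algebraMap (Polynomial K) (RatFunc K) p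
        = C.toRatFunc o P / C.toRatFunc o (Polynomial.C s) := by
    intro p
    have hne : ∀ s : C.affineRing o, s ≠ 0 → C.toRatFunc o (Polynomial.C s) ≠ 0 := fun s hs => by
      rw [Ne, map_eq_zero_iff _ C.toRatFunc_injective]; simpa using hs
    induction p using Polynomial.induction_on' with
    | add p q hp hq =>
      obtain ⟨P, s, hs, h⟩ := hp
      obtain ⟨P', s', hs', h'⟩ := hq
      refine ⟨P * Polynomial.C s' + Polynomial.C s * P', s * s', mul_ne_zero hs hs', ?_⟩
      rw [map_add, h, h', div_add_div _ _ (hne s hs) (hne s' hs')]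
      simp only [map_add, map_mul]
    | monomial n a =>
      obtain ⟨r, s, hs, rfl⟩ := C.exists_eq_div_affineRing ho a
      refine ⟨Polynomial.C r * Polynomial.X ^ n, s, hs, ?_⟩
      rw [RatFunc.algebraMap_monomial, map_mul, map_pow, toRatFunc_C, toRatFunc_X, toRatFunc_C,
        map_div₀]
      ring
  have hne : ∀ s : C.affineRing o, s ≠ 0 → C.toRatFunc o (Polynomial.C s) ≠ 0 := fun s hs => by
    rw [Ne, map_eq_zero_iff _ C.toRatFunc_injective]; simpa using hs
  obtain ⟨p, q, hq, rfl⟩ := ratFunc_eq_div h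
  obtain ⟨P, s, hs, hP⟩ := key p
  obtain ⟨Q, r, hr, hQ⟩ := key q
  have hq' := RatFunc.algebraMap_ne_zero (K := K) hq
  rw [hQ] at hq'
  have hQ0 : Q ≠ 0 := by
    rintro rfl
    simp at hq'
  refine ⟨P * Polynomial.C r, Polynomial.C s * Q, mul_ne_zero (by simpa using hs) hQ0, ?_⟩
  rw [hP, hQ, div_div_div_eq, map_mul, map_mul]

/-- Any one nonzero coefficient of `P` already vanishes at only finitely many members of the family.
-/
theorem finite_setOf_map_eq_zero {A : Type*} [CommRing A] [Algebra ℂ A] {e : ℂ → (A →ₐ[ℂ] ℂ)}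
    (he : ∀ a, a ≠ 0 → {z | e z a = 0}.Finite) {P : Polynomial A} (hP : P ≠ 0) :
    {z | P.map (e z : A →+* ℂ) = 0}.Finite := by
  obtain ⟨n, hn⟩ : ∃ n, P.coeff n ≠ 0 := by
    by_contra! h
    exact hP (Polynomial.ext h)
  refine (he _ hn).subset fun z hz => ?_
  have := congrArg (fun p => Polynomial.coeff p n) (show P.map (e z : A →+* ℂ) = 0 from hz)
  simpa using this

/-- A rational function vanishing at enough points vanishes. -/
theorem eq_zero_of_hasValue_zero (ho : C.coord o ≠ 0) {e : ℂ → (C.affineRing o →ₐ[ℂ] ℂ)}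
    (he : ∀ a, a ≠ 0 → {z | e z a = 0}.Finite) {Z : Set ℂ} (hZ : ¬ Z.Countable) {V : ℂ → Set ℂ}
    (hV : ∀ z ∈ Z, (V z).Infinite) {h : RatFunc K}
    (hh : ∀ z ∈ Z, ∀ v ∈ V z, C.prodP1.HasValue (C.point ho (e z) v) h 0) : h = 0 := by
  obtain ⟨P, Q, hQ, rfl⟩ := exists_eq_div_toRatFunc ho h
  by_contra hne
  have hP : P ≠ 0 := by rintro rfl; simp at hne
  apply hZ
  refine ((finite_setOf_map_eq_zero he hP).subset fun z hz => ?_).countable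
  apply Polynomial.eq_zero_of_infinite_isRoot
  refine (hV z hz).mono fun v hv => ?_
  -- Multiplying by the value of `Q` gives `P` the value zero, whether or not `Q` vanishes at the
  -- point.
  have h1 := (hh z hz v hv).mul (hasValue_point ho (e z) v Q)
  have hQ' : C.toRatFunc o Q ≠ 0 := by rwa [Ne, map_eq_zero_iff _ C.toRatFunc_injective]
  rw [div_mul_cancel₀ _ hQ', zero_mul] at h1
  have := (hasValue_point ho (e z) v P).unique h1
  rwa [evalAt_eq_eval_map] at this

end ProjVariety

/-! ### The flow restricted to fibres -/

/-- If for most `z` and most `v` the property `P z v ε` holds for small `ε`, then some `ε` works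
for uncountably many `z` and infinitely many `v`. -/
theorem exists_uniform_radius {P : ℂ → ℂ → ℝ → Prop}
    (hanti : ∀ z v ε ε', ε' ≤ ε → P z v ε → P z v ε') {B : Set ℂ} (hB : B.Countable)
    (hP : ∀ z ∉ B, {v | ¬ ∃ ε > 0, P z v ε}.Finite) :
    ∃ ε > 0, ∃ Z : Set ℂ, ¬ Z.Countable ∧ ∀ z ∈ Z, {v | P z v ε}.Infinite := by
  have hunc : ¬ (Set.univ : Set ℂ).Countable := fun h =>
    not_countable_complex h
  have hsmall : ∀ z v, (∃ ε > 0, P z v ε) → ∃ n : ℕ, P z v (1 / ((n : ℝ) + 1)) := by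
    rintro z v ⟨ε, hε, h⟩
    obtain ⟨n, hn⟩ := exists_nat_one_div_lt hε
    exact ⟨n, hanti _ _ _ _ hn.le h⟩
  -- If each radius `1/(n+1)` were good for only finitely many `v`, then `ℂ` would be countable. The
  -- same argument over `z` then fixes one `n`.
  have h1 : ∀ z ∉ B, ∃ n : ℕ, {v | P z v (1 / ((n : ℝ) + 1))}.Infinite := by
    intro z hz
    by_contra! hfin
    apply hunc
    refine ((hP z hz).countable.union
      (Set.countable_iUnion fun n : ℕ => (hfin n).countable)).mono ?_
    intro v _
    by_cases hv : ∃ ε > 0, P z v ε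
    · exact Or.inr (Set.mem_iUnion.2 (hsmall z v hv))
    · exact Or.inl hv
  by_contra! hcon
  apply hunc
  refine (hB.union (Set.countable_iUnion fun n : ℕ => (by_contra fun h => ?_ :
    {z | {v | P z v (1 / ((n : ℝ) + 1))}.Infinite}.Countable))).mono ?_
  · obtain ⟨z, hz, hz'⟩ := hcon _ Nat.one_div_pos_of_nat _ h
    exact Set.not_infinite.2 hz' hz
  · intro z _
    by_cases hz : z ∈ B
    · exact Or.inl hz
    · exact Or.inr (Set.mem_iUnion.2 (h1 z hz))

namespace ProjVariety

variable {K : Type*} [Field K] [Algebra ℂ K] {ι : Type*} {C : ProjVariety K ι} {o : ι}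

/-- Most points `(e z, v)` belong to a given non-empty Zariski open set. -/
theorem IsZariskiOpen.finite_notMem (ho : C.coord o ≠ 0) {e : ℂ → (C.affineRing o →ₐ[ℂ] ℂ)}
    (he : ∀ a, a ≠ 0 → {z | e z a = 0}.Finite) {W : Set C.prodP1.Point}
    (hW : C.prodP1.IsZariskiOpen W) (hne : W.Nonempty) :
    ∃ B : Set ℂ, B.Finite ∧ ∀ z ∉ B, {v | C.point ho (e z) v ∉ W}.Finite := by
  obtain ⟨T, hT, rfl⟩ := hW
  obtain ⟨p, g, hgT, hg⟩ := hne
  obtain ⟨d, hgd⟩ := hT g hgT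
  have h1 := aeval_coord_ne_zero hgd hg
  rw [C.aeval_prodP1_coord ho hgd] at h1
  have hG : MvPolynomial.aeval (C.prodCoord o) g ≠ 0 := fun h => by simp [h] at h1
  -- The bad `z` are those where the dehomogenised `g` vanishes on the whole fibre; on any other
  -- fibre the bad `v` are roots of a nonzero polynomial.
  refine ⟨_, finite_setOf_map_eq_zero he hG, fun z hz => ?_⟩
  refine (Polynomial.finite_setOfPred_isRoot hz).subset fun v hv => ?_
  by_contra hroot
  apply hv
  refine ⟨g, hgT, ?_⟩
  obtain ⟨l, hl, h⟩ := point_rep ho (e z) v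
  have h2 := hgd.aeval_const_mul l (C.pointVec (e z) v)
  rw [MvPolynomial.aeval_eq_eval, MvPolynomial.aeval_eq_eval, C.eval_pointVec] at h2
  rw [h]
  change MvPolynomial.eval (fun j => l * C.pointVec (e z) v j) g ≠ 0
  rw [h2, evalAt_eq_eval_map]
  exact mul_ne_zero (pow_ne_zero _ hl) hroot

/-- The local flow along the fibre through `(e, v)`, for times in the disc of radius `ε`. -/
structure IsFibreFlow (ho : C.coord o ≠ 0) (X : Derivation ℂ (RatFunc K) (RatFunc K))
    (φ : ℂ → Bir (RatFunc K)) (e : C.affineRing o →ₐ[ℂ] ℂ) (v : ℂ) (ε : ℝ) (w : ℂ → ℂ) :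
    Prop where
  map_zero : w 0 = v
  hasValue : ∀ t ∈ Metric.ball (0 : ℂ) ε, ∀ P : Polynomial (C.affineRing o),
    C.prodP1.HasValue (C.point ho e v) ((φ t).pullback (C.toRatFunc o P)) (evalAt e (w t) P)
  -- The speed `c` is the value of `X y` at `(e, w t)`, expressed for every fraction `P / Q` in
  -- cross-multiplied form.
  hasDerivAt : ∀ t ∈ Metric.ball (0 : ℂ) ε, ∃ c, HasDerivAt w c t ∧
    ∀ P Q : Polynomial (C.affineRing o), X RatFunc.X * C.toRatFunc o Q = C.toRatFunc o P →
      c * evalAt e (w t) Q = evalAt e (w t) P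

theorem IsFibreFlow.mono {ho : C.coord o ≠ 0} {X : Derivation ℂ (RatFunc K) (RatFunc K)}
    {φ : ℂ → Bir (RatFunc K)} {e : C.affineRing o →ₐ[ℂ] ℂ} {v : ℂ} {ε ε' : ℝ} {w : ℂ → ℂ}
    (hle : ε' ≤ ε) (h : IsFibreFlow ho X φ e v ε w) : IsFibreFlow ho X φ e v ε' w :=
  ⟨h.map_zero, fun t ht => h.hasValue t (Metric.ball_subset_ball hle ht),
    fun t ht => h.hasDerivAt t (Metric.ball_subset_ball hle ht)⟩

/-- `X` kills the functions coming from `C`, so they have zero derivative along an integral curve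
and the curve stays in its fibre. The radius is chosen so that the curve also stays in the chart. -/
theorem IsLocalFlow.exists_isFibreFlow (ho : C.coord o ≠ 0)
    {X : Derivation ℂ (RatFunc K) (RatFunc K)} (hX : IsTangentToFibration X)
    {φ : ℂ → Bir (RatFunc K)} {U : Set (ℂ × C.prodP1.Point)}
    {Φ : ℂ × C.prodP1.Point → C.prodP1.Point}
    (hU : IsOpen U) (hΦ : C.prodP1.IsLocalFlow X U Φ)
    (hφ : ∀ t p, (t, p) ∈ U → C.prodP1.MapsTo (φ t) p (Φ (t, p)))
    {e : C.affineRing o →ₐ[ℂ] ℂ} {v : ℂ} (hp : ((0 : ℂ), C.point ho e v) ∈ U) :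
    ∃ ε > 0, ∃ w, IsFibreFlow ho X φ e v ε w := by
  set p := C.point ho e v with hpdef
  have hslice : IsOpen {t : ℂ | (t, p) ∈ U} := hU.preimage (by fun_prop)
  have hcont : ContinuousOn (fun t : ℂ => Φ (t, p)) {t : ℂ | (t, p) ∈ U} :=
    hΦ.continuousOn.comp (by fun_prop) fun t ht => ht
  have hopen := hcont.isOpen_inter_preimage hslice (isOpen_chart (V := C.prodP1) (o, 0))
  have h0 : (0 : ℂ) ∈ {t : ℂ | (t, p) ∈ U} ∩
      (fun t : ℂ => Φ (t, p)) ⁻¹' {q | q.rep (o, 0) ≠ 0} := by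
    refine ⟨hp, ?_⟩
    change (Φ (0, p)).rep (o, 0) ≠ 0
    rw [hΦ.map_zero p hp]
    exact point_rep_ne_zero ho e v
  obtain ⟨ε, hε, hball⟩ := Metric.isOpen_iff.1 hopen 0 h0
  have hregX : ∀ t ∈ Metric.ball (0 : ℂ) ε, C.prodP1.IsRegularAt (Φ (t, p)) RatFunc.X :=
    fun t ht => (hasValue_X ho (hball ht).2).isRegularAt
  have hconst : ∀ (a : C.affineRing o), ∀ t ∈ Metric.ball (0 : ℂ) ε,
      C.prodP1.HasValue (Φ (t, p)) (RatFunc.C (a : K)) (e a) := by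
    intro a t ht
    have hreg : ∀ s ∈ Metric.ball (0 : ℂ) ε,
        C.prodP1.IsRegularAt (Φ (s, p)) (RatFunc.C (a : K)) :=
      fun s hs => isRegularAt_C (hball hs).2 a
    have hd : ∀ s ∈ Metric.ball (0 : ℂ) ε, HasDerivAt
        (fun s : ℂ => C.prodP1.value (RatFunc.C (a : K)) (Φ (s, p))) 0 s := by
      intro s hs
      have := hΦ.hasDerivAt s p (hball hs).1 _ (hreg s hs)
      rwa [hX, HasValue.zero.value_eq] at this
    have heq := (convex_ball (0 : ℂ) ε).is_const_of_fderivWithin_eq_zero (𝕜 := ℂ)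
      (f := fun s : ℂ => C.prodP1.value (RatFunc.C (a : K)) (Φ (s, p)))
      (fun s hs => (hd s hs).differentiableAt.differentiableWithinAt)
      (fun s hs => by
        rw [fderivWithin_of_isOpen Metric.isOpen_ball hs]
        ext
        simpa using (hd s hs).deriv) ht (Metric.mem_ball_self hε)
    have h1 := (hreg t ht).hasValue
    rw [heq, hΦ.map_zero p hp, (hasValue_point_C ho e v a).value_eq] at h1
    exact h1
  refine ⟨ε, hε, fun t => C.prodP1.value RatFunc.X (Φ (t, p)), ?_, ?_, ?_⟩
  · rw [hΦ.map_zero p hp]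
    exact (hasValue_point_X ho e v).value_eq
  · intro t ht P
    exact hφ t p (hball ht).1 _ _ (hasValue_toRatFunc (fun a => hconst a t ht)
      (hregX t ht).hasValue P)
  · intro t ht
    refine ⟨_, hΦ.hasDerivAt t p (hball ht).1 _ (hregX t ht), fun P Q hPQ => ?_⟩
    have hval := hasValue_toRatFunc (fun a => hconst a t ht) (hregX t ht).hasValue
    have h1 := (hΦ.isHolomorphicAt _ (hball ht).1 _ (hregX t ht)).hasValue.mul (hval Q)
    rw [hPQ] at h1
    exact h1.unique (hval P)

/-- The admissible open set contains `(0, p)` for most points `p = (e z, v)`, with a radius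
depending on `p`; `exists_uniform_radius` makes the radius uniform. -/
theorem IsBirationallyIntegrable.exists_isFibreFlow (ho : C.coord o ≠ 0)
    {e : ℂ → (C.affineRing o →ₐ[ℂ] ℂ)} (he : ∀ a, a ≠ 0 → {z | e z a = 0}.Finite)
    {X : Derivation ℂ (RatFunc K) (RatFunc K)} (hX : IsTangentToFibration X)
    (hint : C.prodP1.IsBirationallyIntegrable X) :
    ∃ φ : Multiplicative ℂ →* Bir (RatFunc K), ∃ ε > 0, ∃ Z : Set ℂ, ¬ Z.Countable ∧
      ∃ V : ℂ → Set ℂ, (∀ z ∈ Z, (V z).Infinite) ∧ ∃ w : ℂ → ℂ → ℂ → ℂ, ∀ z ∈ Z, ∀ v ∈ V z,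
        IsFibreFlow ho X (fun t => φ (Multiplicative.ofAdd t)) (e z) v ε (w z v) := by
  obtain ⟨φ, U, ⟨hU, W, hW, hWne, hWU⟩, Φ, hΦ, hφ⟩ := hint
  obtain ⟨B, hB, hBW⟩ := hW.finite_notMem ho he hWne
  obtain ⟨ε, hε, Z, hZ, hV⟩ := exists_uniform_radius
    (P := fun z v ε => ∃ w, IsFibreFlow ho X (fun t => φ (Multiplicative.ofAdd t)) (e z) v ε w)
    (fun z v ε ε' hle ⟨w, h⟩ => ⟨w, h.mono hle⟩) hB.countable
    (fun z hz => (hBW z hz).subset fun v hv hmem => hv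
      (hΦ.exists_isFibreFlow ho hX hU (φ := fun t => φ (Multiplicative.ofAdd t)) hφ
        (hWU _ hmem)))
  have hw : ∀ z v, ∃ w, (∃ w, IsFibreFlow ho X (fun t => φ (Multiplicative.ofAdd t)) (e z) v ε w) →
      IsFibreFlow ho X (fun t => φ (Multiplicative.ofAdd t)) (e z) v ε w := fun z v => by
    by_cases h : ∃ w, IsFibreFlow ho X (fun t => φ (Multiplicative.ofAdd t)) (e z) v ε w
    · exact h.imp fun w hw _ => hw
    · exact ⟨0, fun h' => absurd h' h⟩
  choose w hw using hw
  exact ⟨φ, ε, hε, Z, hZ, _, hV, w, fun z _ v hv => hw z v hv⟩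

end ProjVariety

/-! ### Integrable fields are quadratic with constant discriminant -/

theorem IsOverBase.pow {K : Type*} [Field K] [Algebra ℂ K] {φ : Bir (RatFunc K)}
    (h : IsOverBase φ) (n : ℕ) : IsOverBase (φ ^ n) := by
  induction n with
  | zero => exact fun k => rfl
  | succ n ih =>
    intro k
    rw [pow_succ']
    change (φ ^ n).pullback (φ.pullback (RatFunc.C k)) = _
    rw [h k, ih k]

theorem coeff_eq_zero_of_infinite {p q r : ℂ} {V : Set ℂ} (hV : V.Infinite)
    (h : ∀ v ∈ V, p * v ^ 2 + q * v + r = 0) : p = 0 ∧ q = 0 ∧ r = 0 := by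
  have : (Polynomial.C p * Polynomial.X ^ 2 + Polynomial.C q * Polynomial.X + Polynomial.C r) = 0 :=
    Polynomial.eq_zero_of_infinite_isRoot _ (hV.mono fun v hv => by
      simpa [Polynomial.IsRoot] using h v hv)
  have h2 := congrArg (fun p => Polynomial.coeff p 2) this
  have h1 := congrArg (fun p => Polynomial.coeff p 1) this
  have h0 := congrArg (fun p => Polynomial.coeff p 0) this
  simp only [Polynomial.coeff_add, Polynomial.coeff_C_mul, Polynomial.coeff_X_pow,
    Polynomial.coeff_X, Polynomial.coeff_C] at h0 h1 h2
  norm_num at h0 h1 h2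
  exact ⟨h2, h1, h0⟩

/-- The numerator of the derivative of `P / Q` over `Q²`. -/
def quotientRule {R : Type*} [CommRing R] (P Q : Polynomial R) : Polynomial R :=
  Polynomial.derivative P * Q - P * Polynomial.derivative Q

theorem map_quotientRule {R S : Type*} [CommRing R] [CommRing S] (f : R →+* S)
    (P Q : Polynomial R) : (quotientRule P Q).map f = quotientRule (P.map f) (Q.map f) := by
  simp [quotientRule, Polynomial.derivative_map]

/-- When a fraction is a polynomial `p`, the numerator given by the quotient rule still encodes
`p'`, so it can be iterated. -/
theorem quotientRule_mul {R : Type*} [CommRing R] (p Q : Polynomial R) :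
    quotientRule (p * Q) Q = Polynomial.derivative p * Q ^ 2 := by
  simp only [quotientRule, Polynomial.derivative_mul]
  ring

namespace ProjVariety

variable {K : Type*} [Field K] [Algebra ℂ K] {ι : Type*} {C : ProjVariety K ι} {o : ι}

theorem exists_common_denom (ho : C.coord o ≠ 0) {τ : Type*} [Fintype τ] (k : τ → K) :
    ∃ s : C.affineRing o, s ≠ 0 ∧ ∀ i, ∃ a : C.affineRing o, k i * s = a := by
  choose a s hs h using fun i => C.exists_eq_div_affineRing ho (k i)
  refine ⟨∏ i, s i, Finset.prod_ne_zero_iff.2 fun i _ => hs i, fun i => ?_⟩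
  obtain ⟨c, hc⟩ := Finset.dvd_prod_of_mem s (Finset.mem_univ i)
  have hsi : (s i : K) ≠ 0 := fun h0 => hs i (Subtype.ext h0)
  refine ⟨a i * c, ?_⟩
  rw [hc, h i]
  push_cast
  field_simp

/-- Clearing denominators gives a matrix that can be evaluated at points of the chart. -/
theorem exists_isHomography_affineRing (ho : C.coord o ≠ 0) {σ : RatFunc K ≃ₐ[ℂ] RatFunc K}
    (hσ : ∀ k, σ (RatFunc.C k) = RatFunc.C k) :
    ∃ N : Matrix (Fin 2) (Fin 2) (C.affineRing o), IsHomography σ (N.map (↑)) := by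
  obtain ⟨M, hM⟩ := exists_isHomography_of_map_C hσ
  obtain ⟨s, hs, h⟩ := exists_common_denom (C := C) ho (fun ij : Fin 2 × Fin 2 => M ij.1 ij.2)
  choose a ha using h
  have hs' : (s : K) ≠ 0 := fun h0 => hs (Subtype.ext h0)
  have hNM : (Matrix.of fun i j => a (i, j)).map ((↑) : C.affineRing o → K) = (s : K) • M := by
    ext i j
    simp [← ha (i, j), mul_comm]
  refine ⟨Matrix.of fun i j => a (i, j), ?_⟩
  rw [hNM]
  refine ⟨hσ, ?_, ?_⟩
  · rw [Matrix.det_smul]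
    exact mul_ne_zero (pow_ne_zero _ hs') hM.det_ne_zero
  · simp only [Matrix.smul_apply, smul_eq_mul, map_mul]
    linear_combination RatFunc.C (s : K) * hM.map_X

section FlowFamily

variable {ho : C.coord o ≠ 0} {e : ℂ → (C.affineRing o →ₐ[ℂ] ℂ)}
  {X : Derivation ℂ (RatFunc K) (RatFunc K)} {φ : Multiplicative ℂ →* Bir (RatFunc K)} {ε : ℝ}

/-- Evaluate at `(e, v)` the relation defining the homography; the value there of the pull-back of
`y` is `w t`. Nothing is asked of the determinant at `e`. -/
theorem IsFibreFlow.homography {e : C.affineRing o →ₐ[ℂ] ℂ} {v : ℂ} {w : ℂ → ℂ}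
    {φ : ℂ → Bir (RatFunc K)} (h : IsFibreFlow ho X φ e v ε w) {t : ℂ}
    (ht : t ∈ Metric.ball (0 : ℂ) ε) {N : Matrix (Fin 2) (Fin 2) (C.affineRing o)}
    (hN : IsHomography (φ t).pullback (N.map (↑))) :
    w t * (e (N 1 0) * v + e (N 1 1)) = e (N 0 0) * v + e (N 0 1) := by
  have h1 := h.hasValue t ht Polynomial.X
  have hlin : ∀ a b : C.affineRing o, C.prodP1.HasValue (C.point ho e v)
      (RatFunc.C (a : K) * RatFunc.X + RatFunc.C (b : K)) (e a * v + e b) := fun a b =>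
    ((hasValue_point_C ho e v a).mul (hasValue_point_X ho e v)).add (hasValue_point_C ho e v b)
  have h2 := h1.mul (hlin (N 1 0) (N 1 1))
  have h3 := hN.map_X
  simp only [Matrix.map_apply] at h3
  rw [toRatFunc_X, h3, evalAt_X] at h2
  exact h2.unique (hlin (N 0 0) (N 0 1))

variable {Z : Set ℂ} {V : ℂ → Set ℂ} {w : ℂ → ℂ → ℂ → ℂ}

/-- For small `t`, the difference between `a` and its pull-back vanishes at enough points to be
zero. Other times follow from `φ(t) = φ(t/n)^n`. -/
theorem isOverBase_of_isFibreFlow (he : ∀ a, a ≠ 0 → {z | e z a = 0}.Finite) (hε : 0 < ε)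
    (hZ : ¬ Z.Countable) (hV : ∀ z ∈ Z, (V z).Infinite) (hw : ∀ z ∈ Z, ∀ v ∈ V z,
      IsFibreFlow ho X (fun t => φ (Multiplicative.ofAdd t)) (e z) v ε (w z v)) (t : ℂ) :
    IsOverBase (φ (Multiplicative.ofAdd t)) := by
  have hsmall : ∀ t ∈ Metric.ball (0 : ℂ) ε, IsOverBase (φ (Multiplicative.ofAdd t)) := by
    intro t ht
    have hA : ∀ a : C.affineRing o, (φ (Multiplicative.ofAdd t)).pullback (RatFunc.C (a : K))
        = RatFunc.C (a : K) := by
      intro a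
      rw [← sub_eq_zero]
      refine eq_zero_of_hasValue_zero ho he hZ hV fun z hz v hv => ?_
      have h1 := (hw z hz v hv).hasValue t ht (Polynomial.C a)
      rw [toRatFunc_C, evalAt_C] at h1
      simpa using h1.sub (hasValue_point_C ho (e z) v a)
    intro k
    obtain ⟨a, s, -, rfl⟩ := C.exists_eq_div_affineRing ho k
    rw [map_div₀, map_div₀, hA, hA]
  obtain ⟨n, hn⟩ := exists_nat_gt (‖t‖ / ε)
  have hn0 : 0 < (n : ℝ) := lt_of_le_of_lt (by positivity) hn
  have hn0' : (n : ℂ) ≠ 0 := by exact_mod_cast hn0.ne'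
  have hmul : φ (Multiplicative.ofAdd t) = φ (Multiplicative.ofAdd (t / n)) ^ n := by
    rw [← map_pow, ← ofAdd_nsmul, nsmul_eq_mul, mul_div_cancel₀ _ hn0']
  rw [hmul]
  refine (hsmall _ ?_).pow n
  rw [mem_ball_zero_iff, norm_div, Complex.norm_natCast, div_lt_iff₀ hn0]
  rwa [div_lt_iff₀ hε, mul_comm] at hn

theorem ddy_toRatFunc_div (P Q : Polynomial (C.affineRing o)) (hQ : Q ≠ 0) :
    ddy (C.toRatFunc o P / C.toRatFunc o Q)
      = C.toRatFunc o (quotientRule P Q) / C.toRatFunc o (Q ^ 2) := by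
  have hQ' : Q.map (algebraMap (C.affineRing o) K) ≠ 0 := fun h0 =>
    hQ (Polynomial.map_injective (algebraMap (C.affineRing o) K) Subtype.val_injective
      (by rw [Polynomial.map_zero]; exact h0))
  rw [ddy_apply, toRatFunc_apply, toRatFunc_apply, ratFuncDeriv_div _ _ hQ', toRatFunc_apply,
    map_quotientRule, toRatFunc_apply, Polynomial.map_pow, map_pow]
  rfl

/-- On all but countably many fibres over `Z` the cross-ratio argument shows that `P / Q` is a
polynomial of degree at most two. The numerator of its third derivative therefore vanishes on
uncountably many fibres, hence identically. -/
theorem exists_quadratic_of_isFibreFlow (he : ∀ a, a ≠ 0 → {z | e z a = 0}.Finite) (hε : 0 < ε)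
    (hZ : ¬ Z.Countable) (hV : ∀ z ∈ Z, (V z).Infinite) (hw : ∀ z ∈ Z, ∀ v ∈ V z,
      IsFibreFlow ho X (fun t => φ (Multiplicative.ofAdd t)) (e z) v ε (w z v)) :
    ∃ a b c : K, X RatFunc.X
      = RatFunc.C a * RatFunc.X ^ 2 + 2 * RatFunc.C b * RatFunc.X + RatFunc.C c := by
  obtain ⟨P, Q, hQ, hPQ⟩ := exists_eq_div_toRatFunc ho (X RatFunc.X)
  have hQ0 : C.toRatFunc o Q ≠ 0 := by rwa [Ne, map_eq_zero_iff _ C.toRatFunc_injective]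
  have hmulQ : X RatFunc.X * C.toRatFunc o Q = C.toRatFunc o P := by
    rw [hPQ, div_mul_cancel₀ _ hQ0]
  -- The shift by two keeps every time strictly inside the ball of radius `ε`.
  let s : ℕ → ℂ := fun j => ((ε / (j + 2) : ℝ) : ℂ)
  have hs : Filter.Tendsto s Filter.atTop (nhds 0) := by
    have h1 : Filter.Tendsto (fun j : ℕ => ε / ((j : ℝ) + 2)) Filter.atTop (nhds 0) :=
      Filter.Tendsto.div_atTop tendsto_const_nhds
        (Filter.tendsto_atTop_add_const_right _ _ tendsto_natCast_atTop_atTop)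
    have h2 := (Complex.continuous_ofReal.tendsto 0).comp h1
    rw [Complex.ofReal_zero] at h2
    exact h2
  have hs0 : ∀ j, s j ≠ 0 := fun j => by
    have : (0 : ℝ) < ε / (j + 2) := by positivity
    exact Complex.ofReal_ne_zero.2 this.ne'
  have hsball : ∀ j, s j ∈ Metric.ball (0 : ℂ) ε := fun j => by
    rw [mem_ball_zero_iff, Complex.norm_real, Real.norm_eq_abs, abs_of_pos (by positivity)]
    exact div_lt_self hε (by linarith [(Nat.cast_nonneg j : (0 : ℝ) ≤ j)])
  choose N hN using fun j => exists_isHomography_affineRing ho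
    (isOverBase_of_isFibreFlow he hε hZ hV hw (s j))
  have hdet : ∀ j, (N j).det ≠ 0 := fun j h0 => (hN j).det_ne_zero (by
    have : ((N j).map ((↑) : C.affineRing o → K)).det = ((N j).det : K) := by
      simp [Matrix.det_fin_two]
    rw [this, h0]; rfl)
  -- The successive derivatives of `P / Q` have denominators `Q²`, `(Q²)²` and `((Q²)²)²`.
  set P₃ := quotientRule (quotientRule (quotientRule P Q) (Q ^ 2)) ((Q ^ 2) ^ 2) with hP₃
  have hP₃0 : P₃ = 0 := by
    by_contra hne
    apply hZ
    refine ((finite_setOf_map_eq_zero he hne).countable.union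
      ((finite_setOf_map_eq_zero he hQ).countable.union
        (Set.countable_iUnion fun j => (he _ (hdet j)).countable))).mono fun z hz => ?_
    by_cases hzQ : Q.map (e z : C.affineRing o →+* ℂ) = 0
    · exact Or.inr (Or.inl hzQ)
    by_cases hzd : ∃ j, e z (N j).det = 0
    · exact Or.inr (Or.inr (Set.mem_iUnion.2 hzd))
    push Not at hzd
    refine Or.inl ?_
    have hV' : {v ∈ V z | evalAt (e z) v Q ≠ 0}.Infinite := by
      have := (hV z hz).sdiff (Polynomial.finite_setOfPred_isRoot hzQ)
      refine this.mono fun v hv => ⟨hv.1, ?_⟩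
      rw [evalAt_eq_eval_map]
      exact hv.2
    have hder : ∀ v ∈ {v ∈ V z | evalAt (e z) v Q ≠ 0},
        HasDerivAt (w z v) (evalAt (e z) v P / evalAt (e z) v Q) 0 := by
      rintro v ⟨hv, hvQ⟩
      obtain ⟨c, hc, hcP⟩ := (hw z hz v hv).hasDerivAt 0 (Metric.mem_ball_self hε)
      have := hcP P Q hmulQ
      rw [(hw z hz v hv).map_zero] at this
      rwa [← eq_div_of_mul_eq hvQ this]
    obtain ⟨p, hp, hpv⟩ := exists_quadratic_of_homography_flow hs hs0
      (a := fun j => e z (N j 0 0)) (b := fun j => e z (N j 0 1)) (c := fun j => e z (N j 1 0))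
      (d := fun j => e z (N j 1 1)) (fun j => by
        have := hzd j
        rwa [Matrix.det_fin_two, map_sub, map_mul, map_mul] at this) hV'
      (fun v hv => (hw z hz v hv.1).map_zero) hder
      (fun v hv j => (hw z hz v hv.1).homography (hsball j) (hN j))
    have hpoly : P.map (e z : C.affineRing o →+* ℂ) = p * Q.map (e z : C.affineRing o →+* ℂ) := by
      rw [← sub_eq_zero]
      refine Polynomial.eq_zero_of_infinite_isRoot _ (hV'.mono fun v hv => ?_)
      have := hpv v hv
      rw [div_eq_iff hv.2, evalAt_eq_eval_map, evalAt_eq_eval_map] at this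
      simp [Polynomial.IsRoot, this]
    change P₃.map (e z : C.affineRing o →+* ℂ) = 0
    have hp3 : Polynomial.derivative (Polynomial.derivative (Polynomial.derivative p)) = 0 := by
      have := Polynomial.iterate_derivative_eq_zero (p := p) (x := 3) (by omega)
      simpa using this
    rw [hP₃, map_quotientRule, map_quotientRule, map_quotientRule, hpoly, quotientRule_mul,
      Polynomial.map_pow, quotientRule_mul, Polynomial.map_pow, Polynomial.map_pow,
      quotientRule_mul, hp3, zero_mul]
  apply exists_quadratic_of_ddy_ddy_ddy_eq_zero
  rw [hPQ, ddy_toRatFunc_div _ _ hQ, ddy_toRatFunc_div _ _ (pow_ne_zero _ hQ),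
    ddy_toRatFunc_div _ _ (pow_ne_zero _ (pow_ne_zero _ hQ)), ← hP₃, hP₃0, map_zero, zero_div]

/-- In terms of eigenvalues, `tr²/det - 2` is `λ/μ + μ/λ`, so squaring a homography sends it to its
square minus two. Repeated halving of the time gives an infinite backward orbit in `K`, which only a
constant can start. -/
theorem exists_trace_sq_eq_of_isOverBase [Finite ι] (ho : C.coord o ≠ 0) (hdim : C.dim = 1)
    (hφ : ∀ t, IsOverBase (φ (Multiplicative.ofAdd t))) (t : ℂ) :
    ∃ c : ℂ, ∀ M, IsHomography (φ (Multiplicative.ofAdd t)).pullback M →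
      M.trace ^ 2 = algebraMap ℂ K c * M.det := by
  choose M hM using fun j : ℕ => exists_isHomography_of_map_C (hφ (t / 2 ^ j))
  let u : ℕ → K := fun j => (M j).trace ^ 2 / (M j).det - 2
  have hu : ∀ j, u j = u (j + 1) ^ 2 - 2 := by
    intro j
    have hsq : (φ (Multiplicative.ofAdd (t / 2 ^ j))).pullback
        = (φ (Multiplicative.ofAdd (t / 2 ^ (j + 1)))).pullback.trans
          (φ (Multiplicative.ofAdd (t / 2 ^ (j + 1)))).pullback := by
      have : t / 2 ^ j = t / 2 ^ (j + 1) + t / 2 ^ (j + 1) := by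
        field_simp; ring
      rw [this, ofAdd_add, map_mul]
      rfl
    have h1 := (hM (j + 1)).trans (hM (j + 1))
    rw [← hsq] at h1
    have h2 := (hM j).trace_sq_mul_det h1
    have hd := (hM j).det_ne_zero
    have hd' := (hM (j + 1)).det_ne_zero
    have htr : (M (j + 1) * M (j + 1)).trace
        = (M (j + 1)).trace ^ 2 - 2 * (M (j + 1)).det := by
      simp only [Matrix.trace_fin_two, Matrix.det_fin_two, Matrix.mul_apply, Fin.sum_univ_two]
      ring
    rw [htr, Matrix.det_mul] at h2
    simp only [u]
    have h3 : (M j).trace ^ 2 / (M j).det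
        = ((M (j + 1)).trace ^ 2 - 2 * (M (j + 1)).det) ^ 2 / (M (j + 1)).det ^ 2 := by
      rw [div_eq_div_iff hd (pow_ne_zero 2 hd')]
      linear_combination h2
    rw [h3]
    field_simp
  obtain ⟨c, hc⟩ := mem_range_algebraMap_of_sq_sub_two
    (Set.finite_range fun i => C.coord i / C.coord o) (C.adjoin_affineCoord_eq_top ho)
    (Cardinal.toNat_eq_one.1 hdim).le u hu
  refine ⟨c + 2, fun N hN => ?_⟩
  have h0 := hM 0
  rw [pow_zero, div_one] at h0
  have h1 := hN.trace_sq_mul_det h0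
  have hd := h0.det_ne_zero
  have hc' : (M 0).trace ^ 2 = algebraMap ℂ K (c + 2) * (M 0).det := by
    rw [map_add, hc, map_ofNat]
    simp only [u]
    field_simp
    ring
  apply mul_right_cancel₀ hd
  rw [h1, hc']
  ring

/-- On a fibre the flow at time `t` is given both by the evaluated matrix of `φ(t)` and by the
Riccati exponential. Comparing `tr²/det` gives `m = 4 cosh²(rt)` with `r²` the discriminant on that
fibre, so countably many discriminants occur. Were the discriminant nonconstant, each would occur
finitely often in the family, and `Z` would be countable. -/
theorem discriminant_eq_of_isFibreFlow [Finite ι] (hdim : C.dim = 1)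
    (he : ∀ a, a ≠ 0 → {z | e z a = 0}.Finite) (hε : 0 < ε)
    (hZ : ¬ Z.Countable) (hV : ∀ z ∈ Z, (V z).Infinite) (hw : ∀ z ∈ Z, ∀ v ∈ V z,
      IsFibreFlow ho X (fun t => φ (Multiplicative.ofAdd t)) (e z) v ε (w z v)) {a b c : K}
    (hX : X RatFunc.X = RatFunc.C a * RatFunc.X ^ 2 + 2 * RatFunc.C b * RatFunc.X + RatFunc.C c) :
    ∃ κ : ℂ, b ^ 2 - a * c = algebraMap ℂ K (κ ^ 2) := by
  have hφ := isOverBase_of_isFibreFlow he hε hZ hV hw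
  obtain ⟨s, hs, h⟩ := exists_common_denom (C := C) ho ![a, b, c]
  obtain ⟨a', ha⟩ := h 0
  obtain ⟨b', hb⟩ := h 1
  obtain ⟨c', hc⟩ := h 2
  simp only [Matrix.cons_val] at ha hb hc
  have hs' : (s : K) ≠ 0 := fun h0 => hs (Subtype.ext h0)
  have hmul : X RatFunc.X * C.toRatFunc o (Polynomial.C s) = C.toRatFunc o
      (Polynomial.C a' * Polynomial.X ^ 2 + 2 * Polynomial.C b' * Polynomial.X
        + Polynomial.C c') := by
    simp only [map_add, map_mul, map_pow, toRatFunc_C, toRatFunc_X, map_ofNat, ← ha, ← hb, ← hc,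
      hX]
    ring
  let t : ℂ := ((ε / 2 : ℝ) : ℂ)
  have ht0 : t ≠ 0 := Complex.ofReal_ne_zero.2 (half_pos hε).ne'
  have ht : t ∈ Metric.ball (0 : ℂ) ε := by
    rw [mem_ball_zero_iff, Complex.norm_real, Real.norm_eq_abs, abs_of_pos (half_pos hε)]
    exact half_lt_self hε
  obtain ⟨N, hN⟩ := exists_isHomography_affineRing ho (hφ t)
  have hNdet : (N.map ((↑) : C.affineRing o → K)).det = (N.det : K) := by
    simp [Matrix.det_fin_two]
  have hdet : N.det ≠ 0 := fun h0 => hN.det_ne_zero (by rw [hNdet, h0]; rfl)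
  obtain ⟨m, hm⟩ := exists_trace_sq_eq_of_isOverBase ho hdim hφ t
  have hm' : (N 0 0 + N 1 1) ^ 2 = algebraMap ℂ (C.affineRing o) m * N.det := by
    have := hm _ hN
    rw [hNdet] at this
    apply Subtype.ext
    simpa [Matrix.trace_fin_two] using this
  suffices ∃ d : ℂ, b' ^ 2 - a' * c' = algebraMap ℂ (C.affineRing o) d * s ^ 2 by
    obtain ⟨d, hd⟩ := this
    obtain ⟨κ, hκ⟩ := IsAlgClosed.exists_pow_nat_eq d (n := 2) (by norm_num)
    refine ⟨κ, ?_⟩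
    have hd' : (b' : K) ^ 2 - a' * c' = algebraMap ℂ K d * s ^ 2 := congrArg Subtype.val hd
    rw [hκ]
    apply mul_right_cancel₀ (pow_ne_zero 2 hs')
    rw [← hd', ← ha, ← hb, ← hc]
    ring
  by_contra! hcon
  apply hZ
  -- Exceptional `z`: a pole of the coefficients, a degenerate matrix, or a discriminant in the
  -- countable set. The rest of the proof places every `z ∈ Z` in one of these classes.
  refine ((he _ hs).countable.union ((he _ hdet).countable.union
    ((countable_setOf_cosh_sq_eq ht0 m).biUnion fun d _ =>
      (he _ (sub_ne_zero.2 (hcon d))).countable))).mono fun z hz => ?_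
  by_cases hzs : e z s = 0
  · exact Or.inl hzs
  by_cases hzd : e z N.det = 0
  · exact Or.inr (Or.inl hzd)
  refine Or.inr (Or.inr ?_)
  obtain ⟨r, hr⟩ := IsAlgClosed.exists_pow_nat_eq
    ((e z b' / e z s) ^ 2 - (e z a' / e z s) * (e z c' / e z s)) (n := 2) (by norm_num)
  simp only [Set.mem_iUnion]
  refine ⟨r ^ 2, ⟨r, rfl, ?_⟩, ?_⟩
  swap
  · change e z (_ - _) = 0
    rw [map_sub, map_sub, map_mul, map_mul, AlgHom.commutes, Algebra.algebraMap_self,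
      RingHom.id_apply, hr, map_pow, map_pow]
    field_simp
    ring
  have hagree : ∀ v ∈ V z,
      ((Complex.cosh (r * t) + e z b' / e z s * sinhDiv r t) * v + e z c' / e z s * sinhDiv r t)
          * (e z (N 1 0) * v + e z (N 1 1))
        = (e z (N 0 0) * v + e z (N 0 1)) * (-(e z a' / e z s * sinhDiv r t) * v
          + (Complex.cosh (r * t) - e z b' / e z s * sinhDiv r t)) := by
    intro v hv
    have hflow := hw z hz v hv
    have h1 := hflow.homography ht hN
    have h2 := riccati_eq_homography (a := e z a' / e z s) (b := e z b' / e z s)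
      (c := e z c' / e z s) (v := v) hr (w := w z v) (fun t ht => by
        obtain ⟨y, hy, hyP⟩ := hflow.hasDerivAt t ht
        have := hyP _ _ hmul
        simp only [map_add, map_mul, map_pow, evalAt_C, evalAt_X, map_ofNat] at this
        convert! hy using 1
        field_simp
        linear_combination -this) hflow.map_zero ht
    rw [← h1, ← h2]
    ring
  -- Two homographies agreeing at infinitely many `v` have proportional matrices; these are the
  -- coefficients of the cross-multiplied identity.
  obtain ⟨k2, k1, k0⟩ := coeff_eq_zero_of_infinite (hV z hz)
    (p := (Complex.cosh (r * t) + e z b' / e z s * sinhDiv r t) * e z (N 1 0)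
      - e z (N 0 0) * (-(e z a' / e z s * sinhDiv r t)))
    (q := (Complex.cosh (r * t) + e z b' / e z s * sinhDiv r t) * e z (N 1 1)
      + e z c' / e z s * sinhDiv r t * e z (N 1 0)
      - (e z (N 0 0) * (Complex.cosh (r * t) - e z b' / e z s * sinhDiv r t)
        + e z (N 0 1) * (-(e z a' / e z s * sinhDiv r t))))
    (r := e z c' / e z s * sinhDiv r t * e z (N 1 1)
      - e z (N 0 1) * (Complex.cosh (r * t) - e z b' / e z s * sinhDiv r t))
    (fun v hv => by linear_combination hagree v hv)
  have hone : (Complex.cosh (r * t) + e z b' / e z s * sinhDiv r t)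
      * (Complex.cosh (r * t) - e z b' / e z s * sinhDiv r t)
      - (e z c' / e z s * sinhDiv r t) * (-(e z a' / e z s * sinhDiv r t)) = 1 := by
    linear_combination cosh_sq_sub_sinhDiv_sq r t + sinhDiv r t ^ 2 * hr
  have htr := trace_sq_mul_det_eq (by rw [hone]; exact one_ne_zero) (sub_eq_zero.1 k2)
    (sub_eq_zero.1 k1) (sub_eq_zero.1 k0)
  rw [hone] at htr
  have hmz := congrArg (e z) hm'
  rw [Matrix.det_fin_two] at hzd hmz
  simp only [map_mul, map_pow, map_add, map_sub, AlgHom.commutes, Algebra.algebraMap_self,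
    RingHom.id_apply] at hmz hzd
  apply mul_right_cancel₀ hzd
  linear_combination htr + hmz

/-- Birationally integrable vertical vector fields are quadratic, with constant discriminant. -/
theorem IsBirationallyIntegrable.exists_quadratic [Finite ι] (hdim : C.dim = 1)
    (hX : IsTangentToFibration X) (hint : C.prodP1.IsBirationallyIntegrable X) :
    ∃ (a b c : K) (κ : ℂ),
      X = (RatFunc.C a * RatFunc.X ^ 2 + 2 * RatFunc.C b * RatFunc.X + RatFunc.C c) • ddy ∧
        b ^ 2 - a * c = algebraMap ℂ K (κ ^ 2) := by
  obtain ⟨o, ho⟩ := C.exists_coord_ne_zero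
  obtain ⟨e, he⟩ := C.exists_points ho hdim
  obtain ⟨φ, ε, hε, Z, hZ, V, hV, w, hw⟩ := hint.exists_isFibreFlow ho he hX
  obtain ⟨a, b, c, h⟩ := exists_quadratic_of_isFibreFlow he hε hZ hV hw
  obtain ⟨κ, hκ⟩ := discriminant_eq_of_isFibreFlow hdim he hε hZ hV hw h
  exact ⟨a, b, c, κ, by rw [← h]; exact hX.eq_smul, hκ⟩

end FlowFamily

end ProjVariety

/-! ### The explicit flow of a quadratic field with constant discriminant -/

/-- The exponential of `t` times the trace-free matrix with entries `b, c, -a, -b`, where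
`b² - a c = κ²`. -/
def flowMatrix {K : Type*} [Field K] [Algebra ℂ K] (a b c : K) (κ t : ℂ) :
    Matrix (Fin 2) (Fin 2) K :=
  !![algebraMap ℂ K (Complex.cosh (κ * t)) + b * algebraMap ℂ K (sinhDiv κ t),
      c * algebraMap ℂ K (sinhDiv κ t);
    -(a * algebraMap ℂ K (sinhDiv κ t)),
      algebraMap ℂ K (Complex.cosh (κ * t)) - b * algebraMap ℂ K (sinhDiv κ t)]

section FlowMatrix

variable {K : Type*} [Field K] [Algebra ℂ K] {a b c : K} {κ : ℂ}

theorem det_flowMatrix (hD : b ^ 2 - a * c = algebraMap ℂ K (κ ^ 2)) (t : ℂ) :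
    (flowMatrix a b c κ t).det = 1 := by
  have h := congrArg (algebraMap ℂ K) (cosh_sq_sub_sinhDiv_sq κ t)
  simp only [map_sub, map_pow, map_mul, map_one] at h hD
  simp only [flowMatrix, Matrix.det_fin_two_of]
  linear_combination h - algebraMap ℂ K (sinhDiv κ t) ^ 2 * hD

/-- The matrix is `cosh(κt) + sinhDiv κ t * A` with `A² = κ²`, so this is the addition law of the
hyperbolic functions. It is uniform in `κ`, including zero. -/
theorem flowMatrix_add (hD : b ^ 2 - a * c = algebraMap ℂ K (κ ^ 2)) (s t : ℂ) :
    flowMatrix a b c κ (s + t) = flowMatrix a b c κ s * flowMatrix a b c κ t := by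
  have h : algebraMap ℂ K κ ^ 2 = b ^ 2 - a * c := by rw [hD, map_pow]
  ext i j
  fin_cases i <;> fin_cases j <;>
    simp only [flowMatrix, cosh_mul_add, sinhDiv_add, map_add, map_mul, map_pow, h,
      Matrix.mul_apply, Fin.sum_univ_two, Matrix.of_apply, Matrix.cons_val', Matrix.cons_val_zero,
      Matrix.cons_val_one, Matrix.cons_val_fin_one, Fin.zero_eta, Fin.mk_one, Fin.isValue] <;>
    ring

/-- A matrix determines its homography, so automorphisms chosen separately for each time still form
a group morphism. The opposite multiplication in `Bir` matches the order in `IsHomography.trans`. -/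
theorem exists_hom_isHomography_flowMatrix (hD : b ^ 2 - a * c = algebraMap ℂ K (κ ^ 2)) :
    ∃ φ : Multiplicative ℂ →* Bir (RatFunc K),
      ∀ t, IsHomography (φ (Multiplicative.ofAdd t)).pullback (flowMatrix a b c κ t) := by
  choose σ hσ using fun t => exists_isHomography (M := flowMatrix a b c κ t)
    (by rw [det_flowMatrix hD]; exact one_ne_zero)
  refine ⟨MonoidHom.mk' (fun t => MulOpposite.op (σ t.toAdd)) fun s t => ?_, hσ⟩
  refine congrArg MulOpposite.op ((hσ (s.toAdd + t.toAdd)).eq ?_)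
  rw [flowMatrix_add hD]
  exact (hσ t.toAdd).trans (hσ s.toAdd)

end FlowMatrix

namespace ProjVariety

section ContinuousValue

variable {F : Type*} [Field F] [Algebra ℂ F] {ι : Type*} {V : ProjVariety F ι}

theorem IsRegularAt.continuousAt_value {p : V.Point} {h : F} (H : V.IsRegularAt p h) :
    ContinuousAt (V.value h) p := by
  obtain ⟨i, hi⟩ := p.rep_ne_zero
  obtain ⟨c, hc⟩ := H
  obtain ⟨f, g, rfl, hg, -⟩ := hc.exists_chart i hi
  have hchart := (isOpen_chart (V := V) i).mem_nhds hi
  have hcont : ∀ f : MvPolynomial ι ℂ, ContinuousAt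
      (fun q : V.Point => MvPolynomial.eval (fun j => q.rep j / q.rep i) f) p := fun f => by
    have h1 : ContinuousAt (fun q : V.Point => fun j => q.rep j / q.rep i) p :=
      continuousAt_pi.2 fun j => (continuousOn_ratio i j).continuousAt hchart
    exact (MvPolynomial.continuous_eval f).continuousAt.comp h1
  refine ((hcont f).div (hcont g) hg).congr ?_
  filter_upwards [hchart, (hcont g).eventually_ne hg] with q hq hgq
  exact (((HasValue.aeval (HasValue.coord_div hq) f).div
    (HasValue.aeval (HasValue.coord_div hq) g) hgq).value_eq).symm

end ContinuousValue

variable {K : Type*} [Field K] [Algebra ℂ K] {ι : Type*} {C : ProjVariety K ι} {o : ι}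

/-- The homomorphism of evaluation at a point of the chart `C_o × 𝔸¹`. -/
def pointEval {q : C.prodP1.Point} (hq : q.rep (o, 0) ≠ 0) : C.affineRing o →ₐ[ℂ] ℂ where
  toFun a := C.prodP1.value (RatFunc.C (a : K)) q
  map_one' := by simpa using HasValue.one.value_eq
  map_mul' a b := by
    simpa using ((isRegularAt_C hq a).hasValue.mul (isRegularAt_C hq b).hasValue).value_eq
  map_zero' := by simpa using HasValue.zero.value_eq
  map_add' a b := by
    simpa using ((isRegularAt_C hq a).hasValue.add (isRegularAt_C hq b).hasValue).value_eq
  commutes' z := by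
    change C.prodP1.value (RatFunc.C (algebraMap ℂ K z)) q = z
    rw [← algebraMap_ratFunc_eq]
    exact (HasValue.algebraMap z).value_eq

theorem hasValue_pointEval {q : C.prodP1.Point} (hq : q.rep (o, 0) ≠ 0) (a : C.affineRing o) :
    C.prodP1.HasValue q (RatFunc.C (a : K)) (pointEval hq a) := (isRegularAt_C hq a).hasValue

theorem pointEval_affineCoord {q : C.prodP1.Point} (hq : q.rep (o, 0) ≠ 0) (i : ι) :
    pointEval hq (C.affineCoord o i) = q.rep (i, 0) / q.rep (o, 0) :=
  (hasValue_C_affineCoord hq i).value_eq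

theorem prodP1_coord_div (ho : C.coord o ≠ 0) (ij : ι × Fin 2) :
    C.prodP1.coord ij / C.prodP1.coord (o, 0)
      = RatFunc.C (C.affineCoord o ij.1 : K) * ![1, RatFunc.X] ij.2 := by
  have ho' : (RatFunc.C (C.coord o) : RatFunc K) ≠ 0 := by simpa using ho
  obtain ⟨i, j⟩ := ij
  fin_cases j
  · simp [prodP1, affineCoord]
  · simp [prodP1, affineCoord]
    field_simp

/-- Every point of the chart is a pair `(e, v)`: evaluation on the functions of `C`, and the value
of `y`. -/
theorem point_pointEval (ho : C.coord o ≠ 0) {q : C.prodP1.Point} (hq : q.rep (o, 0) ≠ 0) :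
    C.point ho (pointEval hq) (C.prodP1.value RatFunc.X q) = q := by
  apply Subtype.ext
  rw [← Projectivization.mk_rep q.1]
  refine (Projectivization.mk_eq_mk_iff' ℂ _ _ _ _).2 ⟨(q.rep (o, 0))⁻¹, funext fun ij => ?_⟩
  have h1 := HasValue.coord_div hq ij
  rw [prodP1_coord_div ho] at h1
  have h2 : C.prodP1.HasValue q (RatFunc.C (C.affineCoord o ij.1 : K) * ![1, RatFunc.X] ij.2)
      (C.pointVec (pointEval hq) (C.prodP1.value RatFunc.X q) ij) := by
    refine (hasValue_pointEval hq _).mul ?_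
    obtain ⟨i, j⟩ := ij
    fin_cases j
    · exact HasValue.one
    · exact (hasValue_X ho hq).isRegularAt.hasValue
  rw [← h1.unique h2, div_eq_inv_mul]
  rfl

end ProjVariety

namespace ProjVariety

variable {K : Type*} [Field K] [Algebra ℂ K] {ι : Type*} {C : ProjVariety K ι} {o : ι}

theorem hasValue_point_C_of_mul_eq (ho : C.coord o ≠ 0) {e : C.affineRing o →ₐ[ℂ] ℂ} (w : ℂ)
    {k : K} {a s : C.affineRing o} (h : k * s = a) (hs : e s ≠ 0) :
    C.prodP1.HasValue (C.point ho e w) (RatFunc.C k) (e a / e s) := by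
  have hs' : (s : K) ≠ 0 := fun h0 => hs (by rw [show s = 0 from Subtype.ext h0, map_zero])
  rw [eq_div_of_mul_eq hs' h, map_div₀]
  exact (hasValue_point_C ho e w a).div (hasValue_point_C ho e w s) hs

/-- A non-empty Zariski open set on which a given non-zero function on the chart does not vanish. -/
theorem exists_isZariskiOpen_value_ne_zero [Finite ι] (ho : C.coord o ≠ 0) (hdim : C.dim = 1)
    {s : C.affineRing o} (hs : s ≠ 0) :
    ∃ W : Set C.prodP1.Point, C.prodP1.IsZariskiOpen W ∧ W.Nonempty ∧
      ∀ p ∈ W, p.rep (o, 0) ≠ 0 ∧ C.prodP1.value (RatFunc.C (s : K)) p ≠ 0 := by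
  obtain ⟨e, he⟩ := C.exists_points ho hdim
  obtain ⟨z, hz⟩ := (he s hs).exists_notMem
  -- One fraction `f / g` represents `s`; nonvanishing of `f`, `g` and the chart coordinate cuts out
  -- the open set.
  obtain ⟨d, f, g, hf, hg, hg0, hfg, hval⟩ := hasValue_point_C ho (e z) 0 s
  have hX := MvPolynomial.isHomogeneous_X ℂ ((o, 0) : ι × Fin 2)
  refine ⟨_, ⟨{f * g * MvPolynomial.X (o, 0)}, ?_, rfl⟩, ⟨C.point ho (e z) 0, _, rfl, ?_⟩, ?_⟩
  · rintro _ rfl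
    exact ⟨_, (hf.mul hg).mul hX⟩
  · have hf0 : MvPolynomial.eval (C.point ho (e z) 0).rep f ≠ 0 := fun h0 => hz (by
      change e z s = 0
      rw [hval, h0, zero_div])
    simpa using ⟨⟨hf0, hg0⟩, point_rep_ne_zero ho (e z) 0⟩
  · rintro p ⟨_, rfl, hp⟩
    simp only [map_mul, MvPolynomial.eval_X, ne_eq, mul_eq_zero, not_or] at hp
    refine ⟨hp.2, ?_⟩
    have : C.prodP1.HasValue p (RatFunc.C (s : K)) _ := ⟨d, f, g, hf, hg, hp.1.2, hfg, rfl⟩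
    rw [this.value_eq]
    exact div_ne_zero hp.1.1 hp.1.2

section Flow

variable (C) in
/-- The numerator of the explicit flow. -/
def flowNum (b c : K) (κ : ℂ) (z : ℂ × C.prodP1.Point) : ℂ :=
  (Complex.cosh (κ * z.1) + C.prodP1.value (RatFunc.C b) z.2 * sinhDiv κ z.1)
      * C.prodP1.value RatFunc.X z.2
    + C.prodP1.value (RatFunc.C c) z.2 * sinhDiv κ z.1

variable (C) in
/-- The denominator of the explicit flow. -/
def flowDenom (a b : K) (κ : ℂ) (z : ℂ × C.prodP1.Point) : ℂ :=
  -(C.prodP1.value (RatFunc.C a) z.2 * sinhDiv κ z.1) * C.prodP1.value RatFunc.X z.2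
    + (Complex.cosh (κ * z.1) - C.prodP1.value (RatFunc.C b) z.2 * sinhDiv κ z.1)

variable (C) in
/-- The points of the chart where the function `s` does not vanish. -/
def flowBase (s : C.affineRing o) : Set C.prodP1.Point :=
  {p | p.rep (o, 0) ≠ 0 ∧ C.prodP1.value (RatFunc.C (s : K)) p ≠ 0}

variable (C) in
/-- The points of `ℂ × (C × ℙ¹)` that remain in the chart during the flow. -/
def flowDomain (s : C.affineRing o) (a b : K) (κ : ℂ) : Set (ℂ × C.prodP1.Point) :=
  {z | z.2 ∈ C.flowBase s ∧ ∀ r ∈ Set.Icc (0 : ℝ) 1, C.flowDenom a b κ ((r : ℂ) * z.1, z.2) ≠ 0}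

open Classical in
/-- The explicit flow. -/
def flow (ho : C.coord o ≠ 0) (a b c : K) (κ : ℂ) (z : ℂ × C.prodP1.Point) : C.prodP1.Point :=
  if h : z.2.rep (o, 0) ≠ 0 then
    C.point ho (pointEval h) (C.flowNum b c κ z / C.flowDenom a b κ z)
  else z.2

variable {a b c : K} {κ : ℂ} {s a' b' c' : C.affineRing o}

theorem flow_eq (ho : C.coord o ≠ 0) {t : ℂ} {p : C.prodP1.Point} (h : p.rep (o, 0) ≠ 0) :
    flow ho a b c κ (t, p) = C.point ho (pointEval h)
      (C.flowNum b c κ (t, p) / C.flowDenom a b κ (t, p)) := dif_pos h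

theorem flowDenom_zero (p : C.prodP1.Point) : C.flowDenom a b κ (0, p) = 1 := by
  simp [flowDenom]

theorem flowNum_zero (p : C.prodP1.Point) :
    C.flowNum b c κ (0, p) = C.prodP1.value RatFunc.X p := by
  simp [flowNum]

theorem flow_zero (ho : C.coord o ≠ 0) {p : C.prodP1.Point} (h : p.rep (o, 0) ≠ 0) :
    flow ho a b c κ (0, p) = p := by
  rw [flow_eq ho h, flowDenom_zero, flowNum_zero, div_one, point_pointEval]

theorem isOpen_flowBase : IsOpen (C.flowBase s) := by
  have hcont : ContinuousOn (C.prodP1.value (RatFunc.C (s : K))) {p | p.rep (o, 0) ≠ 0} :=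
    fun p hp => (isRegularAt_C hp s).continuousAt_value.continuousWithinAt
  exact hcont.isOpen_inter_preimage (isOpen_chart (o, 0)) isOpen_ne

theorem hasValue_of_mem_flowBase (ho : C.coord o ≠ 0) {p : C.prodP1.Point}
    (hp : p ∈ C.flowBase s) {k : K} {x : C.affineRing o} (h : k * s = x) :
    C.prodP1.HasValue p (RatFunc.C k) (pointEval hp.1 x / pointEval hp.1 s) := by
  have := hasValue_point_C_of_mul_eq ho (e := pointEval hp.1) (C.prodP1.value RatFunc.X p) h hp.2
  rwa [point_pointEval ho hp.1] at this

theorem hasValue_point_of_mem_flowBase (ho : C.coord o ≠ 0) {p : C.prodP1.Point}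
    (hp : p ∈ C.flowBase s) {k : K} {x : C.affineRing o} (h : k * s = x) (w : ℂ) :
    C.prodP1.HasValue (C.point ho (pointEval hp.1) w) (RatFunc.C k)
      (C.prodP1.value (RatFunc.C k) p) := by
  rw [(hasValue_of_mem_flowBase ho hp h).value_eq]
  exact hasValue_point_C_of_mul_eq ho w h hp.2

/-- Numerator `N` and denominator `D` solve the linear system `N' = b N + c D`, `D' = -a N - b D`,
so `N / D` solves the Riccati equation. -/
theorem hasDerivAt_flowNum (p : C.prodP1.Point)
    (hκ : κ ^ 2 = C.prodP1.value (RatFunc.C b) p ^ 2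
      - C.prodP1.value (RatFunc.C a) p * C.prodP1.value (RatFunc.C c) p) (t : ℂ) :
    HasDerivAt (fun t => C.flowNum b c κ (t, p))
      (C.prodP1.value (RatFunc.C b) p * C.flowNum b c κ (t, p)
        + C.prodP1.value (RatFunc.C c) p * C.flowDenom a b κ (t, p)) t := by
  have h1 := hasDerivAt_sinhDiv κ t
  have h2 := hasDerivAt_cosh_mul κ t
  have h := ((h2.add (h1.const_mul (C.prodP1.value (RatFunc.C b) p))).mul_const
    (C.prodP1.value RatFunc.X p)).add (h1.const_mul (C.prodP1.value (RatFunc.C c) p))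
  convert! h using 1
  simp only [flowNum, flowDenom, hκ]
  ring

theorem hasDerivAt_flowDenom (p : C.prodP1.Point)
    (hκ : κ ^ 2 = C.prodP1.value (RatFunc.C b) p ^ 2
      - C.prodP1.value (RatFunc.C a) p * C.prodP1.value (RatFunc.C c) p) (t : ℂ) :
    HasDerivAt (fun t => C.flowDenom a b κ (t, p))
      (-(C.prodP1.value (RatFunc.C a) p * C.flowNum b c κ (t, p))
        - C.prodP1.value (RatFunc.C b) p * C.flowDenom a b κ (t, p)) t := by
  have h1 := hasDerivAt_sinhDiv κ t
  have h2 := hasDerivAt_cosh_mul κ t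
  have h := (((h1.const_mul (C.prodP1.value (RatFunc.C a) p)).neg).mul_const
    (C.prodP1.value RatFunc.X p)).add (h2.sub (h1.const_mul (C.prodP1.value (RatFunc.C b) p)))
  convert! h using 1
  simp only [flowNum, flowDenom, hκ]
  ring

theorem continuousAt_value_snd (ho : C.coord o ≠ 0) {z : ℂ × C.prodP1.Point}
    (hz : z.2 ∈ C.flowBase s) {k : K} {x : C.affineRing o} (h : k * s = x) :
    ContinuousAt (fun z : ℂ × C.prodP1.Point => C.prodP1.value (RatFunc.C k) z.2) z :=
  ContinuousAt.comp (g := C.prodP1.value (RatFunc.C k))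
    (hasValue_of_mem_flowBase ho hz h).isRegularAt.continuousAt_value continuousAt_snd

theorem continuousAt_value_X_snd (ho : C.coord o ≠ 0) {z : ℂ × C.prodP1.Point}
    (hz : z.2 ∈ C.flowBase s) :
    ContinuousAt (fun z : ℂ × C.prodP1.Point => C.prodP1.value RatFunc.X z.2) z :=
  ContinuousAt.comp (g := C.prodP1.value RatFunc.X)
    (hasValue_X ho hz.1).isRegularAt.continuousAt_value continuousAt_snd

theorem continuous_sinhDiv (κ : ℂ) : Continuous (sinhDiv κ) :=
  continuous_iff_continuousAt.2 fun t => (hasDerivAt_sinhDiv κ t).continuousAt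

theorem continuousAt_flowNum (ho : C.coord o ≠ 0) {z : ℂ × C.prodP1.Point}
    (hz : z.2 ∈ C.flowBase s) (hb : b * s = b') (hc : c * s = c') :
    ContinuousAt (C.flowNum b c κ) z := by
  have h1 := continuousAt_value_snd ho hz hb
  have h2 := continuousAt_value_snd ho hz hc
  have h3 := continuousAt_value_X_snd ho hz
  have h4 : ContinuousAt (fun z : ℂ × C.prodP1.Point => sinhDiv κ z.1) z :=
    ((continuous_sinhDiv κ).comp continuous_fst).continuousAt
  have h5 : ContinuousAt (fun z : ℂ × C.prodP1.Point => Complex.cosh (κ * z.1)) z := by fun_prop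
  exact ((h5.add (h1.mul h4)).mul h3).add (h2.mul h4)

theorem continuousAt_flowDenom (ho : C.coord o ≠ 0) {z : ℂ × C.prodP1.Point}
    (hz : z.2 ∈ C.flowBase s) (ha : a * s = a') (hb : b * s = b') :
    ContinuousAt (C.flowDenom a b κ) z := by
  have h1 := continuousAt_value_snd ho hz hb
  have h2 := continuousAt_value_snd ho hz ha
  have h3 := continuousAt_value_X_snd ho hz
  have h4 : ContinuousAt (fun z : ℂ × C.prodP1.Point => sinhDiv κ z.1) z :=
    ((continuous_sinhDiv κ).comp continuous_fst).continuousAt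
  have h5 : ContinuousAt (fun z : ℂ × C.prodP1.Point => Complex.cosh (κ * z.1)) z := by fun_prop
  exact (((h2.mul h4).neg).mul h3).add (h5.sub (h1.mul h4))

/-- The condition bears on a compact segment of times, so it persists for nearby points. -/
theorem isOpen_flowDomain (ho : C.coord o ≠ 0) (ha : a * s = a') (hb : b * s = b') :
    IsOpen (C.flowDomain s a b κ) := by
  rw [isOpen_iff_eventually]
  rintro z ⟨hz, hzr⟩
  have h1 : ∀ᶠ y in nhds z, y.2 ∈ C.flowBase s :=
    continuousAt_snd.eventually (isOpen_flowBase.mem_nhds hz)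
  have h2 : ∀ᶠ y in nhds z, ∀ r ∈ Set.Icc (0 : ℝ) 1,
      C.flowDenom a b κ ((r : ℂ) * y.1, y.2) ≠ 0 := by
    refine isCompact_Icc.eventually_forall_of_forall_eventually fun r hr => ?_
    have hcont : ContinuousAt (fun y : (ℂ × C.prodP1.Point) × ℝ =>
        C.flowDenom a b κ ((y.2 : ℂ) * y.1.1, y.1.2)) (z, r) :=
      ContinuousAt.comp (g := C.flowDenom a b κ)
        (f := fun y : (ℂ × C.prodP1.Point) × ℝ => ((y.2 : ℂ) * y.1.1, y.1.2))
        (continuousAt_flowDenom ho hz ha hb) (by fun_prop)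
    exact hcont.eventually_ne (hzr r hr)
  filter_upwards [h1, h2] with y hy hy' using ⟨hy, hy'⟩

theorem flowDenom_ne_zero {z : ℂ × C.prodP1.Point} (hz : z ∈ C.flowDomain s a b κ) :
    C.flowDenom a b κ z ≠ 0 := by
  simpa using hz.2 1 (by simp)

theorem zero_mem_flowDomain {p : C.prodP1.Point} (hp : p ∈ C.flowBase s) :
    ((0 : ℂ), p) ∈ C.flowDomain s a b κ :=
  ⟨hp, fun r _ => by simp [flowDenom_zero]⟩

/-- Asking that the denominator be nonzero on the whole segment from `0` to `t` makes each slice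
star-shaped. -/
theorem isPreconnected_flowDomain (p : C.prodP1.Point) :
    IsPreconnected {t : ℂ | (t, p) ∈ C.flowDomain s a b κ} := by
  by_cases hp : p ∈ C.flowBase s
  · have hstar : StarConvex ℝ (0 : ℂ) {t : ℂ | (t, p) ∈ C.flowDomain s a b κ} := by
      rw [starConvex_zero_iff]
      rintro t ⟨-, ht⟩ r hr0 hr1
      refine ⟨hp, fun r' hr' => ?_⟩
      have := ht (r' * r) ⟨mul_nonneg hr'.1 hr0, mul_le_one₀ hr'.2 hr0 hr1⟩
      simpa [mul_assoc] using this
    exact (hstar.isPathConnected (zero_mem_flowDomain hp)).isConnected.isPreconnected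
  · convert! isPreconnected_empty
    ext t
    simp [flowDomain, hp]

theorem continuousOn_flow (ho : C.coord o ≠ 0) (ha : a * s = a') (hb : b * s = b')
    (hc : c * s = c') : ContinuousOn (flow ho a b c κ) (C.flowDomain s a b κ) := by
  have hne : ∀ z ∈ C.flowDomain s a b κ, (fun ij : ι × Fin 2 =>
      z.2.rep (ij.1, 0) / z.2.rep (o, 0)
        * ![1, C.flowNum b c κ z / C.flowDenom a b κ z] ij.2) ≠ 0 := fun z hz h => by
    have := congrFun h (o, 0)
    simp [hz.1.1] at this
  refine continuousOn_point (f := fun z (ij : ι × Fin 2) => z.2.rep (ij.1, 0) / z.2.rep (o, 0)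
    * ![1, C.flowNum b c κ z / C.flowDenom a b κ z] ij.2) ?_ hne ?_
  · refine continuousOn_pi.2 fun ij z hz => ContinuousAt.continuousWithinAt ?_
    have h1 : ContinuousAt (fun z : ℂ × C.prodP1.Point => z.2.rep (ij.1, 0) / z.2.rep (o, 0)) z :=
      ContinuousAt.comp (g := fun q : C.prodP1.Point => q.rep (ij.1, 0) / q.rep (o, 0))
        ((continuousOn_ratio (V := C.prodP1) (o, 0) (ij.1, 0)).continuousAt
          ((isOpen_chart (o, 0)).mem_nhds hz.1.1)) continuousAt_snd
    refine h1.mul ?_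
    obtain ⟨i, j⟩ := ij
    fin_cases j
    · exact continuousAt_const
    · exact (continuousAt_flowNum ho hz.1 hb hc).div (continuousAt_flowDenom ho hz.1 ha hb)
        (flowDenom_ne_zero hz)
  · rintro ⟨t, p⟩ hz
    rw [flow_eq ho hz.1.1]
    refine (Projectivization.mk_eq_mk_iff' ℂ _ _ _ _).2 ⟨1, funext fun ij => ?_⟩
    simp only [pointVec, pointEval_affineCoord, one_smul]

/-- The explicit flow is an integral curve. -/
theorem isLocalFlow_flow (ho : C.coord o ≠ 0) (hD : b ^ 2 - a * c = algebraMap ℂ K (κ ^ 2))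
    (ha : a * s = a') (hb : b * s = b') (hc : c * s = c') :
    C.prodP1.IsLocalFlow
      ((RatFunc.C a * RatFunc.X ^ 2 + 2 * RatFunc.C b * RatFunc.X + RatFunc.C c) • ddy)
      (C.flowDomain s a b κ) (flow ho a b c κ) := by
  -- `X` kills the coordinates coming from `C` and multiplies the others by the quadratic over `y`;
  -- its coefficients keep along the fibre their values at `p`.
  have hval : ∀ {p : C.prodP1.Point} (hp : p ∈ C.flowBase s) (w : ℂ) (ij : ι × Fin 2),
      C.prodP1.HasValue (C.point ho (pointEval hp.1) w)
        (((RatFunc.C a * RatFunc.X ^ 2 + 2 * RatFunc.C b * RatFunc.X + RatFunc.C c) • ddy :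
          Derivation ℂ (RatFunc K) (RatFunc K)) (C.prodP1.coord ij / C.prodP1.coord (o, 0)))
        (pointEval hp.1 (C.affineCoord o ij.1) * ![0, C.prodP1.value (RatFunc.C a) p * w ^ 2
          + 2 * C.prodP1.value (RatFunc.C b) p * w + C.prodP1.value (RatFunc.C c) p] ij.2) := by
    intro p hp w ij
    have h2 : C.prodP1.HasValue (C.point ho (pointEval hp.1) w) (2 : RatFunc K) 2 := by
      have := HasValue.algebraMap (V := C.prodP1) (p := C.point ho (pointEval hp.1) w) 2
      rwa [map_ofNat] at this
    have hXv := hasValue_point_X ho (pointEval hp.1) w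
    have hf := (((hasValue_point_of_mem_flowBase ho hp ha w).mul (hXv.mul hXv)).add
      ((h2.mul (hasValue_point_of_mem_flowBase ho hp hb w)).mul hXv)).add
      (hasValue_point_of_mem_flowBase ho hp hc w)
    rw [← pow_two, ← pow_two] at hf
    rw [prodP1_coord_div ho]
    obtain ⟨i, j⟩ := ij
    have hi := hasValue_point_C ho (pointEval hp.1) w (C.affineCoord o i)
    fin_cases j
    · simpa using HasValue.zero
    · have := hf.mul hi
      simpa [mul_comm] using this
  have hκ : ∀ {p : C.prodP1.Point}, p ∈ C.flowBase s → κ ^ 2 = C.prodP1.value (RatFunc.C b) p ^ 2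
      - C.prodP1.value (RatFunc.C a) p * C.prodP1.value (RatFunc.C c) p := by
    intro p hp
    have hA := (hasValue_of_mem_flowBase ho hp ha).isRegularAt.hasValue
    have hB := (hasValue_of_mem_flowBase ho hp hb).isRegularAt.hasValue
    have hC := (hasValue_of_mem_flowBase ho hp hc).isRegularAt.hasValue
    have h := (hB.mul hB).sub (hA.mul hC)
    rw [← map_mul, ← map_mul, ← map_sub, ← pow_two, hD, ← algebraMap_ratFunc_eq] at h
    rw [(HasValue.algebraMap _).unique h, pow_two]
  refine ⟨isPreconnected_flowDomain, fun t p h => zero_mem_flowDomain h.1,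
    continuousOn_flow ho ha hb hc, fun p h => flow_zero ho h.1.1, ?_, ?_⟩
  · rintro ⟨t, p⟩ hz
    rw [flow_eq ho hz.1.1]
    exact isHolomorphicAt_of_coord (point_rep_ne_zero ho _ _) fun ij =>
      (hval hz.1 _ ij).isRegularAt
  · intro t p hz h hh
    have hp := hz.1
    refine hasDerivAt_value_of_coord (r := fun t => flow ho a b c κ (t, p)) (i := (o, 0))
      (Filter.Eventually.of_forall fun t => ?_) (fun ij => ?_) hh
    · rw [flow_eq ho hp.1]
      exact point_rep_ne_zero ho _ _
    · simp only [flow_eq ho hp.1, point_ratio]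
      refine ⟨_, hval hp _ ij, HasDerivAt.const_mul _ ?_⟩
      obtain ⟨i, j⟩ := ij
      fin_cases j
      · exact hasDerivAt_const t (1 : ℂ)
      · have hd := (hasDerivAt_flowNum p (hκ hp) t).div (hasDerivAt_flowDenom p (hκ hp) t)
          (flowDenom_ne_zero hz)
        have hne := flowDenom_ne_zero hz
        convert! hd using 1
        simp
        field_simp
        ring

/-- The pull-back fixes the coordinates of `C`, and sends `y` to a fraction whose value at `p` is
the quotient defining the flow. -/
theorem mapsTo_flow (ho : C.coord o ≠ 0) (ha : a * s = a') (hb : b * s = b') (hc : c * s = c')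
    {φ : Bir (RatFunc K)} {z : ℂ × C.prodP1.Point} (hφ : IsHomography φ.pullback
      (flowMatrix a b c κ z.1)) (hz : z ∈ C.flowDomain s a b κ) :
    C.prodP1.MapsTo φ z.2 (flow ho a b c κ z) := by
  obtain ⟨t, p⟩ := z
  have hp := hz.1
  rw [flow_eq ho hp.1]
  refine mapsTo_of_coord (i := (o, 0)) (point_rep_ne_zero ho _ _) fun ij => ?_
  rw [prodP1_coord_div ho, point_ratio, map_mul, hφ.map_C]
  refine (hasValue_pointEval hp.1 _).mul ?_
  obtain ⟨i, j⟩ := ij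
  fin_cases j
  · simpa using HasValue.one
  · have hA := (hasValue_of_mem_flowBase ho hp ha).isRegularAt.hasValue
    have hB := (hasValue_of_mem_flowBase ho hp hb).isRegularAt.hasValue
    have hC := (hasValue_of_mem_flowBase ho hp hc).isRegularAt.hasValue
    have hX := (hasValue_X ho hp.1).isRegularAt.hasValue
    have hconst : ∀ w : ℂ, C.prodP1.HasValue p (RatFunc.C (algebraMap ℂ K w)) w := fun w => by
      rw [← algebraMap_ratFunc_eq]; exact HasValue.algebraMap w
    have hS := hconst (sinhDiv κ t)
    have hch := hconst (Complex.cosh (κ * t))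
    have hnum := ((hch.add (hB.mul hS)).mul hX).add (hC.mul hS)
    have hden := ((hA.mul hS).neg.mul hX).add (hch.sub (hB.mul hS))
    have := hnum.div hden (flowDenom_ne_zero hz)
    change C.prodP1.HasValue p (φ.pullback RatFunc.X) _
    rw [hφ.map_X_eq]
    convert! this using 1
    simp [flowMatrix]

/-- Quadratic vertical vector fields with constant discriminant are birationally integrable. -/
theorem isBirationallyIntegrable_quadratic [Finite ι] (hdim : C.dim = 1)
    (hD : b ^ 2 - a * c = algebraMap ℂ K (κ ^ 2)) :
    C.prodP1.IsBirationallyIntegrable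
      ((RatFunc.C a * RatFunc.X ^ 2 + 2 * RatFunc.C b * RatFunc.X + RatFunc.C c) • ddy) := by
  obtain ⟨o, ho⟩ := C.exists_coord_ne_zero
  obtain ⟨s, hs, h⟩ := exists_common_denom (C := C) ho ![a, b, c]
  obtain ⟨a', ha⟩ := h 0
  obtain ⟨b', hb⟩ := h 1
  obtain ⟨c', hc⟩ := h 2
  simp only [Matrix.cons_val] at ha hb hc
  obtain ⟨φ, hφ⟩ := exists_hom_isHomography_flowMatrix hD
  obtain ⟨W, hW, hWne, hWs⟩ := exists_isZariskiOpen_value_ne_zero ho hdim hs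
  exact ⟨φ, C.flowDomain s a b κ, ⟨isOpen_flowDomain ho ha hb, W, hW, hWne,
    fun p hp => zero_mem_flowDomain (hWs p hp)⟩, flow ho a b c κ,
    isLocalFlow_flow ho hD ha hb hc, fun t p hz => mapsTo_flow ho ha hb hc (hφ t) hz⟩

end Flow

end ProjVariety

/-! ### Tangent spaces of cones and smoothness of `C × ℙ¹` -/

/-- First-order Taylor expansion, in dual numbers. -/
theorem MvPolynomial.aeval_inl_add_inr {ι : Type*} [Fintype ι] (z w : ι → ℂ)
    (f : MvPolynomial ι ℂ) :
    MvPolynomial.aeval (fun i => (TrivSqZeroExt.inl (z i) + TrivSqZeroExt.inr (w i) :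
        DualNumber ℂ)) f
      = TrivSqZeroExt.inl (MvPolynomial.eval z f)
        + TrivSqZeroExt.inr (∑ i, MvPolynomial.eval z (MvPolynomial.pderiv i f) * w i) := by
  classical
  induction f using MvPolynomial.induction_on with
  | C a => simp [TrivSqZeroExt.algebraMap_eq_inl]
  | add f g hf hg =>
    simp only [map_add, hf, hg, add_mul, Finset.sum_add_distrib, TrivSqZeroExt.inl_add,
      TrivSqZeroExt.inr_add]
    abel
  | mul_X f j hf =>
    have h : ∑ i, MvPolynomial.eval z (MvPolynomial.pderiv i (f * MvPolynomial.X j)) * w i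
        = MvPolynomial.eval z f * w j
          + z j * ∑ i, MvPolynomial.eval z (MvPolynomial.pderiv i f) * w i := by
      simp only [Derivation.leibniz, smul_eq_mul, map_add, map_mul, MvPolynomial.eval_X, add_mul,
        Finset.sum_add_distrib, Finset.mul_sum, mul_assoc]
      congr 1
      rw [Finset.sum_eq_single j]
      · simp
      · intro i _ hij
        simp [MvPolynomial.pderiv_X_of_ne hij.symm]
      · simp
    rw [map_mul, hf, MvPolynomial.aeval_X, h]
    ext
    · simp
    · simp
      ring

namespace ProjVariety

section Tangent

variable {F : Type*} [Field F] [Algebra ℂ F] {ι : Type*} (V : ProjVariety F ι)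

/-- The affine cone over the variety, without its vertex. -/
def cone : Set (ι → ℂ) :=
  {z | z ≠ 0 ∧ ∀ (d : ℕ) (f : MvPolynomial ι ℂ), V.IsEquation d f → MvPolynomial.eval z f = 0}

variable {V} in
theorem Point.rep_mem_cone (p : V.Point) : p.rep ∈ V.cone := ⟨p.1.rep_nonzero, p.2⟩

variable {V} in
theorem exists_point_rep_eq_smul {z : ι → ℂ} (hz : z ∈ V.cone) :
    ∃ (p : V.Point) (l : ℂ), l ≠ 0 ∧ p.rep = l • z := by
  obtain ⟨l, hl, h⟩ := rep_mk_smul hz.1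
  refine ⟨⟨Projectivization.mk ℂ z hz.1, fun d f hf => ?_⟩, l, hl, h⟩
  have := hf.1.aeval_const_mul l z
  rw [MvPolynomial.aeval_eq_eval, MvPolynomial.aeval_eq_eval] at this
  change MvPolynomial.eval (fun j => l * z j) f = l ^ d * MvPolynomial.eval z f at this
  rw [h]
  change MvPolynomial.eval (fun j => l * z j) f = 0
  rw [this, hz.2 d f hf, mul_zero]

variable [Fintype ι]

/-- The Zariski tangent space of the affine cone over the variety. -/
def coneTangent (z : ι → ℂ) : Submodule ℂ (ι → ℂ) where
  carrier := {w | ∀ (d : ℕ) (f : MvPolynomial ι ℂ), V.IsEquation d f →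
    ∑ i, MvPolynomial.eval z (MvPolynomial.pderiv i f) * w i = 0}
  add_mem' := fun h h' d f hf => by
    simp only [Pi.add_apply, mul_add, Finset.sum_add_distrib]
    rw [h d f hf, h' d f hf, add_zero]
  zero_mem' := fun d f hf => by simp
  smul_mem' := fun c w h d f hf => by
    simp only [Pi.smul_apply, smul_eq_mul, mul_left_comm _ c, ← Finset.mul_sum]
    rw [h d f hf, mul_zero]

variable {V}

/-- Tangent vectors are points of the cone over the dual numbers, so substitutions in equations
replace computations of partial derivatives. -/
theorem mem_coneTangent_iff {z w : ι → ℂ} (hz : z ∈ V.cone) : w ∈ V.coneTangent z ↔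
    ∀ (d : ℕ) (f : MvPolynomial ι ℂ), V.IsEquation d f → MvPolynomial.aeval (fun i =>
      (TrivSqZeroExt.inl (z i) + TrivSqZeroExt.inr (w i) : DualNumber ℂ)) f = 0 := by
  refine forall₃_congr fun d f hf => ?_
  rw [MvPolynomial.aeval_inl_add_inr, hz.2 d f hf, TrivSqZeroExt.inl_zero, zero_add,
    ← TrivSqZeroExt.inr_zero ℂ, TrivSqZeroExt.inr_injective.eq_iff]

theorem coneTangent_smul {l : ℂ} (hl : l ≠ 0) (z : ι → ℂ) :
    V.coneTangent (l • z) = V.coneTangent z := by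
  ext w
  refine forall₃_congr fun d f hf => ?_
  have : ∀ i, MvPolynomial.eval (l • z) (MvPolynomial.pderiv i f)
      = l ^ (d - 1) * MvPolynomial.eval z (MvPolynomial.pderiv i f) := fun i => by
    have := (hf.1.pderiv (i := i)).aeval_const_mul l z
    rw [MvPolynomial.aeval_eq_eval, MvPolynomial.aeval_eq_eval] at this
    exact this
  simp only [this, mul_assoc, ← Finset.mul_sum]
  simp [hl]

/-- The tangent space is the annihilator of the span of the gradients. -/
theorem finrank_span_add_finrank_coneTangent (z : ι → ℂ) :
    Module.finrank ℂ (Submodule.span ℂ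
      {w : ι → ℂ | ∃ (d : ℕ) (f : MvPolynomial ι ℂ), V.IsEquation d f ∧
        w = fun i => MvPolynomial.eval z (MvPolynomial.pderiv i f)})
      + Module.finrank ℂ (V.coneTangent z) = Fintype.card ι := by
  classical
  set G := Submodule.span ℂ
      {w : ι → ℂ | ∃ (d : ℕ) (f : MvPolynomial ι ℂ), V.IsEquation d f ∧
        w = fun i => MvPolynomial.eval z (MvPolynomial.pderiv i f)} with hG
  have h := Subspace.finrank_add_finrank_dualCoannihilator_eq
    (G.map (dotProductEquiv ℂ ι).toLinearMap)
  rw [LinearEquiv.finrank_map_eq, Module.finrank_fintype_fun_eq_card] at h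
  rw [← h]
  congr 1
  suffices hT : V.coneTangent z = (G.map (dotProductEquiv ℂ ι).toLinearMap).dualCoannihilator by
    rw [hT]
  rw [hG, Submodule.map_span]
  apply SetLike.coe_injective
  rw [Submodule.coe_dualCoannihilator_span]
  ext w
  simp only [Set.mem_ofPred_eq]
  constructor
  · rintro hw _ ⟨_, ⟨d, f, hf, rfl⟩, rfl⟩
    exact hw d f hf
  · exact fun hw d f hf => hw _ ⟨_, ⟨d, f, hf, rfl⟩, rfl⟩

/-- Smoothness in terms of tangent spaces. -/
theorem isSmooth_iff : V.IsSmooth ↔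
    ∀ z ∈ V.cone, Module.finrank ℂ (V.coneTangent z) = V.dim + 1 := by
  constructor
  · intro h z hz
    obtain ⟨p, l, hl, hp⟩ := exists_point_rep_eq_smul hz
    have h1 := h p
    have h2 := finrank_span_add_finrank_coneTangent (V := V) p.rep
    rw [hp, coneTangent_smul hl] at h2
    rw [hp] at h1
    omega
  · intro h p
    have h1 := h p.rep p.rep_mem_cone
    have h2 := finrank_span_add_finrank_coneTangent (V := V) p.rep
    omega

/-- Euler's relation: `f((1 + ε) z) = (1 + ε)^d f(z) = 0`. -/
theorem self_mem_coneTangent {z : ι → ℂ} (hz : z ∈ V.cone) : z ∈ V.coneTangent z := by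
  rw [mem_coneTangent_iff hz]
  intro d f hf
  have : (fun i => (TrivSqZeroExt.inl (z i) + TrivSqZeroExt.inr (z i) : DualNumber ℂ))
      = fun i => (1 + DualNumber.eps) * algebraMap ℂ (DualNumber ℂ) (z i) := by
    ext i <;> simp [TrivSqZeroExt.algebraMap_eq_inl]
  have h2 : MvPolynomial.aeval (fun i => algebraMap ℂ (DualNumber ℂ) (z i)) f = _ :=
    MvPolynomial.aeval_algebraMap_apply (DualNumber ℂ) z f
  rw [this, hf.1.aeval_const_mul, h2, MvPolynomial.aeval_eq_eval,
    hz.2 d f hf, map_zero, mul_zero]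

end Tangent

section Reindex

variable {F : Type*} [Field F] [Algebra ℂ F] {ι ι' : Type*}

/-- The same variety, with relabelled coordinates. -/
def reindex (V : ProjVariety F ι) (e : ι' ≃ ι) : ProjVariety F ι' where
  coord i := V.coord (e i)
  exists_coord_ne_zero := by
    obtain ⟨i, hi⟩ := V.exists_coord_ne_zero
    exact ⟨e.symm i, by simpa using hi⟩
  adjoin_eq_top := by
    rw [← V.adjoin_eq_top]
    congr 1
    exact (e.prodCongr e).surjective.range_comp
      fun ij : ι × ι => V.coord ij.1 / V.coord ij.2

variable {V : ProjVariety F ι} {e : ι' ≃ ι}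

theorem isEquation_reindex_iff {d : ℕ} {f : MvPolynomial ι' ℂ} :
    (V.reindex e).IsEquation d f ↔ V.IsEquation d (MvPolynomial.rename e f) := by
  unfold IsEquation
  rw [MvPolynomial.IsHomogeneous.rename_isHomogeneous_iff e.injective, MvPolynomial.aeval_rename]
  rfl

theorem isEquation_rename_symm {d : ℕ} {f : MvPolynomial ι ℂ} (hf : V.IsEquation d f) :
    (V.reindex e).IsEquation d (MvPolynomial.rename e.symm f) := by
  rw [isEquation_reindex_iff, MvPolynomial.rename_rename]
  simpa using hf

theorem comp_symm_mem_cone {z : ι' → ℂ} (hz : z ∈ (V.reindex e).cone) : z ∘ e.symm ∈ V.cone := by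
  refine ⟨fun h => hz.1 (funext fun i => ?_), fun d f hf => ?_⟩
  · simpa using congrFun h (e i)
  · have := hz.2 d _ (isEquation_rename_symm hf)
    rwa [MvPolynomial.eval_rename] at this

variable [Fintype ι] [Fintype ι']

theorem IsSmooth.reindex (h : V.IsSmooth) (e : ι' ≃ ι) : (V.reindex e).IsSmooth := by
  rw [isSmooth_iff] at h ⊢
  intro z hz
  have hz' := comp_symm_mem_cone hz
  have : (V.coneTangent (z ∘ e.symm)).map (LinearEquiv.funCongrLeft ℂ ℂ e).toLinearMap
      = (V.reindex e).coneTangent z := by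
    ext w
    constructor
    · rintro ⟨w, hw, rfl⟩
      rw [SetLike.mem_coe, mem_coneTangent_iff hz'] at hw
      rw [mem_coneTangent_iff hz]
      intro d f hf
      have := hw d _ (isEquation_reindex_iff.1 hf)
      rw [MvPolynomial.aeval_rename] at this
      simpa [Function.comp_def, LinearMap.funLeft] using this
    · intro hw
      refine ⟨w ∘ e.symm, ?_, by ext; simp [LinearMap.funLeft]⟩
      rw [mem_coneTangent_iff hz] at hw
      rw [SetLike.mem_coe, mem_coneTangent_iff hz']
      intro d f hf
      have := hw d _ (isEquation_rename_symm hf)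
      rw [MvPolynomial.aeval_rename] at this
      exact this
  rw [← this, LinearEquiv.finrank_map_eq, h _ hz']
  rfl

end Reindex

end ProjVariety

namespace ProjVariety

variable {K : Type*} [Field K] [Algebra ℂ K] {ι : Type*} {C : ProjVariety K ι}

theorem dim_prodP1 (hdim : C.dim = 1) : C.prodP1.dim = 2 := by
  have h1 : Algebra.trdeg ℂ K = 1 := Cardinal.toNat_eq_one.1 hdim
  have h2 := trdeg_add_eq ℂ K (A := RatFunc K)
  have h3 := trdeg_add_eq K (Polynomial K) (A := RatFunc K)
  have : Algebra.IsAlgebraic (Polynomial K) (RatFunc K) :=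
    IsLocalization.isAlgebraic _ (nonZeroDivisors (Polynomial K))
  rw [Polynomial.trdeg_of_isDomain, trdeg_eq_zero (R := Polynomial K), add_zero] at h3
  rw [h1, ← h3, one_add_one_eq_two] at h2
  rw [dim, ← h2, Cardinal.toNat_ofNat]

theorem isEquation_minor (i i' : ι) (j j' : Fin 2) : C.prodP1.IsEquation 2
    (MvPolynomial.X (i, j) * MvPolynomial.X (i', j')
      - MvPolynomial.X (i, j') * MvPolynomial.X (i', j)) := by
  refine ⟨((MvPolynomial.isHomogeneous_X ℂ _).mul (MvPolynomial.isHomogeneous_X ℂ _)).sub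
    ((MvPolynomial.isHomogeneous_X ℂ _).mul (MvPolynomial.isHomogeneous_X ℂ _)), ?_⟩
  simp only [map_sub, map_mul, MvPolynomial.aeval_X, prodP1]
  ring

theorem IsEquation.column {d : ℕ} {f : MvPolynomial ι ℂ} (hf : C.IsEquation d f) (j : Fin 2) :
    C.prodP1.IsEquation d (MvPolynomial.rename (fun i => (i, j)) f) := by
  refine ⟨hf.1.rename_isHomogeneous, ?_⟩
  rw [MvPolynomial.aeval_rename]
  have h1 : C.prodP1.coord ∘ (fun i => (i, j))
      = fun i => ![1, RatFunc.X] j * algebraMap K (RatFunc K) (C.coord i) :=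
    funext fun i => mul_comm _ _
  have h2 : MvPolynomial.aeval (fun i => algebraMap K (RatFunc K) (C.coord i)) f = _ :=
    MvPolynomial.aeval_algebraMap_apply (RatFunc K) C.coord f
  rw [h1, hf.1.aeval_const_mul, h2, hf.2, map_zero, mul_zero]

/-- The equation holds for `v = (1, y)` with `y` generic, hence for all `v` with `v 0 ≠ 0` by
specialising and rescaling. Multiplying by the first variable gives a polynomial vanishing on all of
`K²`; as `K` is infinite, the case `v 0 = 0` follows. -/
theorem IsEquation.aeval_mul_eq_zero {d : ℕ} {f : MvPolynomial (ι × Fin 2) ℂ}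
    (hf : C.prodP1.IsEquation d f) (v : Fin 2 → K) :
    MvPolynomial.aeval (fun ij : ι × Fin 2 => C.coord ij.1 * v ij.2) f = 0 := by
  have : Infinite K := Infinite.of_injective _ (algebraMap ℂ K).injective
  have h1 : MvPolynomial.aeval (fun ij : ι × Fin 2 =>
      Polynomial.C (C.coord ij.1) * ![1, Polynomial.X] ij.2) f = 0 := by
    apply RatFunc.algebraMap_injective K
    rw [map_zero, ← hf.2]
    have := MvPolynomial.comp_aeval_apply (fun ij : ι × Fin 2 =>
      Polynomial.C (C.coord ij.1) * ![1, Polynomial.X] ij.2)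
      (IsScalarTower.toAlgHom ℂ (Polynomial K) (RatFunc K)) f
    rw [IsScalarTower.coe_toAlgHom'] at this
    rw [this]
    congr 2
    ext ⟨i, j⟩
    fin_cases j <;> simp [prodP1]
  have h2 : ∀ v : Fin 2 → K, v 0 ≠ 0 →
      MvPolynomial.aeval (fun ij : ι × Fin 2 => C.coord ij.1 * v ij.2) f = 0 := fun v hv => by
    have h3 := congrArg (Polynomial.aeval (R := K) (v 1 / v 0)) h1
    have h4 := MvPolynomial.comp_aeval_apply (fun ij : ι × Fin 2 =>
      Polynomial.C (C.coord ij.1) * ![1, Polynomial.X] ij.2)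
      ((Polynomial.aeval (R := K) (v 1 / v 0)).restrictScalars ℂ) f
    rw [AlgHom.restrictScalars_apply, h3, map_zero] at h4
    have h5 := hf.1.aeval_const_mul (v 0) (fun ij : ι × Fin 2 =>
      (Polynomial.aeval (R := K) (v 1 / v 0)).restrictScalars ℂ
        (Polynomial.C (C.coord ij.1) * ![1, Polynomial.X] ij.2))
    rw [← h4, mul_zero] at h5
    rw [← h5]
    congr 2
    ext ⟨i, j⟩
    fin_cases j <;> simp <;> field_simp
  have h3 : MvPolynomial.X 0 * MvPolynomial.aeval (fun ij : ι × Fin 2 =>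
      (MvPolynomial.C (C.coord ij.1) * MvPolynomial.X ij.2 : MvPolynomial (Fin 2) K)) f = 0 := by
    refine MvPolynomial.funext fun v => ?_
    have h4 := MvPolynomial.comp_aeval_apply (fun ij : ι × Fin 2 =>
      (MvPolynomial.C (C.coord ij.1) * MvPolynomial.X ij.2 : MvPolynomial (Fin 2) K))
      ((MvPolynomial.aeval (R := K) v).restrictScalars ℂ) f
    rw [AlgHom.restrictScalars_apply, MvPolynomial.aeval_eq_eval] at h4
    rw [map_mul, map_zero, MvPolynomial.eval_X]
    by_cases hv : v 0 = 0
    · rw [hv, zero_mul]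
    · refine mul_eq_zero_of_right _ (Eq.trans h4 ?_)
      rw [← h2 v hv]
      congr 2
      ext ij
      simp
  have h4 := (mul_eq_zero.1 h3).resolve_left (MvPolynomial.X_ne_zero 0)
  have h5 := MvPolynomial.comp_aeval_apply (fun ij : ι × Fin 2 =>
      (MvPolynomial.C (C.coord ij.1) * MvPolynomial.X ij.2 : MvPolynomial (Fin 2) K))
      ((MvPolynomial.aeval (R := K) v).restrictScalars ℂ) f
  rw [h4, map_zero] at h5
  rw [h5]
  congr 2
  ext ij
  simp

/-- The restriction of a homogeneous polynomial to `C × {v}`. -/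
def specialize (v : Fin 2 → ℂ) (f : MvPolynomial (ι × Fin 2) ℂ) : MvPolynomial ι ℂ :=
  MvPolynomial.aeval (fun ij : ι × Fin 2 => MvPolynomial.C (v ij.2) * MvPolynomial.X ij.1) f

theorem aeval_specialize {R : Type*} [CommRing R] [Algebra ℂ R] (x : ι → R) (v : Fin 2 → ℂ)
    (f : MvPolynomial (ι × Fin 2) ℂ) : MvPolynomial.aeval x (specialize v f)
      = MvPolynomial.aeval (fun ij : ι × Fin 2 => algebraMap ℂ R (v ij.2) * x ij.1) f := by
  rw [specialize, MvPolynomial.comp_aeval_apply]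
  simp

theorem IsEquation.specialize {d : ℕ} {f : MvPolynomial (ι × Fin 2) ℂ}
    (hf : C.prodP1.IsEquation d f) (v : Fin 2 → ℂ) : C.IsEquation d (specialize v f) := by
  constructor
  · have := hf.1.aeval (fun ij : ι × Fin 2 =>
      (MvPolynomial.C (v ij.2) * MvPolynomial.X ij.1 : MvPolynomial ι ℂ)) (n := 1) fun ij => by
        simpa using (MvPolynomial.isHomogeneous_C ι (v ij.2)).mul
          (MvPolynomial.isHomogeneous_X ℂ ij.1)
    rwa [one_mul] at this
  · rw [aeval_specialize, ← hf.aeval_mul_eq_zero fun j => algebraMap ℂ K (v j)]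
    simp only [mul_comm]

/-- The Segre minors force the array of coordinates to have rank one: `x` is a normalised column and
`v` a row through a nonzero entry. -/
theorem exists_eq_mul_of_mem_cone {z : ι × Fin 2 → ℂ} (hz : z ∈ C.prodP1.cone) :
    ∃ x ∈ C.cone, ∃ (v : Fin 2 → ℂ) (i₀ : ι) (j₀ : Fin 2), x i₀ = 1 ∧ v j₀ ≠ 0 ∧
      z = fun ij => x ij.1 * v ij.2 := by
  obtain ⟨⟨i₀, j₀⟩, h0⟩ := Function.ne_iff.1 hz.1
  rw [Pi.zero_apply] at h0
  have hz' : z = fun ij : ι × Fin 2 => (z (ij.1, j₀) / z (i₀, j₀)) * z (i₀, ij.2) := by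
    ext ⟨i, j⟩
    have := hz.2 2 _ (isEquation_minor i i₀ j j₀)
    simp only [map_sub, map_mul, MvPolynomial.eval_X] at this
    field_simp
    linear_combination this
  refine ⟨fun i => z (i, j₀) / z (i₀, j₀), ⟨fun h => ?_, fun d f hf => ?_⟩, fun j => z (i₀, j), i₀,
    j₀, div_self h0, h0, hz'⟩
  · have := congrFun h i₀
    simp [h0] at this
  · have h1 := hz.2 d _ (hf.column j₀)
    have h2 := hf.1.aeval_const_mul (z (i₀, j₀))⁻¹ (fun i => z (i, j₀))
    rw [MvPolynomial.eval_rename] at h1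
    simp only [MvPolynomial.aeval_eq_eval, ← div_eq_inv_mul] at h2
    refine Eq.trans h2 ?_
    rw [show (fun i => z (i, j₀)) = z ∘ fun i => (i, j₀) from rfl, h1, mul_zero]

variable [Fintype ι] {x : ι → ℂ} {v : Fin 2 → ℂ}

theorem mul_mem_coneTangent_left {τ : ι → ℂ} (hx : x ∈ C.cone)
    (hz : (fun ij : ι × Fin 2 => x ij.1 * v ij.2) ∈ C.prodP1.cone) (hτ : τ ∈ C.coneTangent x) :
    (fun ij : ι × Fin 2 => τ ij.1 * v ij.2)
      ∈ C.prodP1.coneTangent fun ij : ι × Fin 2 => x ij.1 * v ij.2 := by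
  rw [mem_coneTangent_iff hx] at hτ
  rw [mem_coneTangent_iff hz]
  intro d f hf
  rw [← hτ d _ (hf.specialize v), aeval_specialize]
  congr 2
  ext ij <;> simp [TrivSqZeroExt.algebraMap_eq_inl, mul_comm]

/-- For fixed `x` the equation vanishes identically as a polynomial in `v`, so it also vanishes at
dual-number values of `v`. -/
theorem mul_mem_coneTangent_right (u : Fin 2 → ℂ) (hx : x ∈ C.cone)
    (hz : (fun ij : ι × Fin 2 => x ij.1 * v ij.2) ∈ C.prodP1.cone) :
    (fun ij : ι × Fin 2 => x ij.1 * u ij.2)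
      ∈ C.prodP1.coneTangent fun ij : ι × Fin 2 => x ij.1 * v ij.2 := by
  rw [mem_coneTangent_iff hz]
  intro d f hf
  have h0 : MvPolynomial.aeval (fun ij : ι × Fin 2 =>
      (MvPolynomial.C (x ij.1) * MvPolynomial.X ij.2 : MvPolynomial (Fin 2) ℂ)) f = 0 := by
    refine MvPolynomial.funext fun v => ?_
    rw [map_zero, ← hx.2 d _ (hf.specialize v)]
    have h1 := MvPolynomial.comp_aeval_apply (fun ij : ι × Fin 2 =>
      (MvPolynomial.C (x ij.1) * MvPolynomial.X ij.2 : MvPolynomial (Fin 2) ℂ))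
      (MvPolynomial.aeval (R := ℂ) v) f
    have h2 := aeval_specialize x v f
    rw [MvPolynomial.aeval_eq_eval] at h1 h2
    refine Eq.trans h1 (Eq.trans ?_ h2.symm)
    congr 2
    ext ij
    simp [mul_comm]
  have h1 := MvPolynomial.comp_aeval_apply (fun ij : ι × Fin 2 =>
      (MvPolynomial.C (x ij.1) * MvPolynomial.X ij.2 : MvPolynomial (Fin 2) ℂ))
      (MvPolynomial.aeval (R := ℂ) fun j =>
        (TrivSqZeroExt.inl (v j) + TrivSqZeroExt.inr (u j) : DualNumber ℂ)) f
  rw [h0, map_zero] at h1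
  rw [h1]
  congr 2
  ext ij <;> simp [TrivSqZeroExt.algebraMap_eq_inl]

/-- Modulo `ε²` the minors split `w` into a variation of `x` and one of `v`. Column `j₀` of the
deformed point is `x + ε τ` times the unit `v j₀ + ε w(i₀, j₀)`, so homogeneity makes `τ` tangent to
the cone of `C`. -/
theorem exists_of_mem_coneTangent {i₀ : ι} {j₀ : Fin 2} (hx : x ∈ C.cone) (hx0 : x i₀ = 1)
    (hv : v j₀ ≠ 0) (hz : (fun ij : ι × Fin 2 => x ij.1 * v ij.2) ∈ C.prodP1.cone)
    {w : ι × Fin 2 → ℂ}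
    (hw : w ∈ C.prodP1.coneTangent fun ij : ι × Fin 2 => x ij.1 * v ij.2) :
    ∃ τ ∈ C.coneTangent x, τ i₀ = 0 ∧
      w = (fun ij : ι × Fin 2 => τ ij.1 * v ij.2) + fun ij => x ij.1 * w (i₀, ij.2) := by
  rw [mem_coneTangent_iff hz] at hw
  let τ : ι → ℂ := fun i => (w (i, j₀) - x i * w (i₀, j₀)) / v j₀
  refine ⟨τ, ?_, by simp [τ, hx0], ?_⟩
  · rw [mem_coneTangent_iff hx]
    intro d f hf
    have h1 := hw d _ (hf.column j₀)
    rw [MvPolynomial.aeval_rename] at h1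
    have h2 := hf.1.aeval_const_mul
      (TrivSqZeroExt.inl (v j₀) + TrivSqZeroExt.inr (w (i₀, j₀)) : DualNumber ℂ)
      (fun i => TrivSqZeroExt.inl (x i) + TrivSqZeroExt.inr (τ i))
    have h3 : (TrivSqZeroExt.inl (v j₀) + TrivSqZeroExt.inr (w (i₀, j₀)) : DualNumber ℂ) ^ d
        * MvPolynomial.aeval
          (fun i => (TrivSqZeroExt.inl (x i) + TrivSqZeroExt.inr (τ i) : DualNumber ℂ)) f = 0 := by
      rw [← h2, ← h1]
      congr 2
      ext i
      · simp [mul_comm]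
      · simp [τ]
        field_simp
        ring
    have hu : IsUnit (TrivSqZeroExt.inl (v j₀) + TrivSqZeroExt.inr (w (i₀, j₀)) : DualNumber ℂ) := by
      rw [TrivSqZeroExt.isUnit_iff_isUnit_fst]
      simpa using hv
    exact (hu.pow d).mul_right_eq_zero.1 h3
  · ext ⟨i, j⟩
    have := congrArg TrivSqZeroExt.snd (hw 2 _ (isEquation_minor i i₀ j j₀))
    simp [hx0] at this
    simp [τ]
    field_simp
    linear_combination this

/-- The radial direction `x` is tangent and has `i₀`-th coordinate one, so it is a complement. -/
theorem finrank_coneTangent_inf_ker_proj_add_one {i₀ : ι} (hx : x ∈ C.cone) (hx0 : x i₀ = 1) :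
    Module.finrank ℂ (C.coneTangent x ⊓ LinearMap.ker (LinearMap.proj i₀) : Submodule ℂ (ι → ℂ)) + 1
      = Module.finrank ℂ (C.coneTangent x) := by
  have hsup : (C.coneTangent x ⊓ LinearMap.ker (LinearMap.proj i₀)) ⊔ Submodule.span ℂ {x}
      = C.coneTangent x := by
    apply le_antisymm
    · refine sup_le inf_le_left ?_
      rw [Submodule.span_singleton_le_iff_mem]
      exact self_mem_coneTangent hx
    · intro τ hτ
      refine Submodule.mem_sup.2 ⟨τ - τ i₀ • x, ⟨?_, ?_⟩, τ i₀ • x,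
        Submodule.smul_mem _ _ (Submodule.mem_span_singleton_self x), sub_add_cancel _ _⟩
      · exact sub_mem hτ (Submodule.smul_mem _ _ (self_mem_coneTangent hx))
      · simp [hx0]
  have hinf : (C.coneTangent x ⊓ LinearMap.ker (LinearMap.proj i₀)) ⊓ Submodule.span ℂ {x}
      = ⊥ := by
    rw [eq_bot_iff]
    rintro τ ⟨⟨-, h0⟩, h1⟩
    obtain ⟨c, rfl⟩ := Submodule.mem_span_singleton.1 h1
    have hc : c = 0 := by simpa [hx0] using h0
    simp [hc]
  have h := Submodule.finrank_sup_add_finrank_inf_eq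
    (C.coneTangent x ⊓ LinearMap.ker (LinearMap.proj i₀)) (Submodule.span ℂ {x})
  rw [hsup, hinf, finrank_bot, finrank_span_singleton hx.1, add_zero] at h
  exact h.symm

/-- The linear map `(τ, u) ↦ τ ⊗ v + x ⊗ u`. -/
def tensorAdd (x : ι → ℂ) (v : Fin 2 → ℂ) (T : Submodule ℂ (ι → ℂ)) :
    T × (Fin 2 → ℂ) →ₗ[ℂ] (ι × Fin 2 → ℂ) where
  toFun y ij := y.1.1 ij.1 * v ij.2 + x ij.1 * y.2 ij.2
  map_add' y y' := by
    ext ij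
    simp
    ring
  map_smul' c y := by
    ext ij
    simp
    ring

/-- The product of a smooth curve with the projective line is smooth. -/
theorem IsSmooth.prodP1 (h : C.IsSmooth) (hdim : C.dim = 1) : C.prodP1.IsSmooth := by
  rw [isSmooth_iff] at h ⊢
  intro z hz
  obtain ⟨x, hx, v, i₀, j₀, hx0, hv, rfl⟩ := exists_eq_mul_of_mem_cone hz
  have hT := finrank_coneTangent_inf_ker_proj_add_one hx hx0
  rw [h x hx, hdim] at hT
  -- Imposing `τ i₀ = 0` removes the overlap `x ⊗ v` of the two kinds of variation. The tangent
  -- space then has dimension `1 + 2`, that is, `dim + 1` for a surface.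
  set T := C.coneTangent x ⊓ LinearMap.ker (LinearMap.proj i₀) with hTdef
  have hrange : LinearMap.range (tensorAdd x v T)
      = C.prodP1.coneTangent fun ij : ι × Fin 2 => x ij.1 * v ij.2 := by
    ext w
    constructor
    · rintro ⟨⟨⟨τ, hτ⟩, u⟩, rfl⟩
      exact add_mem (mul_mem_coneTangent_left hx hz hτ.1) (mul_mem_coneTangent_right u hx hz)
    · intro hw
      obtain ⟨τ, hτ, hτ0, hw'⟩ := exists_of_mem_coneTangent hx hx0 hv hz hw
      exact ⟨(⟨τ, hτ, hτ0⟩, fun j => w (i₀, j)), hw'.symm⟩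
  have hker : LinearMap.ker (tensorAdd x v T) = ⊥ := by
    rw [eq_bot_iff]
    rintro ⟨⟨τ, hτ⟩, u⟩ hy
    have hτ0 : τ i₀ = 0 := hτ.2
    have hy' : ∀ i j, τ i * v j + x i * u j = 0 := fun i j => congrFun hy (i, j)
    have hu : u = 0 := funext fun j => by simpa [hτ0, hx0] using hy' i₀ j
    have hτ1 : τ = 0 := funext fun i => by simpa [hu, hv] using hy' i j₀
    subst hu hτ1
    rfl
  have hdims := LinearMap.finrank_range_add_finrank_ker (tensorAdd x v T)
  rw [hrange, hker, finrank_bot, Module.finrank_prod, Module.finrank_fintype_fun_eq_card,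
    Fintype.card_fin] at hdims
  rw [dim_prodP1 hdim]
  omega

end ProjVariety

/-! ### Holomorphy of the normal forms and regularizability -/

namespace ProjVariety

variable {K : Type*} [Field K] [Algebra ℂ K] {ι ι' : Type*} {C : ProjVariety K ι}

/-- Affine vertical vector fields with constant coefficients are holomorphic on `C × ℙ¹`. -/
theorem isHolomorphic_reindex_prodP1 (e : ι' ≃ ι × Fin 2) (α β : ℂ) :
    (C.prodP1.reindex e).IsHolomorphic
      ((algebraMap ℂ (RatFunc K) α + algebraMap ℂ (RatFunc K) β * RatFunc.X) • ddy) := by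
  intro p
  obtain ⟨k, hk⟩ := p.rep_ne_zero
  refine isHolomorphicAt_of_coord hk fun l => ?_
  have hreg : ∀ l, (C.prodP1.reindex e).IsRegularAt p
      (C.prodP1.coord (e l) / C.prodP1.coord (e k)) := fun l =>
    (HasValue.coord_div (V := C.prodP1.reindex e) hk l).isRegularAt
  have hreg' : ∀ ij, (C.prodP1.reindex e).IsRegularAt p
      (C.prodP1.coord ij / C.prodP1.coord (e k)) := fun ij => by
    simpa using hreg (e.symm ij)
  have hconst : ∀ z : ℂ, (C.prodP1.reindex e).IsRegularAt p (algebraMap ℂ (RatFunc K) z) :=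
    fun z => (HasValue.algebraMap z).isRegularAt
  have hk0 : C.prodP1.coord (e k) ≠ 0 := coord_ne_zero (V := C.prodP1.reindex e) hk
  change (C.prodP1.reindex e).IsRegularAt p
    ((algebraMap ℂ (RatFunc K) α + algebraMap ℂ (RatFunc K) β * RatFunc.X)
      * ddy (C.prodP1.coord (e l) / C.prodP1.coord (e k)))
  generalize e l = ij at *
  generalize e k = ij₀ at *
  obtain ⟨i, j⟩ := ij
  obtain ⟨i₀, j₀⟩ := ij₀
  have hX : (RatFunc.X : RatFunc K) ≠ 0 := RatFunc.X_ne_zero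
  have h0 : (RatFunc.C (C.coord i₀) : RatFunc K) ≠ 0 := left_ne_zero_of_mul hk0
  have hY : ddy (RatFunc.X : RatFunc K)⁻¹ = -(RatFunc.X⁻¹ * RatFunc.X⁻¹) := by
    rw [Derivation.leibniz_inv, ddy_X, smul_eq_mul, mul_one, pow_two]
  have hc : ∀ g : RatFunc K, ddy (RatFunc.C (C.coord i / C.coord i₀) * g)
      = RatFunc.C (C.coord i / C.coord i₀) * ddy g := fun g => by
    rw [Derivation.leibniz, ddy_C, smul_zero, add_zero, smul_eq_mul]
  -- The index `j₀` says whether the chart contains `y = 0` or `y = ∞`; the index `j` selects the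
  -- coordinate being differentiated.
  fin_cases j₀ <;> fin_cases j
  · have h : C.prodP1.coord (i, 0) / C.prodP1.coord (i₀, 0)
        = RatFunc.C (C.coord i / C.coord i₀) := by
      simp [prodP1]
    change (C.prodP1.reindex e).IsRegularAt p
      (_ * ddy (C.prodP1.coord (i, 0) / C.prodP1.coord (i₀, 0)))
    rw [h, ddy_C, mul_zero]
    exact HasValue.zero.isRegularAt
  · have h : C.prodP1.coord (i, 1) / C.prodP1.coord (i₀, 0)
        = RatFunc.C (C.coord i / C.coord i₀) * RatFunc.X := by
      simp [prodP1]
      ring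
    have hr := ((hconst α).mul (hreg' (i, 0))).add ((hconst β).mul (hreg' (i, 1)))
    change (C.prodP1.reindex e).IsRegularAt p
      (_ * ddy (C.prodP1.coord (i, 1) / C.prodP1.coord (i₀, 0)))
    rw [h, hc, ddy_X]
    convert! hr using 1
    simp [prodP1]
    field_simp
  · have h : C.prodP1.coord (i, 0) / C.prodP1.coord (i₀, 1)
        = RatFunc.C (C.coord i / C.coord i₀) * RatFunc.X⁻¹ := by
      simp [prodP1]
      field_simp
    -- With `y' = 1/y` the field becomes `-(α y'² + β y') ∂_{y'}`, which has no pole at infinity.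
    have hr := ((hconst (-α)).mul ((hreg' (i, 0)).mul (hreg' (i₀, 0)))).add
      ((hconst (-β)).mul (hreg' (i, 0)))
    change (C.prodP1.reindex e).IsRegularAt p
      (_ * ddy (C.prodP1.coord (i, 0) / C.prodP1.coord (i₀, 1)))
    rw [h, hc, hY]
    convert! hr using 1
    simp [prodP1]
    field_simp
    ring
  · have h : C.prodP1.coord (i, 1) / C.prodP1.coord (i₀, 1)
        = RatFunc.C (C.coord i / C.coord i₀) := by
      simp [prodP1]
      field_simp
    change (C.prodP1.reindex e).IsRegularAt p
      (_ * ddy (C.prodP1.coord (i, 1) / C.prodP1.coord (i₀, 1)))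
    rw [h, ddy_C, mul_zero]
    exact HasValue.zero.isRegularAt

end ProjVariety

/-- A vector field with a constant affine normal form on `C × ℙ¹` is regularizable. -/
theorem isRegularizable_of_pullbackField_eq {K : Type*} [Field K] [Algebra ℂ K] {n : ℕ}
    {C : ProjVariety K (Fin (n + 1))} (hsmooth : C.IsSmooth) (hdim : C.dim = 1)
    {X : Derivation ℂ (RatFunc K) (RatFunc K)} {σ : RatFunc K ≃ₐ[ℂ] RatFunc K} {α β : ℂ}
    (h : pullbackField σ X
      = (algebraMap ℂ (RatFunc K) α + algebraMap ℂ (RatFunc K) β * RatFunc.X) • ddy) :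
    IsRegularizable X := by
  have hcard : Fintype.card (Fin (n + 1) × Fin 2) = 2 * n + 1 + 1 := by
    simp
    ring
  let e := (Fintype.equivFinOfCardEq hcard).symm
  refine ⟨RatFunc K, inferInstance, inferInstance, 2 * n + 1, C.prodP1.reindex e, σ,
    (hsmooth.prodP1 hdim).reindex e, ?_⟩
  rw [h]
  exact ProjVariety.isHolomorphic_reindex_prodP1 e α β

end

/-! ### The classification theorem -/

theorem mainTheorem7 {K : Type*} [Field K] [Algebra ℂ K] {n : ℕ}
    (C : ProjVariety K (Fin (n + 1))) (hsmooth : C.IsSmooth) (hdim : C.dim = 1)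
    (X : Derivation ℂ (RatFunc K) (RatFunc K)) (hX : IsTangentToFibration X) :
    (C.prodP1.IsBirationallyIntegrable X ↔
      ∃ (a b c : K) (κ : ℂ),
        X = (RatFunc.C a * RatFunc.X ^ 2 + 2 * RatFunc.C b * RatFunc.X + RatFunc.C c) • ddy ∧
          b ^ 2 - a * c = algebraMap ℂ K (κ ^ 2)) ∧
    (∀ (a b c : K) (κ : ℂ),
      X = (RatFunc.C a * RatFunc.X ^ 2 + 2 * RatFunc.C b * RatFunc.X + RatFunc.C c) • ddy →
      b ^ 2 - a * c = algebraMap ℂ K (κ ^ 2) →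
        (κ ≠ 0 → ∃ φ : Bir (RatFunc K), IsOverBase φ ∧
          pullbackField φ.pullback X
            = (algebraMap ℂ (RatFunc K) (2 * κ) * RatFunc.X) • ddy) ∧
        (κ = 0 → X ≠ 0 → ∃ φ : Bir (RatFunc K), IsOverBase φ ∧
          pullbackField φ.pullback X = ddy)) ∧
    (C.prodP1.IsBirationallyIntegrable X → IsRegularizable X) := by
  have normalForm : ∀ (a b c : K) (κ : ℂ),
      X = (RatFunc.C a * RatFunc.X ^ 2 + 2 * RatFunc.C b * RatFunc.X + RatFunc.C c) • ddy →
      b ^ 2 - a * c = algebraMap ℂ K (κ ^ 2) →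
        (κ ≠ 0 → ∃ φ : Bir (RatFunc K), IsOverBase φ ∧
          pullbackField φ.pullback X
            = (algebraMap ℂ (RatFunc K) (2 * κ) * RatFunc.X) • ddy) ∧
        (κ = 0 → X ≠ 0 → ∃ φ : Bir (RatFunc K), IsOverBase φ ∧
          pullbackField φ.pullback X = ddy) := by
    rintro a b c κ rfl hD
    refine ⟨fun hκ => exists_pullbackField_eq_smul_ddy hκ hD, ?_⟩
    rintro rfl hne
    refine exists_pullbackField_eq_ddy (by simpa using hD) ?_
    by_contra! h
    exact hne (by simp [h.1, h.2.1, h.2.2])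
  refine ⟨⟨fun h => h.exists_quadratic hdim hX, ?_⟩, normalForm, fun h => ?_⟩
  · rintro ⟨a, b, c, κ, rfl, hD⟩
    exact ProjVariety.isBirationallyIntegrable_quadratic hdim hD
  · obtain ⟨a, b, c, κ, habc, hD⟩ := h.exists_quadratic hdim hX
    obtain ⟨h1, h2⟩ := normalForm a b c κ habc hD
    by_cases hκ : κ = 0
    -- The zero field has no normal form among the two, but it is already holomorphic on `C × ℙ¹`.
    · by_cases h0 : X = 0
      · refine isRegularizable_of_pullbackField_eq hsmooth hdim (σ := AlgEquiv.refl) (α := 0)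
          (β := 0) ?_
        ext h
        simp [h0, pullbackField_apply]
      · obtain ⟨φ, -, hφ⟩ := h2 hκ h0
        exact isRegularizable_of_pullbackField_eq hsmooth hdim (α := 1) (β := 0)
          (hφ.trans (by simp))
    · obtain ⟨φ, -, hφ⟩ := h1 hκ
      exact isRegularizable_of_pullbackField_eq hsmooth hdim (α := 0) (β := 2 * κ)
        (hφ.trans (by simp))
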